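/- Let $k$ be an algebraically closed field of characteristic $p>0$ (or of characteristic $0$, with $p^e$ read as $1$). **Setting.** At a closed point $P$ of a nonsingular $3$-fold $W$ over $k$, with completed local ring $\widehat{\mathcal O}=\widehat{\mathcal O}_{W,P}\cong k[[z,x,y]]$ and maximal ideal $\mathfrak m$, consider an idealistic filtration $\mathcal R=\bigoplus_{n\ge 0}(I_n,n)$ (a finitely generated graded $\widehat{\mathcal O}$-algebra of ideals $\widehat{\mathcal O}=I_0\supset I_1\supset\cdots$) with $P\in\mathrm{Sing}(\mathcal R)=\{Q:\mathrm{ord}_Q(I_n)\ge n\ \forall n\}$, and finitely many indexed boundary components $D\in E_{\mathrm{young}}$ through $P$ with multiplicities $m_D\in\mathbb Z_{\ge0}$ and a level $a>0$. It is *in the monomial case with $\tau=1$* (with unique element of the leading generator system at level $p^e$) if there are a regular system of parameters $X=(z,x,y)$ and $h=z^{p^e}+a_1z^{p^e-1}+\dots+a_{p^e}$, $a_i\in k[[x,y]]$, $\mathrm{ord}_P(a_i)>i$, such that: each component $D$ is given by $x_D=0$ with $x_D\in\{x,y\}$ (different $x_D$ for different $D$); $\{(h,p^e)\}$, $h\in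 I_{p^e}$, is a leading generator system; for $M=\prod_Dx_D^{m_D}$ we have $M\in I_a$ and $\sum_D m_D>a$; for each $f\in I_n$ with expansion $f=\sum_b c_bh^b$ ($c_b$ polynomials in $z$ of degree $<p^e$ over $k[[x,y]]$), $x_D^{\lceil m_Dn/a\rceil}\mid c_0$ for all $D$; and $f\in I_n$ implies $\partial^m f/\partial z^m\in I_{\max(0,n-m)}$ for all Hasse derivatives in $z$ with respect to $X$. **Invariants.** Put $\mu(P)=\sum_Dm_D/a$ and $\mu(\xi_D)=m_D/a$, where $\xi_D$ is the generic point of $D$. For $v\in\{P\}\cup\{\xi_D\}$ let $\mathrm{Slope}(v)=\min\{\mathrm{ord}_v(a_{p^e})/p^e,\mu(v)\}$; call $h$ *well-adapted* at $v$ with respect to $X$ if $\mathrm{Slope}(v)=\mu(v)$, or $\mathrm{Slope}(v)<\mu(v)$ and the initial form $\mathrm{In}_v(a_{p^e})$ is not a $p^e$-th power. The invariant $\mathrm H(v)$ is $\mathrm{Slope}(v)$ for a well-adapted $h$ and $X$. The point $P$ (resp. the divisor $D$) is *bad* if $\mathrm H<\mu$ at $P$ (resp. at $\xi_D$), and *good*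 otherwise. Put $\mathrm{ord}_P(M_{\mathrm{tight}})=\sum_D\mathrm H(\xi_D)$ and $\mathrm{ord}_P(M_{\mathrm{usual}})=\mu(P)$. For a bad $D$ and $h$ well-adapted at $\xi_D$, put $w\text{-}\rho_D(P)=\mathrm{res\text{-}ord}_P^{(p^e)}(\mathrm{In}_{\xi_D}(a_{p^e}))/p^e-\mathrm{ord}_P(M_{\mathrm{tight}})$, where $\mathrm{res\text{-}ord}_P^{(p^e)}$ is the lowest degree of the nonzero terms that are not $p^e$-th powers. Let $$\mathrm{inv}_{\mathrm{MON},\heartsuit}(P)=\mathrm H(P)-\mathrm{ord}_P(M_{\mathrm{tight}}).$$ Let $A$ be the word of the numbers $w\text{-}\rho_D(P)$, $D$ bad, in increasing order ($A=0$ if one of them is $0$ or there is no bad $D$), and $B=\mathrm{ord}_P(M_{\mathrm{usual}})-\mathrm{ord}_P(M_{\mathrm{tight}})$. With the dictionary order on words, let $\mathrm{inv}_{\mathrm{MON},\spadesuit}(P)=\mathrm{lex}\{A,B\}$ be the pair (smaller word, larger word), replaced by the smallest pair $0$ if $A=0$ or $B=0$; pairs are ordered lexicographically. A pair is $>$ a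 word $C$ if $\min\{A,B\}>C$ or $\min\{A,B\}=C\ne0$, and $<C$ if $\min\{A,B\}<C$. The point $P$ is in configuration ③ if exactly one component of $E_{\mathrm{young}}$ passes through $P$ and it is bad, in configuration ④ (resp. ⑤) if exactly two components pass through $P$ and exactly one is bad (resp. both are bad). **Algorithm.** As long as $\mathrm{inv}_{\mathrm{MON},\spadesuit}(P)\ne0$: if $\dim\mathrm{Sing}(\mathcal R)_P=1$, blow up a curve $V(z,x_D)\subset\mathrm{Sing}(\mathcal R)_P$, where $(z,x,y)$ is such that $h$ is well-adapted simultaneously at $P$ and all $\xi_D$; if there are two such curves, choose the $D$ with the larger $\mathrm H(\xi_D)$, and in case of equality the $D$ with the larger index. Otherwise blow up $P$. At a closed point over $P$, with exceptional equation $u$, the new filtration is generated by all $(\pi^*f/u^n,n)$ with $f\in I_n$; the new components are the strict transforms and the exceptional divisor (with the largest index), each as far as it passes through the point; and $(M,a)$ is replaced by $(\pi^*M/u^a,a)$ up to units. **Proposition (eventual decrease).** Let $P=P_0\leftarrow\widetilde P=P_1\leftarrow\cdots\leftarrow P_n$, $n\ge1$, be closed points in successive transformations of the algorithm, all in the monomial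 case with $\tau=1$ and with the same $e$ (i.e. the invariant $\sigma$ stays the same). Suppose that the first transformation makes the invariant jump up, $$\mathrm{inv}_{\mathrm{MON},\spadesuit}(P)<\mathrm{inv}_{\mathrm{MON},\spadesuit}(\widetilde P)$$ (this is known to happen only if the center is the point $P$, which is bad and in configuration ④ or ⑤, and $\widetilde P$ is in configuration ③), and let $P^\sharp=P_n$ be the first point after $P$ in configuration ④ or ⑤. Then $$\mathrm{inv}_{\mathrm{MON},\spadesuit}(P)>\mathrm{inv}_{\mathrm{MON},\heartsuit}(P)>\mathrm{inv}_{\mathrm{MON},\spadesuit}(P^\sharp),$$ and in particular $\mathrm{inv}_{\mathrm{MON},\spadesuit}(P)>\mathrm{inv}_{\mathrm{MON},\spadesuit}(P^\sharp)$. -/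

import Mathlib

noncomputable section

namespace KM

open IsLocalRing

/-- The power series ring `k[[x, y]]`. -/
abbrev Base (k : Type*) [Field k] : Type _ := MvPowerSeries (Fin 2) k

/-- The completed local ring `k[[x, y]][[z]] = k[[z, x, y]]` of a nonsingular three-dimensional
variety over `k` at a closed point (identified with a power series ring by one fixed, but
otherwise irrelevant, regular system of parameters). -/
abbrev Loc (k : Type*) [Field k] : Type _ := PowerSeries (Base k)

instance instIsLocalRingLoc (k : Type*) [Field k] : IsLocalRing (Loc k) :=
  inferInstanceAs (IsLocalRing (MvPowerSeries Unit (Base k)))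

/-- A regular system of parameters `(z, x, y)` of the complete local ring, given as the
`k`-automorphism which sends the three variables to `z`, `x`, `y`. -/
abbrev Coord (k : Type*) [Field k] : Type _ := Loc k ≃ₐ[k] Loc k

namespace Coord

variable {k : Type*} [Field k]

/-- The parameter `z`. -/
def z (X : Coord k) : Loc k := X PowerSeries.X

/-- The parameters `x` (index `0`) and `y` (index `1`). -/
def xy (X : Coord k) (j : Fin 2) : Loc k := X (PowerSeries.C (MvPowerSeries.X j : Base k))

end Coord

/-- An idealistic filtration (of i.f.g. type) `⊕ₙ (Iₙ, n)` on a ring: a decreasing sequence of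
ideals with `I₀` the unit ideal, for which `⊕ₙ Iₙ` is a graded algebra generated by finitely many
homogeneous elements. -/
structure IdealisticFiltration (A : Type*) [CommRing A] where
  ideal : ℕ → Ideal A
  ideal_zero : ideal 0 = ⊤
  antitone : Antitone ideal
  mul_le : ∀ m n, ideal m * ideal n ≤ ideal (m + n)
  fg : ∃ S : Finset (ℕ × A), (∀ s ∈ S, s.2 ∈ ideal s.1) ∧
    ∀ n, ideal n = Ideal.span {g | ∃ t : Multiset (ℕ × A), (∀ s ∈ t, s ∈ S) ∧
      (t.map Prod.fst).sum = n ∧ (t.map Prod.snd).prod = g}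

/-- The singular locus: all primes `q` with `ord_q(Iₙ) ≥ n` for every `n`. -/
def IdealisticFiltration.Sing {A : Type*} [CommRing A] (R : IdealisticFiltration A) :
    Set (PrimeSpectrum A) :=
  {q | ∀ n, (R.ideal n).map (algebraMap A (Localization.AtPrime q.asIdeal)) ≤
    maximalIdeal (Localization.AtPrime q.asIdeal) ^ n}

/-- The data at a closed point `P`: the idealistic filtration; the indices of the components of
`E_young` through `P`; the ideals of these components; and the monomial `M = ∏ x_D ^ m_D`
together with its level `a`. (The values of `div` and `mult` outside `bdry` are irrelevant.) -/
structure Triplet (k : Type*) [Field k] where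
  R : IdealisticFiltration (Loc k)
  bdry : Finset ℕ
  div : ℕ → Ideal (Loc k)
  mult : ℕ → ℕ
  level : ℕ

/-- The places at which orders are taken: the closed point `P`, and the generic point `ξ_D` of a
boundary component `D`. -/
inductive Place where
  | pt : Place
  | gen (D : ℕ) : Place

/-- The Hasse derivative `∂ⁿ/∂zⁿ` on `k[[x, y]][[z]]`. -/
def hasseZ {k : Type*} [Field k] (n : ℕ) (f : Loc k) : Loc k :=
  PowerSeries.mk fun m => ((m + n).choose n : Base k) * PowerSeries.coeff (m + n) f

/-- The invariant `μ`: `μ(P) = ∑ m_D / a` and `μ(ξ_D) = m_D / a`. -/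
def mu {k : Type*} [Field k] (T : Triplet k) : Place → ℚ
  | .pt => (∑ D ∈ T.bdry, (T.mult D : ℚ)) / T.level
  | .gen D => (T.mult D : ℚ) / T.level

/-- A regular system of parameters `X = (z, x, y)` and an element
`h = z^(p^e) + a₁ z^(p^e-1) + ⋯ + a_(p^e)` in Weierstrass form, with `aᵢ ∈ k[[x, y]]`, such that
`(h, p^e)` is the unique element of a leading generator system and such that all the conditions
of the setting of the monomial case with `τ = 1` hold.
The polynomial `W` over `k[[x, y]]` is `h` written in the parameters `X`. -/
structure Presentation {k : Type*} [Field k] (p e : ℕ) (T : Triplet k) where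
  X : Coord k
  W : Polynomial (Base k)
  /-- `slot D` tells which of `x` (`0`) and `y` (`1`) is the defining equation `x_D` of `D`. -/
  slot : ℕ → Fin 2
  slot_injOn : Set.InjOn slot (T.bdry : Set ℕ)
  div_eq : ∀ D ∈ T.bdry, T.div D = Ideal.span {X.xy (slot D)}
  monic : W.Monic
  natDegree_eq : W.natDegree = p ^ e
  lt_order : ∀ i ∈ Finset.Icc 1 (p ^ e), (i : ℕ∞) < (W.coeff (p ^ e - i)).order
  h_mem : X (W : Loc k) ∈ T.R.ideal (p ^ e)
  /-- Leading generator system: for every `j`, the pure part of degree `p^j` of the leading algebra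
  (the initial forms of elements of level `p^j` which are `p^j`-th powers of linear forms)
  vanishes for `j < e`, and is spanned by the initial form of `h^(p^(j-e))` for `j ≥ e`. -/
  lgs : ∀ j, ∀ f ∈ T.R.ideal (p ^ j), ∀ l ∈ maximalIdeal (Loc k),
    f - l ^ p ^ j ∈ maximalIdeal (Loc k) ^ (p ^ j + 1) →
    (j < e → f ∈ maximalIdeal (Loc k) ^ (p ^ j + 1)) ∧
    (e ≤ j → ∃ c : k, f - c • X (W : Loc k) ^ p ^ (j - e) ∈
      maximalIdeal (Loc k) ^ (p ^ j + 1))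
  level_pos : 0 < T.level
  level_lt : T.level < ∑ D ∈ T.bdry, T.mult D
  monomial_mem : ∏ D ∈ T.bdry, X.xy (slot D) ^ T.mult D ∈ T.R.ideal T.level
  /-- If `f = ∑_b c_b h^b` is the expansion of `(f, n)`, where the `c_b` are polynomials in `z` of
  degree `< p^e` over `k[[x, y]]`, then `(M^(1/a))^n` divides `c₀`. Here `c₀` is written as the
  remainder `r` of the Weierstrass division of `f` by `h`. -/
  rem_dvd : ∀ (n : ℕ) (f q : Loc k) (r : Polynomial (Base k)), X f ∈ T.R.ideal n →
    r.degree < (p ^ e : ℕ) → f = q * (W : Loc k) + (r : Loc k) → ∀ D ∈ T.bdry,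
    PowerSeries.C (MvPowerSeries.X (slot D) : Base k) ^ ⌈(T.mult D : ℚ) * n / T.level⌉₊ ∣
      (r : Loc k)
  /-- The filtration is closed under partial (Hasse) differentiation with respect to `z`. -/
  hasse_mem : ∀ (n m : ℕ) (f : Loc k), X f ∈ T.R.ideal n → X (hasseZ m f) ∈ T.R.ideal (n - m)

/-- The point lies in the singular locus, and the triplet is in the monomial case with `τ = 1`
there, the unique element of the leading generator system being at level `p^e`. -/
def InMonomialCase {k : Type*} [Field k] (p e : ℕ) (T : Triplet k) : Prop :=
  closedPoint (Loc k) ∈ T.R.Sing ∧ Nonempty (Presentation p e T)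

/-- The initial form of a power series in `x, y` with respect to given weights of `x` and `y`. -/
def initialForm {k : Type*} [Field k] (w : Fin 2 → ℕ) (f : Base k) : Base k :=
  MvPowerSeries.weightedHomogeneousComponent w (f.weightedOrder w).toNat f

/-- The residual order `res-ord^(q)` at the point: the lowest degree of the nonzero terms which
are not `q`-th powers. -/
def resOrd {k : Type*} [Field k] (q : ℕ) (f : Base k) : ℕ :=
  sInf {d | ∃ n : Fin 2 →₀ ℕ, MvPowerSeries.coeff n f ≠ 0 ∧
    (¬ ∃ g : Base k, g ^ q = MvPowerSeries.monomial n (MvPowerSeries.coeff n f)) ∧ n.degree = d}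

namespace Presentation

variable {k : Type*} [Field k] {p e : ℕ} {T : Triplet k}

/-- The last coefficient `a_(p^e)` of `h`. -/
def aLast (H : Presentation p e T) : Base k := H.W.coeff 0

/-- The weights of `x, y` computing the order at a place: `(1, 1)` for `P`, and the weight `1` for
`x_D` and `0` for the other variable for `ξ_D`. -/
def wt (H : Presentation p e T) : Place → Fin 2 → ℕ
  | .pt => fun _ => 1
  | .gen D => Pi.single (H.slot D) 1

/-- `Slope = min {ord(a_(p^e)) / p^e, μ}` at a place, where `ord 0 = ∞`. -/
def slope (H : Presentation p e T) (v : Place) : ℚ :=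
  open Classical in
  if H.aLast = 0 then mu T v
  else min (((H.aLast.weightedOrder (H.wt v)).toNat : ℚ) / (p : ℚ) ^ e) (mu T v)

/-- `h` is well-adapted at a place with respect to `X`: either the slope is `μ`, or it is smaller
(hence equal to `ord(a_(p^e)) / p^e`) and the initial form of `a_(p^e)` is not a `p^e`-th power. -/
def WellAdapted (H : Presentation p e T) (v : Place) : Prop :=
  H.slope v = mu T v ∨
    (H.slope v < mu T v ∧ ¬ ∃ g : Base k, g ^ p ^ e = initialForm (H.wt v) H.aLast)

/-- `h` is well-adapted simultaneously at `P` and at all the components of `E_young`. -/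
def WellAdaptedEverywhere (H : Presentation p e T) : Prop :=
  H.WellAdapted .pt ∧ ∀ D ∈ T.bdry, H.WellAdapted (.gen D)

end Presentation

section Invariants

variable {k : Type*} [Field k] (p e : ℕ) (T : Triplet k)

/-- The invariant `H` at a place: the slope of any well-adapted `h` and `X`. -/
def invH (v : Place) : ℚ :=
  Classical.epsilon fun s => ∃ H : Presentation p e T, H.WellAdapted v ∧ s = H.slope v

/-- `P` is a bad point, resp. `D` is a bad divisor, if `H < μ` there; otherwise it is good. -/
def IsBad (v : Place) : Prop := invH p e T v < mu T v

open Classical in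
/-- The bad components of `E_young` through the point. -/
def badDivisors : Finset ℕ := T.bdry.filter fun D => IsBad p e T (.gen D)

/-- `ord_P(M_tight)`. -/
def ordTight : ℚ := ∑ D ∈ T.bdry, invH p e T (.gen D)

/-- `res-ord_P(x^r g_x)` for a bad divisor `D = {x = 0}`, where `x^r g_x` is the initial form of
`a_(p^e)` at `ξ_D` and `h` is well-adapted at `ξ_D` with respect to `X`. -/
def residual (D : ℕ) : ℕ :=
  Classical.epsilon fun s => ∃ H : Presentation p e T, H.WellAdapted (.gen D) ∧
    s = resOrd (p ^ e) (initialForm (H.wt (.gen D)) H.aLast)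

/-- The invariant `w-ρ_D(P)` of a bad divisor `D`. -/
def wRho (D : ℕ) : ℚ := (residual p e T D : ℚ) / (p : ℚ) ^ e - ordTight p e T

/-- The invariant `inv_{MON,♡}(P) = H(P) - ord_P(M_tight)`. -/
def invHeart : ℚ := invH p e T .pt - ordTight p e T

open Classical in
/-- The word `A`: the numbers `w-ρ_D(P)` of the bad divisors in increasing order. It is the word
`0`, i.e. `[0]`, if there is no bad divisor or if one of the letters is `0`. Words carry the
lexicographical (dictionary) order. -/
def wordA : List ℚ :=
  if badDivisors p e T = ∅ ∨ ∃ D ∈ badDivisors p e T, wRho p e T D = 0 then [0]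
  else ((badDivisors p e T).val.map (wRho p e T)).sort

/-- The one-letter word `B = ord_P(M_usual) - ord_P(M_tight)`. -/
def wordB : List ℚ := [mu T .pt - ordTight p e T]

/-- Pairs of words with the lexicographical order. -/
abbrev WordPair : Type := List ℚ ×ₗ List ℚ

/-- The smallest pair. -/
def zeroPair : WordPair := toLex ([0], [0])

/-- The invariant `inv_{MON,♠}(P) = lex{A, B}`: the smaller one of the words `A`, `B` followed by
the larger one; it is the zero pair if one of the words is `0`. -/
def invSpade : WordPair :=
  if wordA p e T = [0] ∨ wordB p e T = [0] then zeroPair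
  else toLex (min (wordA p e T) (wordB p e T), max (wordA p e T) (wordB p e T))

end Invariants

/-- Comparison of pairs with words: the pair is larger than the word. -/
def PairGtWord (S : WordPair) (C : List ℚ) : Prop :=
  C < (ofLex S).1 ∨ ((ofLex S).1 = C ∧ C ≠ [0])

/-- Comparison of pairs with words: the pair is smaller than the word. -/
def PairLtWord (S : WordPair) (C : List ℚ) : Prop := (ofLex S).1 < C

/-- Configuration ④: two components of `E_young` pass through `P`, exactly one of them bad. -/
def Config4 {k : Type*} [Field k] (p e : ℕ) (T : Triplet k) : Prop :=
  T.bdry.card = 2 ∧ (badDivisors p e T).card = 1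

/-- Configuration ⑤: two components of `E_young` pass through `P`, both of them bad. -/
def Config5 {k : Type*} [Field k] (p e : ℕ) (T : Triplet k) : Prop :=
  T.bdry.card = 2 ∧ (badDivisors p e T).card = 2

/-- `φ` is the homomorphism of completed local rings at a closed point `P'` over `P` of the blow-up
with center `c`, and `u` is a local equation of the exceptional divisor at `P'`. The center is `P`
or a nonsingular curve `V(z, x)`; for suitable regular systems of parameters `(z, x, y)` at `P`
and `(z', x', y')` at `P'` one has `z = x' z'`, `x = x' = u`, and `y = x' y'` (point), respectively
`y = y'` (curve). -/
def IsBlowup {k : Type*} [Field k] (φ : Loc k →ₐ[k] Loc k) (c : Ideal (Loc k)) (u : Loc k) :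
    Prop :=
  ∃ X X' : Coord k, u = X'.xy 0 ∧ φ (X.xy 0) = X'.xy 0 ∧ φ X.z = X'.xy 0 * X'.z ∧
    ((c = maximalIdeal (Loc k) ∧ φ (X.xy 1) = X'.xy 0 * X'.xy 1) ∨
      (c = Ideal.span {X.z, X.xy 0} ∧ φ (X.xy 1) = X'.xy 1))

/-- The strict transform of the divisor with ideal `I`: the elements `g` such that `u^j g` lies in
the extension of `I` for some `j`. -/
def strictTransform {k : Type*} [Field k] (φ : Loc k →ₐ[k] Loc k) (u : Loc k)
    (I : Ideal (Loc k)) : Ideal (Loc k) where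
  carrier := {g | ∃ j : ℕ, u ^ j * g ∈ I.map φ}
  zero_mem' := ⟨0, by simp⟩
  add_mem' := by
    rintro a b ⟨i, hi⟩ ⟨j, hj⟩
    refine ⟨i + j, ?_⟩
    have h1 := Ideal.mul_mem_left (I.map φ) (u ^ j) hi
    have h2 := Ideal.mul_mem_left (I.map φ) (u ^ i) hj
    have h3 : u ^ (i + j) * (a + b) = u ^ j * (u ^ i * a) + u ^ i * (u ^ j * b) := by ring
    rw [h3]
    exact Ideal.add_mem _ h1 h2
  smul_mem' := by
    rintro c a ⟨i, hi⟩
    refine ⟨i, ?_⟩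
    have h1 := Ideal.mul_mem_left (I.map φ) c hi
    have h3 : u ^ i * (c • a) = c * (u ^ i * a) := by rw [smul_eq_mul]; ring
    rw [h3]
    exact h1

open Classical in
/-- `T'` is the transform of `T` at a closed point over `P` of the blow-up with center `c`.
* The new filtration is generated by the elements `(φ(f) / u^m, m)` with `(f, m)` in the old one.
* The components of `E_young` through the new point are the strict transforms of the old ones, as
  far as they pass through it, and the exceptional divisor, whose index `N` is the largest.
* The monomial `(M, a)` becomes `(φ(M) / u^a, a)` (up to a unit). -/
def IsTransform {k : Type*} [Field k] (T T' : Triplet k) (c : Ideal (Loc k)) : Prop :=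
  ∃ (φ : Loc k →ₐ[k] Loc k) (u : Loc k) (N : ℕ), IsBlowup φ c u ∧
    (∀ n, T'.R.ideal n = ⨆ m ≥ n, Ideal.span {g | ∃ f ∈ T.R.ideal m, φ f = u ^ m * g}) ∧
    (∀ D ∈ T.bdry, D < N) ∧
    T'.bdry = insert N (T.bdry.filter fun D => strictTransform φ u (T.div D) ≠ ⊤) ∧
    T'.div N = Ideal.span {u} ∧
    (∀ D ∈ T.bdry, D ∈ T'.bdry → T'.div D = strictTransform φ u (T.div D)) ∧
    T'.level = T.level ∧
    (∀ D ∈ T.bdry, D ∈ T'.bdry → T'.mult D = T.mult D) ∧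
    T'.mult N + T.level = ∑ D ∈ T.bdry.filter (fun D => T.div D ≤ c), T.mult D

/-- The dimension of the singular locus at the point. -/
def singDim {k : Type*} [Field k] (T : Triplet k) : WithBot ℕ∞ :=
  Order.krullDim T.R.Sing

/-- `c` is the curve center chosen by the algorithm. It is `V(z, x_D)`, contained in the singular
locus, where `(z, x, y)` is a regular system of parameters with respect to which `h` is well-adapted
simultaneously at `P` and at all components. If `V(z, x_D')` is contained in the singular locus as
well for the other component `D'`, then `H(ξ_D) > H(ξ_D')`, or these are equal and `D` has the
bigger index. -/
def IsCurveCenter {k : Type*} [Field k] (p e : ℕ) (T : Triplet k) (c : Ideal (Loc k)) : Prop :=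
  ∃ H : Presentation p e T, H.WellAdaptedEverywhere ∧ ∃ D ∈ T.bdry,
    c = Ideal.span {H.X.z, H.X.xy (H.slot D)} ∧ (∃ q ∈ T.R.Sing, q.asIdeal = c) ∧
    ∀ D' ∈ T.bdry, D' ≠ D →
      (∃ q ∈ T.R.Sing, q.asIdeal = Ideal.span {H.X.z, H.X.xy (H.slot D')}) →
      invH p e T (.gen D') < invH p e T (.gen D) ∨
        (invH p e T (.gen D') = invH p e T (.gen D) ∧ D' < D)

/-- One transformation `P ← P'` of the algorithm, with `T` the data at `P` and `T'` the data at the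
closed point `P'` over `P`. The algorithm goes on only if `inv_{MON,♠}(P) ≠ 0`; if the singular locus
has dimension `1` at `P`, it blows up a curve, otherwise it blows up the point `P`. -/
def AlgorithmStep {k : Type*} [Field k] (p e : ℕ) (T T' : Triplet k) : Prop :=
  invSpade p e T ≠ zeroPair ∧
    ((singDim T = 1 ∧ ∃ c, IsCurveCenter p e T c ∧ IsTransform T T' c) ∨
      (singDim T ≠ 1 ∧ IsTransform T T' (maximalIdeal (Loc k))))

end KM

end

/-!
Throughout, `q = p ^ e`, and `a_j` denotes the coefficient of `z ^ (q - j)` in `h`.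

**The invariants.** Closedness under Hasse derivatives and the condition on remainders force `a_j`, for
`0 < j < q`, to be divisible by the powers of the `x_D` prescribed by `j μ`
(`Presentation.coeff_mem_gen`). Hence a translation `z ↦ z + b` changes `a_q` only by `b ^ q`
up to terms that are invisible below `q μ`, and all `q`-th powers among the relevant monomials of `a_q` can
be removed at once: there is a presentation which is clean, thus well-adapted, at all places
(`Presentation.exists_clean`). Dividing one Weierstrass polynomial by another and setting `z = 0` shows
that `H(P)`, `H(ξ_D)` and the residual order do not depend on the presentation: at a bad `D`,
`q H(ξ_D)` is the lowest exponent `r` of `x_D` in `a_q`, and the residual order is `r + l`, where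
`x_D ^ r x_{D'} ^ l` is the first monomial of the lowest row that is not a `q`-th power
(`RowData`, `invH_pt`, `invH_gen_of_mem`, `invH_gen_of_rowData`). The comparison needs only part of the
structure of a presentation of the triplet after the blow-up, a `Frame`, and a frame is what
the equation of a blow-up produces (`Presentation.exists_point_frame`, `Presentation.exists_curve_frame`).

**One step.** Let `δ = inv_♡(P)`. Every letter of `A` and the letter of `B` is at least `δ`, and `δ > 0` as
long as the algorithm goes on (`invHeart_le_words`, `invHeart_pos`); this gives the first inequality.
A curve blow-up divides `a_q` by `x_D ^ q` and preserves `inv_♠` (`curve_step_invariants`). A point blow-up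
(`point_step`) makes the letter of an old component that still passes through the point drop by exactly
`δ`. The letter of the exceptional divisor is governed by the order of vanishing, modulo `q`-th powers,
of the lowest form of `a_q` at a point of the exceptional line. It is at most `δ` if an old component
passes through the new point, or if there was only one component, and it is smaller than `2 δ` in the
remaining case, two components neither of which passes through the new point: this is the
characteristic-`p` heart of the matter (`exists_taylor_coeff_lt`), a bound on the vanishing order of a form
`x ^ R y ^ S g(x, y)` modulo `q`-th powers, with slopes at most `1` because otherwise the singular locus
would contain a curve (`singDim_eq_one`).

**The sequence.** If a jump occurs, then no old component passes through the new point, and the only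
letter there is smaller than `2 δ` (`bdry_eq_singleton_of_jump`). This letter does not grow as long as there
is a single component (`wRho_step`). When a second component appears, the letter `w-ρ < 2 δ` is
replaced by `w-ρ - δ'` and by a number at most `δ'`, where `δ'` is the value of `inv_♡` just before. One of
these two is smaller than `δ` (`pairLtWord_of_step`), so `inv_♠(P^♯) < δ ≤ inv_♠(P)`.
-/

noncomputable section

namespace KM

open IsLocalRing

/-! ### Weighted orders and `q`-th powers in `k[[x, y]]` -/

section Base

variable {k : Type*} [Field k]

theorem weight_apply (w : Fin 2 → ℕ) (n : Fin 2 →₀ ℕ) :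
    Finsupp.weight w n = n 0 * w 0 + n 1 * w 1 := by
  rw [Finsupp.weight_apply, Finsupp.sum_fintype _ _ (by simp)]
  simp [Fin.sum_univ_two]

theorem weight_single (i : Fin 2) (n : Fin 2 →₀ ℕ) :
    Finsupp.weight (Pi.single i 1 : Fin 2 → ℕ) n = n i := by
  rw [weight_apply]
  fin_cases i <;> simp

theorem weight_one (n : Fin 2 →₀ ℕ) :
    Finsupp.weight (fun _ : Fin 2 => 1) n = n 0 + n 1 := by
  simp [weight_apply]

/-- The ideal of the power series all of whose exponents have weight at least `s`. The bound is a
rational number, so that the bounds `j * μ` need no rounding. -/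
def ordIdeal (k : Type*) [Field k] (w : Fin 2 → ℕ) (s : ℚ) : Ideal (Base k) where
  carrier := {f | ∀ n, MvPowerSeries.coeff n f ≠ 0 → s ≤ (Finsupp.weight w n : ℕ)}
  zero_mem' := by intro n hn; simp at hn
  add_mem' := by
    intro a b ha hb n hn
    by_cases h : MvPowerSeries.coeff n a = 0
    · exact hb n (by simpa [h] using hn)
    · exact ha n h
  smul_mem' := by
    classical
    intro c f hf n hn
    rw [smul_eq_mul, MvPowerSeries.coeff_mul] at hn
    obtain ⟨x, hx, hne⟩ := Finset.exists_ne_zero_of_sum_ne_zero hn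
    have h1 := hf x.2 (right_ne_zero_of_mul hne)
    have h2 := Finset.HasAntidiagonal.mem_antidiagonal.1 hx
    rw [← h2, map_add]
    push_cast
    have : (0 : ℚ) ≤ (Finsupp.weight w x.1 : ℕ) := Nat.cast_nonneg _
    linarith

theorem mem_ordIdeal {w : Fin 2 → ℕ} {s : ℚ} {f : Base k} :
    f ∈ ordIdeal k w s ↔
      ∀ n, MvPowerSeries.coeff n f ≠ 0 → s ≤ (Finsupp.weight w n : ℕ) := Iff.rfl

theorem coeff_eq_zero_of_mem {w : Fin 2 → ℕ} {s : ℚ} {f : Base k} (hf : f ∈ ordIdeal k w s)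
    {n : Fin 2 →₀ ℕ} (hn : ((Finsupp.weight w n : ℕ) : ℚ) < s) :
    MvPowerSeries.coeff n f = 0 := by
  by_contra h
  exact absurd (hf n h) (not_le.2 hn)

theorem ordIdeal_anti {w : Fin 2 → ℕ} {s t : ℚ} (h : s ≤ t) :
    ordIdeal k w t ≤ ordIdeal k w s := fun _ hf n hn => h.trans (hf n hn)

theorem mem_ordIdeal_of_nonpos {w : Fin 2 → ℕ} {s : ℚ} (h : s ≤ 0) (f : Base k) :
    f ∈ ordIdeal k w s := fun _ _ => h.trans (Nat.cast_nonneg _)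

theorem mul_mem_ordIdeal {w : Fin 2 → ℕ} {s t : ℚ} {f g : Base k} (hf : f ∈ ordIdeal k w s)
    (hg : g ∈ ordIdeal k w t) : f * g ∈ ordIdeal k w (s + t) := by
  classical
  intro n hn
  rw [MvPowerSeries.coeff_mul] at hn
  obtain ⟨x, hx, hne⟩ := Finset.exists_ne_zero_of_sum_ne_zero hn
  have h1 := hf x.1 (left_ne_zero_of_mul hne)
  have h2 := hg x.2 (right_ne_zero_of_mul hne)
  rw [← Finset.HasAntidiagonal.mem_antidiagonal.1 hx, map_add]
  push_cast
  linarith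

theorem pow_mem_ordIdeal {w : Fin 2 → ℕ} {s : ℚ} {f : Base k} (hf : f ∈ ordIdeal k w s) (m : ℕ) :
    f ^ m ∈ ordIdeal k w (m * s) := by
  induction m with
  | zero => exact mem_ordIdeal_of_nonpos (by simp) _
  | succ m ih =>
    rw [pow_succ]
    have := mul_mem_ordIdeal ih hf
    push_cast
    rwa [add_mul, one_mul]

theorem X_pow_dvd_iff_mem {i : Fin 2} {m : ℕ} {f : Base k} :
    (MvPowerSeries.X i : Base k) ^ m ∣ f ↔ f ∈ ordIdeal k (Pi.single i 1) m := by
  rw [MvPowerSeries.X_pow_dvd_iff, mem_ordIdeal]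
  refine forall_congr' fun n => ?_
  rw [weight_single, Nat.cast_le, ← not_lt]
  exact not_imp_not.symm.trans (by simp)

theorem X_dvd_iff_mem {i : Fin 2} {f : Base k} :
    (MvPowerSeries.X i : Base k) ∣ f ↔ f ∈ ordIdeal k (Pi.single i 1) 1 := by
  have := X_pow_dvd_iff_mem (i := i) (m := 1) (f := f)
  rwa [pow_one, Nat.cast_one] at this

theorem coeff_X_pow_mul (i : Fin 2) (m : ℕ) (g : Base k) (n : Fin 2 →₀ ℕ) :
    MvPowerSeries.coeff (Finsupp.single i m + n) (MvPowerSeries.X i ^ m * g) =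
      MvPowerSeries.coeff n g := by
  rw [MvPowerSeries.X_pow_eq, MvPowerSeries.coeff_add_monomial_mul, one_mul]

theorem mem_of_X_pow_mul_mem {w : Fin 2 → ℕ} {s : ℚ} {i : Fin 2} {m : ℕ} {g : Base k}
    (h : MvPowerSeries.X i ^ m * g ∈ ordIdeal k w (s + m * w i)) : g ∈ ordIdeal k w s := by
  intro n hn
  have := h (Finsupp.single i m + n) (by rwa [coeff_X_pow_mul])
  rw [map_add, Finsupp.weight_single] at this
  push_cast [smul_eq_mul] at this
  linarith

theorem mem_ordIdeal_of_lt_order {m : ℕ} {f : Base k} (h : (m : ℕ∞) < f.order) :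
    f ∈ ordIdeal k (fun _ => 1) (m + 1) := by
  intro n hn
  have h1 := h.trans_le (MvPowerSeries.order_le hn)
  rw [weight_one]
  have h2 : m < n.degree := by exact_mod_cast h1
  rw [Finsupp.degree_eq_sum, Fin.sum_univ_two] at h2
  exact_mod_cast h2

theorem lt_order_of_mem {m : ℕ} {f : Base k} (h : f ∈ ordIdeal k (fun _ => 1) (m + 1)) :
    (m : ℕ∞) < f.order := by
  refine lt_of_lt_of_le (b := ((m + 1 : ℕ) : ℕ∞)) (by exact_mod_cast Nat.lt_succ_self m) ?_
  refine MvPowerSeries.nat_le_order fun d hd => ?_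
  refine coeff_eq_zero_of_mem h ?_
  rw [weight_one]
  rw [Finsupp.degree_eq_sum, Fin.sum_univ_two] at hd
  exact_mod_cast hd

theorem constantCoeff_eq_zero_iff_mem {f : Base k} :
    MvPowerSeries.constantCoeff f = 0 ↔ f ∈ ordIdeal k (fun _ => 1) 1 := by
  constructor
  · intro h n hn
    rw [weight_one]
    have : n ≠ 0 := by
      rintro rfl
      exact hn (by simpa using h)
    by_contra hlt
    have h0 : n 0 + n 1 < 1 := by exact_mod_cast not_le.1 hlt
    apply this
    ext j
    fin_cases j <;> simp <;> omega
  · intro h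
    have := coeff_eq_zero_of_mem h (n := 0) (by simp)
    simpa using this

/-- A power series without constant term is a combination of the variables, the coefficients having
an order which is smaller by one. -/
theorem exists_eq_X_mul_add {s : ℚ} {f : Base k} (h0 : MvPowerSeries.constantCoeff f = 0)
    (hf : f ∈ ordIdeal k (fun _ => 1) (s + 1)) :
    ∃ g₀ ∈ ordIdeal k (fun _ => 1) s, ∃ g₁ ∈ ordIdeal k (fun _ => 1) s,
      f = MvPowerSeries.X 0 * g₀ + MvPowerSeries.X 1 * g₁ := by
  classical
  let f₁ : Base k := fun n => if n 0 = 0 then MvPowerSeries.coeff n f else 0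
  have hf₁ : ∀ n, MvPowerSeries.coeff n f₁ = if n 0 = 0 then MvPowerSeries.coeff n f else 0 :=
    fun n => rfl
  have h1 : (MvPowerSeries.X 1 : Base k) ∣ f₁ := by
    rw [MvPowerSeries.X_dvd_iff]
    intro n hn
    rw [hf₁]
    split_ifs with h
    · have : n = 0 := by ext j; fin_cases j <;> simp [h, hn]
      rw [this]; simpa using h0
    · rfl
  have h2 : (MvPowerSeries.X 0 : Base k) ∣ f - f₁ := by
    rw [MvPowerSeries.X_dvd_iff]
    intro n hn
    rw [map_sub, hf₁, if_pos hn, sub_self]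
  have h3 : f₁ ∈ ordIdeal k (fun _ => 1) (s + 1) := by
    intro n hn
    rw [hf₁] at hn
    split_ifs at hn with h
    · exact hf n hn
    · exact absurd rfl hn
  obtain ⟨g₁, hg₁⟩ := h1
  obtain ⟨g₀, hg₀⟩ := h2
  refine ⟨g₀, ?_, g₁, ?_, by rw [← hg₀, ← hg₁]; ring⟩
  · refine mem_of_X_pow_mul_mem (i := 0) (m := 1) ?_
    rw [pow_one, ← hg₀]
    simpa using Ideal.sub_mem _ hf h3
  · refine mem_of_X_pow_mul_mem (i := 1) (m := 1) ?_
    rw [pow_one, ← hg₁]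
    simpa using h3

theorem exists_eq_C_add (f : Base k) :
    ∃ c : k, ∃ g₀ g₁ : Base k,
      f = algebraMap k _ c + MvPowerSeries.X 0 * g₀ + MvPowerSeries.X 1 * g₁ := by
  have h0 : MvPowerSeries.constantCoeff
      (f - MvPowerSeries.C (MvPowerSeries.constantCoeff f)) = 0 := by simp
  obtain ⟨g₀, -, g₁, -, h⟩ := exists_eq_X_mul_add (s := -1) h0
    (mem_ordIdeal_of_nonpos (by norm_num) _)
  refine ⟨MvPowerSeries.constantCoeff f, g₀, g₁, ?_⟩
  rw [add_assoc, ← h]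
  change f = MvPowerSeries.C _ + _
  ring

theorem map_mem_pow_of_mem_ordIdeal {R : Type*} [CommRing R] {I : Ideal R} (ψ : Base k →+* R)
    (hψ : ∀ j, ψ (MvPowerSeries.X j) ∈ I) {m : ℕ} {f : Base k}
    (hf : f ∈ ordIdeal k (fun _ => 1) m) : ψ f ∈ I ^ m := by
  induction m generalizing f with
  | zero => simp
  | succ m ih =>
    push_cast at hf
    have h0 : MvPowerSeries.constantCoeff f = 0 :=
      constantCoeff_eq_zero_iff_mem.2 (ordIdeal_anti (by simp) hf)
    obtain ⟨g₀, hg₀, g₁, hg₁, rfl⟩ := exists_eq_X_mul_add h0 hf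
    rw [map_add, map_mul, map_mul, pow_succ']
    exact Ideal.add_mem _ (Ideal.mul_mem_mul (hψ 0) (ih hg₀))
      (Ideal.mul_mem_mul (hψ 1) (ih hg₁))

/-- A `k`-algebra homomorphism on `k[[x, y]]` is determined by the images of the variables, if
these lie in an ideal for which the target is separated. -/
theorem algHom_ext_of_X {R : Type*} [CommRing R] [Algebra k R] {I : Ideal R}
    (hI : ∀ r, (∀ m, r ∈ I ^ m) → r = 0) {α β : Base k →ₐ[k] R}
    (hα : ∀ j, α (MvPowerSeries.X j) ∈ I)
    (h : ∀ j, α (MvPowerSeries.X j) = β (MvPowerSeries.X j)) : α = β := by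
  ext f
  rw [← sub_eq_zero]
  apply hI
  intro m
  induction m generalizing f with
  | zero => simp
  | succ m ih =>
    obtain ⟨c, g₀, g₁, rfl⟩ := exists_eq_C_add f
    simp only [map_add, map_mul, AlgHom.commutes, ← h]
    have h1 : ∀ c s t a b a' b' : R, c + s * a + t * b - (c + s * a' + t * b') =
      s * (a - a') + t * (b - b') := by intros; ring
    rw [h1, pow_succ']
    exact Ideal.add_mem _ (Ideal.mul_mem_mul (hα 0) (ih g₀)) (Ideal.mul_mem_mul (hα 1) (ih g₁))

end Base

section QPower

variable {k : Type*} [Field k] {p : ℕ} [ExpChar k p] {e : ℕ}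

theorem coeff_pow_smul (f : Base k) (n : Fin 2 →₀ ℕ) :
    MvPowerSeries.coeff (p ^ e • n) (f ^ p ^ e) = MvPowerSeries.coeff n f ^ p ^ e := by
  rw [← MvPowerSeries.map_iterateFrobenius_expand p (expChar_ne_zero k p), MvPowerSeries.coeff_map,
    MvPowerSeries.coeff_expand_smul, iterateFrobenius_def]

theorem coeff_pow_eq_zero (f : Base k) {n : Fin 2 →₀ ℕ} {i : Fin 2} (h : ¬ p ^ e ∣ n i) :
    MvPowerSeries.coeff n (f ^ p ^ e) = 0 := by
  rw [← MvPowerSeries.map_iterateFrobenius_expand p (expChar_ne_zero k p), MvPowerSeries.coeff_map,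
    MvPowerSeries.coeff_expand_of_not_dvd _ _ _ h, map_zero]

/-- A power series over an algebraically closed field of exponential characteristic `p` is a
`p ^ e`-th power if all its exponents are divisible by `p ^ e`. -/
theorem exists_pow_eq [IsAlgClosed k] {f : Base k}
    (h : ∀ n, MvPowerSeries.coeff n f ≠ 0 → ∀ i, p ^ e ∣ n i) :
    ∃ g : Base k, g ^ p ^ e = f ∧
      ∀ n, MvPowerSeries.coeff n g ≠ 0 → MvPowerSeries.coeff (p ^ e • n) f ≠ 0 := by
  have hq : 0 < p ^ e := pow_pos (expChar_pos k p) e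
  choose r hr using fun c : k => IsAlgClosed.exists_pow_nat_eq c hq
  let g : Base k := fun n => r (MvPowerSeries.coeff (p ^ e • n) f)
  have hg : ∀ n, MvPowerSeries.coeff n g = r (MvPowerSeries.coeff (p ^ e • n) f) := fun n => rfl
  refine ⟨g, ?_, fun n hn hf => hn ?_⟩
  · ext n
    by_cases hn : ∀ i, p ^ e ∣ n i
    · obtain ⟨m, rfl⟩ : ∃ m : Fin 2 →₀ ℕ, n = p ^ e • m :=
        ⟨n.mapRange (· / p ^ e) (Nat.zero_div _), by
          ext i; simp [Nat.mul_div_cancel' (hn i)]⟩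
      rw [coeff_pow_smul, hg, hr]
    · obtain ⟨i, hi⟩ := not_forall.1 hn
      rw [coeff_pow_eq_zero g hi]
      by_contra hne
      exact hi (h n (Ne.symm hne) i)
  · rw [hg, hf]
    exact pow_eq_zero_iff hq.ne' |>.1 (hr 0)

theorem exists_pow_eq_iff [IsAlgClosed k] {f : Base k} :
    (∃ g : Base k, g ^ p ^ e = f) ↔
      ∀ n, MvPowerSeries.coeff n f ≠ 0 → ∀ i, p ^ e ∣ n i := by
  constructor
  · rintro ⟨g, rfl⟩ n hn i
    by_contra hi
    exact hn (coeff_pow_eq_zero g hi)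
  · intro h
    obtain ⟨g, hg, -⟩ := exists_pow_eq h
    exact ⟨g, hg⟩

theorem coeff_mixed_eq_zero {w : Fin 2 → ℕ} {μ m s : ℚ} {b : Base k} {c : ℕ → Base k}
    (hc : ∀ j ∈ Finset.Ioo 0 (p ^ e), c j ∈ ordIdeal k w (j * μ)) (hb : b ∈ ordIdeal k w m)
    (hs : s < (p : ℚ) ^ e * μ) (hsm : s ≤ (p : ℚ) ^ e * m) {n : Fin 2 →₀ ℕ}
    (hn : (Finsupp.weight w n : ℕ) = s) :
    MvPowerSeries.coeff n (∑ j ∈ Finset.Ioo 0 (p ^ e), c j * b ^ (p ^ e - j)) = 0 := by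
  have hq : (0 : ℚ) < (p : ℚ) ^ e := pow_pos (by exact_mod_cast expChar_pos k p) e
  rw [map_sum]
  refine Finset.sum_eq_zero fun j hj => ?_
  have hj' := Finset.mem_Ioo.1 hj
  refine coeff_eq_zero_of_mem (mul_mem_ordIdeal (hc j hj) (pow_mem_ordIdeal hb _)) ?_
  rw [hn, Nat.cast_sub hj'.2.le]
  push_cast
  have h1 : (0 : ℚ) < j := by exact_mod_cast hj'.1
  have h2 : (0 : ℚ) < (p : ℚ) ^ e - j := by
    rw [sub_pos]; exact_mod_cast hj'.2
  have h3 : s / (p : ℚ) ^ e < μ := by rw [div_lt_iff₀ hq]; linarith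
  have h4 : s / (p : ℚ) ^ e ≤ m := by rw [div_le_iff₀ hq]; linarith
  calc s = j * (s / (p : ℚ) ^ e) + ((p : ℚ) ^ e - j) * (s / (p : ℚ) ^ e) := by
        field_simp; ring
    _ < j * μ + ((p : ℚ) ^ e - j) * m :=
        add_lt_add_of_lt_of_le (mul_lt_mul_of_pos_left h3 h1)
          (mul_le_mul_of_nonneg_left h4 h2.le)

/-- In an equation `L = b ^ q + ∑ c_j b ^ (q - j) + t` in which `c_j` has order at least `j * μ`,
the mixed terms do not matter in weights below `q * μ`: if `L` and `t` have order at least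
`N < q * μ`, then `b` has order at least `N / q`, and in weight `N` the equation reads
`L = b ^ q + t`. -/
theorem coeff_eq_of_level {w : Fin 2 → ℕ} {N : ℕ} {μ : ℚ} (hN : (N : ℚ) < (p : ℚ) ^ e * μ)
    {L b t : Base k} {c : ℕ → Base k} (hL : L ∈ ordIdeal k w N) (ht : t ∈ ordIdeal k w N)
    (hc : ∀ j ∈ Finset.Ioo 0 (p ^ e), c j ∈ ordIdeal k w (j * μ))
    (h : L = b ^ p ^ e + ∑ j ∈ Finset.Ioo 0 (p ^ e), c j * b ^ (p ^ e - j) + t) :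
    b ∈ ordIdeal k w (N / (p : ℚ) ^ e) ∧ ∀ n, Finsupp.weight w n = N →
      MvPowerSeries.coeff n L =
        MvPowerSeries.coeff n (b ^ p ^ e) + MvPowerSeries.coeff n t := by
  have hq : (0 : ℚ) < (p : ℚ) ^ e := pow_pos (by exact_mod_cast expChar_pos k p) e
  -- otherwise the lowest term of `b ^ q` could not be cancelled by anything else in the equation
  have hb : b ∈ ordIdeal k w (N / (p : ℚ) ^ e) := by
    by_contra hcon
    rw [mem_ordIdeal] at hcon
    push Not at hcon
    have hex : ∃ m, ∃ n, MvPowerSeries.coeff n b ≠ 0 ∧ Finsupp.weight w n = m := by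
      obtain ⟨n, hn, -⟩ := hcon
      exact ⟨_, n, hn, rfl⟩
    classical
    obtain ⟨n, hn, hnm⟩ := Nat.find_spec hex
    set m := Nat.find hex with hm
    have hmin : b ∈ ordIdeal k w m := fun n' hn' => by
      exact_mod_cast Nat.find_min' hex ⟨n', hn', rfl⟩
    have hlt : (m : ℚ) < N / (p : ℚ) ^ e := by
      obtain ⟨n', hn', hlt⟩ := hcon
      exact (hmin n' hn').trans_lt hlt
    rw [lt_div_iff₀ hq] at hlt
    have hw : ((Finsupp.weight w (p ^ e • n) : ℕ) : ℚ) = (p : ℚ) ^ e * m := by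
      rw [map_nsmul, hnm]; simp
    have h1 := congrArg (MvPowerSeries.coeff (p ^ e • n)) h
    rw [map_add, map_add, coeff_eq_zero_of_mem hL (by rw [hw]; linarith),
      coeff_eq_zero_of_mem ht (by rw [hw]; linarith),
      coeff_mixed_eq_zero hc hmin (by linarith) le_rfl hw, coeff_pow_smul, add_zero,
      add_zero] at h1
    exact hn (pow_eq_zero_iff (pow_pos (expChar_pos k p) e).ne' |>.1 h1.symm)
  refine ⟨hb, fun n hn => ?_⟩
  have h1 := congrArg (MvPowerSeries.coeff n) h
  rw [map_add, map_add, coeff_mixed_eq_zero hc hb hN (by field_simp; exact le_rfl) (by rw [hn]),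
    add_zero] at h1
  exact h1

end QPower

/-! ### The ring `k[[z, x, y]]` and its regular systems of parameters -/

section Loc

variable {k : Type*} [Field k]

/-- The restriction of a power series in `z, x, y` to `z = 0`. -/
abbrev restrictZ (k : Type*) [Field k] : Loc k →+* Base k := PowerSeries.constantCoeff

theorem isUnit_loc_iff {f : Loc k} :
    IsUnit f ↔ MvPowerSeries.constantCoeff (restrictZ k f) ≠ 0 := by
  rw [PowerSeries.isUnit_iff_constantCoeff, MvPowerSeries.isUnit_iff_constantCoeff, isUnit_iff_ne_zero]

theorem mem_maximalIdeal_loc_iff {f : Loc k} :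
    f ∈ maximalIdeal (Loc k) ↔ MvPowerSeries.constantCoeff (restrictZ k f) = 0 := by
  rw [mem_maximalIdeal, mem_nonunits_iff, isUnit_loc_iff, not_not]

theorem constantCoeff_algebraMap (c : k) :
    MvPowerSeries.constantCoeff (restrictZ k (algebraMap k (Loc k) c)) = c := by
  rw [PowerSeries.algebraMap_apply, PowerSeries.constantCoeff_C, MvPowerSeries.algebraMap_apply,
    MvPowerSeries.constantCoeff_C, Algebra.algebraMap_self_apply]

/-- The ideal of the power series in `z, x, y` all of whose exponents have weight at least `s`, where
`z` has weight `1`. -/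
def locIdeal (k : Type*) [Field k] (w : Fin 2 → ℕ) (s : ℚ) : Ideal (Loc k) where
  carrier := {f | ∀ m : ℕ, PowerSeries.coeff m f ∈ ordIdeal k w (s - m)}
  zero_mem' := fun m => by simp
  add_mem' := fun ha hb m => by rw [map_add]; exact Ideal.add_mem _ (ha m) (hb m)
  smul_mem' := by
    intro c f hf m
    rw [smul_eq_mul, PowerSeries.coeff_mul]
    refine Ideal.sum_mem _ fun x hx => Ideal.mul_mem_left _ _ (ordIdeal_anti ?_ (hf x.2))
    have := Finset.HasAntidiagonal.mem_antidiagonal.1 hx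
    have h : (x.2 : ℚ) ≤ m := by exact_mod_cast (by omega : x.2 ≤ m)
    linarith

theorem mul_mem_locIdeal {w : Fin 2 → ℕ} {s t : ℚ} {f g : Loc k} (hf : f ∈ locIdeal k w s)
    (hg : g ∈ locIdeal k w t) : f * g ∈ locIdeal k w (s + t) := by
  intro m
  rw [PowerSeries.coeff_mul]
  refine Ideal.sum_mem _ fun x hx => ?_
  have h1 := mul_mem_ordIdeal (hf x.1) (hg x.2)
  have h2 : (x.1 : ℚ) + x.2 = m := by
    exact_mod_cast Finset.HasAntidiagonal.mem_antidiagonal.1 hx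
  exact ordIdeal_anti (by linarith) h1

theorem C_mem_locIdeal {w : Fin 2 → ℕ} {s : ℚ} {f : Base k} (hf : f ∈ ordIdeal k w s) :
    (PowerSeries.C f : Loc k) ∈ locIdeal k w s := by
  intro m
  rw [PowerSeries.coeff_C]
  split_ifs with h
  · simpa [h] using hf
  · simp

theorem X_mem_locIdeal {w : Fin 2 → ℕ} : (PowerSeries.X : Loc k) ∈ locIdeal k w 1 := by
  intro m
  rw [PowerSeries.coeff_X]
  split_ifs with h
  · exact mem_ordIdeal_of_nonpos (by simp [h]) _
  · simp

theorem X_mem_ordIdeal (w : Fin 2 → ℕ) (j : Fin 2) :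
    (MvPowerSeries.X j : Base k) ∈ ordIdeal k w (w j) := by
  classical
  intro n hn
  rw [MvPowerSeries.coeff_X] at hn
  split_ifs at hn with h
  · rw [h, Finsupp.weight_single]; simp
  · exact absurd rfl hn

theorem exists_loc_eq (f : Loc k) :
    ∃ g, f = PowerSeries.C (restrictZ k f) + PowerSeries.X * g ∧
      ∀ m, PowerSeries.coeff m g = PowerSeries.coeff (m + 1) f := by
  refine ⟨PowerSeries.mk fun m => PowerSeries.coeff (m + 1) f, ?_, fun m => by simp⟩
  ext1 m
  cases m <;> simp

theorem X_mem_maximalIdeal : (PowerSeries.X : Loc k) ∈ maximalIdeal (Loc k) := by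
  rw [mem_maximalIdeal_loc_iff]; simp

theorem C_X_mem_maximalIdeal (j : Fin 2) :
    (PowerSeries.C (MvPowerSeries.X j : Base k) : Loc k) ∈ maximalIdeal (Loc k) := by
  rw [mem_maximalIdeal_loc_iff]; simp

theorem maximalIdeal_loc_eq : maximalIdeal (Loc k) = Ideal.span {PowerSeries.X,
    PowerSeries.C (MvPowerSeries.X 0 : Base k), PowerSeries.C (MvPowerSeries.X 1 : Base k)} := by
  apply le_antisymm
  · intro f hf
    rw [mem_maximalIdeal_loc_iff] at hf
    obtain ⟨g, hg, -⟩ := exists_loc_eq f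
    obtain ⟨g₀, -, g₁, -, h⟩ := exists_eq_X_mul_add (s := -1) hf
      (mem_ordIdeal_of_nonpos (by norm_num) _)
    rw [hg, h, map_add, map_mul, map_mul]
    refine Ideal.add_mem _ (Ideal.add_mem _ ?_ ?_) ?_ <;>
    exact Ideal.mul_mem_right _ _ (Ideal.subset_span (by simp))
  · rw [Ideal.span_le]
    rintro _ (rfl | rfl | rfl)
    exacts [X_mem_maximalIdeal, C_X_mem_maximalIdeal 0, C_X_mem_maximalIdeal 1]

theorem mem_maximalIdeal_pow_iff {M : ℕ} {f : Loc k} :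
    f ∈ maximalIdeal (Loc k) ^ M ↔ f ∈ locIdeal k (fun _ => 1) M := by
  constructor
  · have h1 : maximalIdeal (Loc k) ≤ locIdeal k (fun _ => 1) 1 := by
      rw [maximalIdeal_loc_eq, Ideal.span_le]
      rintro _ (rfl | rfl | rfl)
      · exact X_mem_locIdeal
      · exact C_mem_locIdeal (by simpa using X_mem_ordIdeal (fun _ => 1) 0)
      · exact C_mem_locIdeal (by simpa using X_mem_ordIdeal (fun _ => 1) 1)
    have h2 : maximalIdeal (Loc k) ^ M ≤ locIdeal k (fun _ => 1) M := by
      induction M with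
      | zero => intro f _ m; exact mem_ordIdeal_of_nonpos (by simp) _
      | succ M ih =>
        rw [pow_succ, Ideal.mul_le]
        intro a ha b hb
        exact_mod_cast mul_mem_locIdeal (ih ha) (h1 hb)
    exact fun h => h2 h
  · intro h
    induction M generalizing f with
    | zero => simp
    | succ M ih =>
      have h0 := h 0
      rw [Nat.cast_zero, sub_zero] at h0
      push_cast at h0
      have hc : MvPowerSeries.constantCoeff (PowerSeries.coeff 0 f) = 0 :=
        constantCoeff_eq_zero_iff_mem.2 (ordIdeal_anti (by simp) h0)
      obtain ⟨g₀, hg₀, g₁, hg₁, h2⟩ := exists_eq_X_mul_add hc h0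
      obtain ⟨g, hg, hgc⟩ := exists_loc_eq f
      have hgm : g ∈ locIdeal k (fun _ => 1) M := by
        intro m
        rw [hgc]
        refine ordIdeal_anti ?_ (h (m + 1))
        push_cast; linarith
      rw [hg, ← PowerSeries.coeff_zero_eq_constantCoeff_apply, h2, map_add, map_mul, map_mul,
        pow_succ']
      refine Ideal.add_mem _ (Ideal.add_mem _ ?_ ?_) ?_
      · exact Ideal.mul_mem_mul (C_X_mem_maximalIdeal 0) (ih (C_mem_locIdeal hg₀))
      · exact Ideal.mul_mem_mul (C_X_mem_maximalIdeal 1) (ih (C_mem_locIdeal hg₁))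
      · exact Ideal.mul_mem_mul X_mem_maximalIdeal (ih hgm)

theorem eq_zero_of_forall_mem_pow (r : Loc k) (h : ∀ m, r ∈ maximalIdeal (Loc k) ^ m) : r = 0 := by
  have := Ideal.iInf_pow_eq_bot_of_isLocalRing (maximalIdeal (Loc k)) (Ideal.IsPrime.ne_top')
  rw [← Ideal.mem_bot, ← this]
  simpa [Ideal.mem_iInf] using h

theorem algHom_map_mem {α : Loc k →ₐ[k] Loc k} {f : Loc k} (hf : f ∈ maximalIdeal (Loc k)) :
    α f ∈ maximalIdeal (Loc k) := by
  by_contra h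
  rw [mem_maximalIdeal_loc_iff] at h
  set c := MvPowerSeries.constantCoeff (restrictZ k (α f)) with hc
  have h1 : IsUnit (f - algebraMap k _ c) := by
    rw [isUnit_loc_iff]
    rw [mem_maximalIdeal_loc_iff] at hf
    rwa [map_sub, map_sub, hf, zero_sub, neg_ne_zero, constantCoeff_algebraMap]
  have h2 := h1.map α
  rw [map_sub, AlgHom.commutes, isUnit_loc_iff, map_sub, map_sub, ← hc] at h2
  rw [constantCoeff_algebraMap, sub_self] at h2
  exact h2 rfl

theorem algHom_map_mem_pow {α : Loc k →ₐ[k] Loc k} {M : ℕ} {f : Loc k}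
    (hf : f ∈ maximalIdeal (Loc k) ^ M) : α f ∈ maximalIdeal (Loc k) ^ M := by
  have h1 : (maximalIdeal (Loc k) ^ M).map α ≤ maximalIdeal (Loc k) ^ M := by
    rw [Ideal.map_pow]
    exact Ideal.pow_right_mono (Ideal.map_le_iff_le_comap.2 fun f hf => algHom_map_mem hf) _
  exact h1 (Ideal.mem_map_of_mem _ hf)

theorem coord_mem_pow_iff (X : Coord k) {M : ℕ} {f : Loc k} :
    X f ∈ maximalIdeal (Loc k) ^ M ↔ f ∈ maximalIdeal (Loc k) ^ M := by
  constructor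
  · intro h
    simpa using algHom_map_mem_pow (α := (X.symm : Loc k →ₐ[k] Loc k)) h
  · intro h
    exact algHom_map_mem_pow (α := (X : Loc k →ₐ[k] Loc k)) h

theorem coord_mem_iff (X : Coord k) {f : Loc k} :
    X f ∈ maximalIdeal (Loc k) ↔ f ∈ maximalIdeal (Loc k) := by
  rw [← pow_one (maximalIdeal (Loc k)), coord_mem_pow_iff]

theorem Coord.span_eq (X : Coord k) :
    Ideal.span {X.z, X.xy 0, X.xy 1} = maximalIdeal (Loc k) := by
  have h : Ideal.map (X : Loc k →+* Loc k) (maximalIdeal (Loc k)) = maximalIdeal (Loc k) := by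
    apply le_antisymm
    · rw [Ideal.map_le_iff_le_comap]
      intro f hf
      exact (coord_mem_iff X).2 hf
    · intro f hf
      have := Ideal.mem_map_of_mem (X : Loc k →+* Loc k)
        ((coord_mem_iff X (f := X.symm f)).1 (by simpa using hf))
      simpa using this
  rw [← h, maximalIdeal_loc_eq, Ideal.map_span]
  congr 1
  simp [Set.image_insert_eq, Coord.z, Coord.xy]

theorem Coord.z_mem (X : Coord k) : X.z ∈ maximalIdeal (Loc k) := by
  rw [← X.span_eq]; exact Ideal.subset_span (by simp)

theorem Coord.xy_mem (X : Coord k) (j : Fin 2) : X.xy j ∈ maximalIdeal (Loc k) := by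
  rw [← X.span_eq]; apply Ideal.subset_span; fin_cases j <;> simp

instance : IsPrecomplete (maximalIdeal (Loc k)) (Loc k) := by
  have h1 : IsAdicComplete
    (Ideal.span (Set.range MvPowerSeries.X) : Ideal (MvPowerSeries (Fin 3) k))
      (MvPowerSeries (Fin 3) k) := inferInstance
  have h2 : Ideal.map (MvPowerSeries.finSuccEquiv k 2).toRingEquiv
      (Ideal.span (Set.range MvPowerSeries.X)) = maximalIdeal (Loc k) := by
    have hr : Set.range (MvPowerSeries.X : Fin 3 → MvPowerSeries (Fin 3) k) =
        {MvPowerSeries.X 0, MvPowerSeries.X 1, MvPowerSeries.X 2} := by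
      ext f; simp [Fin.exists_fin_succ, eq_comm]
    have e0 : (MvPowerSeries.finSuccEquiv k 2).toRingEquiv (MvPowerSeries.X 0) =
      PowerSeries.X := MvPowerSeries.finSuccEquiv_X_zero
    have e1 : (MvPowerSeries.finSuccEquiv k 2).toRingEquiv (MvPowerSeries.X 1) =
      PowerSeries.C (MvPowerSeries.X 0) := MvPowerSeries.finSuccEquiv_X_succ 0
    have e2 : (MvPowerSeries.finSuccEquiv k 2).toRingEquiv (MvPowerSeries.X 2) =
      PowerSeries.C (MvPowerSeries.X 1) := MvPowerSeries.finSuccEquiv_X_succ 1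
    rw [Ideal.map_span, maximalIdeal_loc_eq, hr, Set.image_insert_eq, Set.image_insert_eq,
      Set.image_singleton, e0, e1, e2]
  have h3 := (IsAdicComplete.congr_ringEquiv _ (MvPowerSeries.finSuccEquiv k 2).toRingEquiv).2 h1
  rw [h2] at h3
  exact h3.toIsPrecomplete

/-- There is an endomorphism of `k[[z, x, y]]` with given values of the variables in the maximal
ideal. -/
theorem exists_algHom (v : Fin 3 → Loc k) (hv : ∀ i, v i ∈ maximalIdeal (Loc k)) :
    ∃ α : Loc k →ₐ[k] Loc k, α PowerSeries.X = v 0 ∧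
      ∀ j : Fin 2, α (PowerSeries.C (MvPowerSeries.X j : Base k)) = v j.succ := by
  have hs : MvPowerSeries.HasSubst fun i => (MvPowerSeries.finSuccEquiv k 2).symm (v i) := by
    refine MvPowerSeries.hasSubst_of_constantCoeff_zero fun i => ?_
    have h1 := mem_maximalIdeal_loc_iff.1 (hv i)
    rw [← PowerSeries.coeff_zero_eq_constantCoeff_apply,
      ← MvPowerSeries.coeff_zero_eq_constantCoeff_apply] at h1
    rw [← (MvPowerSeries.finSuccEquiv k 2).apply_symm_apply (v i),
      MvPowerSeries.coeff_coeff_finSuccEquiv] at h1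
    rw [← MvPowerSeries.coeff_zero_eq_constantCoeff_apply, ← h1]
    congr
    ext j
    refine Fin.cases ?_ (fun j => ?_) j <;> simp
  refine ⟨((MvPowerSeries.finSuccEquiv k 2 : _ →ₐ[k] _).comp
    (MvPowerSeries.substAlgHom hs)).comp
      ((MvPowerSeries.finSuccEquiv k 2).symm : _ →ₐ[k] _), ?_, fun j => ?_⟩
  · have : (MvPowerSeries.finSuccEquiv k 2).symm PowerSeries.X = MvPowerSeries.X 0 := by
      rw [AlgEquiv.symm_apply_eq]; exact MvPowerSeries.finSuccEquiv_X_zero.symm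
    simp [this, MvPowerSeries.subst_X hs]
  · have : (MvPowerSeries.finSuccEquiv k 2).symm (PowerSeries.C (MvPowerSeries.X j)) =
        MvPowerSeries.X j.succ := by
      rw [AlgEquiv.symm_apply_eq]; exact (MvPowerSeries.finSuccEquiv_X_succ j).symm
    simp [this, MvPowerSeries.subst_X hs]

theorem injective_of_surjective_endomorphism {R : Type*} [CommRing R] [IsNoetherianRing R]
    (f : R →+* R) (hf : Function.Surjective f) : Function.Injective f := by
  let K : ℕ →o Ideal R := ⟨fun m => RingHom.ker (f ^ m), monotone_nat_of_le_succ fun m x hx => by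
    rw [RingHom.mem_ker] at hx ⊢
    rw [pow_succ', RingHom.mul_def, RingHom.comp_apply, hx, map_zero]⟩
  obtain ⟨m, hm⟩ := monotone_stabilizes_iff_noetherian.2 ‹IsNoetherianRing R› K
  rw [injective_iff_map_eq_zero]
  intro x hx
  have hs : Function.Surjective (f ^ m) := by
    rw [RingHom.coe_pow]; exact hf.iterate m
  obtain ⟨y, rfl⟩ := hs x
  have h1 : y ∈ K (m + 1) := by
    change (f ^ (m + 1)) y = 0
    rw [pow_succ', RingHom.mul_def, RingHom.comp_apply, hx]
  rw [← hm (m + 1) (Nat.le_succ m)] at h1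
  exact h1

/-- Every system of generators `z, x, y` of the maximal ideal is a regular system of parameters. -/
theorem exists_coord {z x y : Loc k}
    (h : maximalIdeal (Loc k) = Ideal.span {z, x, y}) :
    ∃ X : Coord k, X.z = z ∧ X.xy 0 = x ∧ X.xy 1 = y := by
  obtain ⟨α, hz, hxy⟩ := exists_algHom ![z, x, y] (by
    intro i; rw [h]; apply Ideal.subset_span; fin_cases i <;> simp)
  have hx : α (PowerSeries.C (MvPowerSeries.X 0 : Base k)) = x := hxy 0
  have hy : α (PowerSeries.C (MvPowerSeries.X 1 : Base k)) = y := hxy 1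
  have hz : α PowerSeries.X = z := hz
  have hmap : (maximalIdeal (Loc k)).map (α : Loc k →+* Loc k) = maximalIdeal (Loc k) := by
    rw [maximalIdeal_loc_eq, Ideal.map_span, ← maximalIdeal_loc_eq, h]
    simp [Set.image_insert_eq, hx, hy, hz]
  have : IsHausdorff ((maximalIdeal (Loc k)).map (α : Loc k →+* Loc k)) (Loc k) := by
    rw [hmap]; infer_instance
  have hs : Function.Surjective (α : Loc k →+* Loc k) := by
    apply surjective_of_mk_map_comp_surjective (I := maximalIdeal (Loc k))
    rw [hmap]
    intro r
    obtain ⟨r, rfl⟩ := Ideal.Quotient.mk_surjective r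
    refine ⟨algebraMap k _ (MvPowerSeries.constantCoeff (restrictZ k r)), ?_⟩
    rw [RingHom.comp_apply, RingHom.coe_coe, AlgHom.commutes, Ideal.Quotient.mk_eq_mk_iff_sub_mem,
      mem_maximalIdeal_loc_iff, map_sub, map_sub, constantCoeff_algebraMap, sub_self]
  have hi := injective_of_surjective_endomorphism _ hs
  exact ⟨AlgEquiv.ofBijective α ⟨hi, hs⟩, hz, hx, hy⟩

end Loc

/-! ### Translations `z ↦ z - b` -/

section Translation

variable {k : Type*} [Field k]

theorem hasseZ_coe (m : ℕ) (P : Polynomial (Base k)) :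
    hasseZ m (P : Loc k) = (Polynomial.hasseDeriv m P : Polynomial (Base k)) := by
  ext1 i
  rw [hasseZ, PowerSeries.coeff_mk, Polynomial.coeff_coe, Polynomial.coeff_coe,
    Polynomial.hasseDeriv_coeff]

theorem hasseZ_add (m : ℕ) (f g : Loc k) : hasseZ m (f + g) = hasseZ m f + hasseZ m g := by
  ext1 i
  simp [hasseZ, mul_add]

theorem hasseZ_mem {m N : ℕ} {f : Loc k} (hf : f ∈ maximalIdeal (Loc k) ^ (N + m)) :
    hasseZ m f ∈ maximalIdeal (Loc k) ^ N := by
  rw [mem_maximalIdeal_pow_iff] at hf ⊢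
  intro i
  rw [hasseZ, PowerSeries.coeff_mk]
  refine Ideal.mul_mem_left _ _ ?_
  have := hf (i + m)
  push_cast at this
  rwa [show (N : ℚ) + m - (i + m) = N - i by ring] at this

theorem hasseDeriv_taylor {R : Type*} [CommRing R] (m : ℕ) (b : R) (P : Polynomial R) :
    Polynomial.hasseDeriv m (Polynomial.taylor b P) =
      Polynomial.taylor b (Polynomial.hasseDeriv m P) := by
  ext i
  have h := congrArg (Polynomial.eval b)
    (LinearMap.congr_fun (Polynomial.hasseDeriv_comp (R := R) i m) P)
  rw [LinearMap.comp_apply] at h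
  rw [Polynomial.hasseDeriv_coeff, Polynomial.taylor_coeff, Polynomial.taylor_coeff, h,
    LinearMap.smul_apply, Polynomial.eval_smul, nsmul_eq_mul, Nat.choose_symm_add]

/-- The translation `z ↦ z - b` of `k[[z, x, y]]`, where `b ∈ k[[x, y]]`. -/
theorem exists_translation {b : Base k} (hb : MvPowerSeries.constantCoeff b = 0) :
    ∃ τ : Coord k, (∀ f : Base k, τ (PowerSeries.C f) = PowerSeries.C f) ∧
      ∀ P : Polynomial (Base k), τ (Polynomial.taylor b P : Polynomial (Base k)) = (P : Loc k) := by
  have hbm : (PowerSeries.C b : Loc k) ∈ Ideal.span {PowerSeries.C (MvPowerSeries.X 0 : Base k),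
      PowerSeries.C (MvPowerSeries.X 1 : Base k)} := by
    obtain ⟨g₀, -, g₁, -, h⟩ := exists_eq_X_mul_add (s := -1) hb
      (mem_ordIdeal_of_nonpos (by norm_num) _)
    rw [h, map_add, map_mul, map_mul]
    exact Ideal.add_mem _ (Ideal.mul_mem_right _ _ (Ideal.subset_span (by simp)))
      (Ideal.mul_mem_right _ _ (Ideal.subset_span (by simp)))
  -- `z - b, x, y` is a regular system of parameters
  obtain ⟨τ, hz, hx, hy⟩ := exists_coord (z := (PowerSeries.X - PowerSeries.C b : Loc k))
    (x := PowerSeries.C (MvPowerSeries.X 0 : Base k))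
    (y := PowerSeries.C (MvPowerSeries.X 1 : Base k)) (by
      rw [maximalIdeal_loc_eq]
      have hle : ∀ z : Loc k, Ideal.span {PowerSeries.C (MvPowerSeries.X 0 : Base k),
          PowerSeries.C (MvPowerSeries.X 1 : Base k)} ≤ Ideal.span {z,
            PowerSeries.C (MvPowerSeries.X 0 : Base k),
            PowerSeries.C (MvPowerSeries.X 1 : Base k)} :=
        fun z => Ideal.span_mono (Set.subset_insert _ _)
      apply le_antisymm
      · rw [Ideal.span_le]
        rintro _ (rfl | rfl | rfl)
        · have := Ideal.add_mem _ (Ideal.subset_span (Set.mem_insert _ _) :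
            (PowerSeries.X - PowerSeries.C b : Loc k) ∈ Ideal.span {PowerSeries.X - PowerSeries.C b,
            PowerSeries.C (MvPowerSeries.X 0 : Base k),
            PowerSeries.C (MvPowerSeries.X 1 : Base k)}) (hle _ hbm)
          simpa using this
        · exact Ideal.subset_span (by simp)
        · exact Ideal.subset_span (by simp)
      · rw [Ideal.span_le]
        rintro _ (rfl | rfl | rfl)
        · exact Ideal.sub_mem _ (Ideal.subset_span (by simp)) (hle _ hbm)
        · exact Ideal.subset_span (by simp)
        · exact Ideal.subset_span (by simp))
  have hC : ∀ f : Base k, τ (PowerSeries.C f) = PowerSeries.C f := by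
    have := algHom_ext_of_X (k := k) (I := maximalIdeal (Loc k)) eq_zero_of_forall_mem_pow
      (α := (τ : Loc k →ₐ[k] Loc k).comp (IsScalarTower.toAlgHom k (Base k) (Loc k)))
      (β := IsScalarTower.toAlgHom k (Base k) (Loc k))
      (fun j => by
        refine (coord_mem_iff τ).2 ?_
        exact C_X_mem_maximalIdeal j)
      (fun j => by
        fin_cases j
        · exact hx
        · exact hy)
    exact fun f => DFunLike.congr_fun this f
  refine ⟨τ, hC, fun P => ?_⟩
  -- both sides are ring homomorphisms in `P`, so that constants and the variable suffice
  have h2 : ((τ : Loc k →+* Loc k).comp Polynomial.coeToPowerSeries.ringHom).comp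
      (Polynomial.taylorAlgHom b : Polynomial (Base k) →+* Polynomial (Base k)) =
      Polynomial.coeToPowerSeries.ringHom := by
    apply Polynomial.ringHom_ext
    · intro a
      simp [hC]
    · have hz' : τ PowerSeries.X = PowerSeries.X - PowerSeries.C b := hz
      simp [hC, hz']
  exact RingHom.congr_fun h2 P

theorem hasseZ_translation {b : Base k} {τ : Coord k}
    (hτ : ∀ P : Polynomial (Base k), τ (Polynomial.taylor b P : Polynomial (Base k)) = (P : Loc k))
    (m : ℕ) (f : Loc k) : hasseZ m (τ f) = τ (hasseZ m f) := by
  have hP : ∀ P : Polynomial (Base k), hasseZ m (τ (P : Loc k)) = τ (hasseZ m (P : Loc k)) := by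
    intro P
    obtain ⟨Q, rfl⟩ : ∃ Q, P = Polynomial.taylor b Q :=
      ⟨Polynomial.taylor (-b) P, by rw [Polynomial.taylor_taylor]; simp⟩
    rw [hτ, hasseZ_coe, hasseZ_coe, hasseDeriv_taylor, hτ]
  rw [← sub_eq_zero]
  apply eq_zero_of_forall_mem_pow
  intro N
  obtain ⟨g, hg⟩ : PowerSeries.X ^ (N + m) ∣
      f - ((PowerSeries.trunc (N + m) f : Polynomial (Base k)) : Loc k) := by
    rw [PowerSeries.X_pow_dvd_iff]
    intro i hi
    rw [map_sub, Polynomial.coeff_coe, PowerSeries.coeff_trunc, if_pos hi, sub_self]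
  have hgm : PowerSeries.X ^ (N + m) * g ∈ maximalIdeal (Loc k) ^ (N + m) :=
    Ideal.mul_mem_right _ _ (Ideal.pow_mem_pow X_mem_maximalIdeal _)
  rw [sub_eq_iff_eq_add'] at hg
  rw [hg, map_add, hasseZ_add, hasseZ_add, map_add, hP, add_sub_add_left_eq_sub]
  exact Ideal.sub_mem _ (hasseZ_mem ((coord_mem_pow_iff τ).2 hgm))
    ((coord_mem_pow_iff τ).2 (hasseZ_mem hgm))

end Translation

/-! ### The coefficients of a presentation -/

theorem sum_range_succ_eq {M : Type*} [AddCommMonoid M] (g : ℕ → M) {q : ℕ} (hq : 0 < q) :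
    ∑ m ∈ Finset.range (q + 1), g m = g q + ∑ j ∈ Finset.Ioo 0 q, g (q - j) + g 0 := by
  rw [← Finset.sum_range_reflect, Finset.sum_range_succ, Finset.range_eq_Ico,
    Finset.sum_eq_sum_Ico_succ_bot hq]
  simp only [Nat.add_sub_cancel, Nat.sub_zero, Nat.sub_self, zero_add]
  rfl

/-- The place `v` is the point or the generic point of a boundary component. -/
def IsPlace {k : Type*} [Field k] (T : Triplet k) (v : Place) : Prop :=
  ∀ D, v = .gen D → D ∈ T.bdry

namespace Presentation

variable {k : Type*} [Field k] {p e : ℕ} {T : Triplet k} (H : Presentation p e T)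

theorem wt_pt : H.wt .pt = fun _ => 1 := rfl

theorem wt_gen (D : ℕ) : H.wt (.gen D) = Pi.single (H.slot D) 1 := rfl

theorem coeff_mem_ordIdeal_of_C_dvd {i : Fin 2} {K : ℕ} {r : Loc k}
    (h : PowerSeries.C (MvPowerSeries.X i : Base k) ^ K ∣ r) (m : ℕ) :
    PowerSeries.coeff m r ∈ ordIdeal k (Pi.single i 1) K := by
  obtain ⟨g, rfl⟩ := h
  rw [← map_pow, PowerSeries.coeff_C_mul, ← X_pow_dvd_iff_mem]
  exact dvd_mul_right _ _

theorem mem_ordIdeal_pt {s : ℚ} (slot : ℕ → Fin 2) (hs : Set.InjOn slot (T.bdry : Set ℕ))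
    {f : Base k} (hf : ∀ D ∈ T.bdry, f ∈ ordIdeal k (Pi.single (slot D) 1) (s * mu T (.gen D))) :
    f ∈ ordIdeal k (fun _ => 1) (s * mu T .pt) := by
  intro n hn
  rw [mu, Finset.sum_div, Finset.mul_sum, weight_one]
  calc ∑ D ∈ T.bdry, s * ((T.mult D : ℚ) / T.level)
      ≤ ∑ D ∈ T.bdry, (n (slot D) : ℚ) := Finset.sum_le_sum fun D hD => by
        have := hf D hD n hn
        rwa [weight_single] at this
    _ = ∑ i ∈ T.bdry.image slot, (n i : ℚ) := by rw [Finset.sum_image hs]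
    _ ≤ ∑ i, (n i : ℚ) := Finset.sum_le_univ_sum_of_nonneg fun i => Nat.cast_nonneg _
    _ = _ := by rw [Fin.sum_univ_two]; push_cast; rfl

theorem coeff_mem_gen {D : ℕ} (hD : D ∈ T.bdry) {j : ℕ} (hj : j ∈ Finset.Ioo 0 (p ^ e)) :
    H.W.coeff (p ^ e - j) ∈ ordIdeal k (Pi.single (H.slot D) 1) (j * mu T (.gen D)) := by
  have hj' := Finset.mem_Ioo.1 hj
  have h1 := H.hasse_mem (p ^ e) (p ^ e - j) _ H.h_mem
  rw [hasseZ_coe, Nat.sub_sub_self hj'.2.le] at h1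
  have hdeg : (Polynomial.hasseDeriv (p ^ e - j) H.W).degree < (p ^ e : ℕ) := by
    by_cases h0 : Polynomial.hasseDeriv (p ^ e - j) H.W = 0
    · rw [h0, Polynomial.degree_zero]; exact WithBot.bot_lt_coe _
    · rw [← Polynomial.natDegree_lt_iff_degree_lt h0]
      refine (Polynomial.natDegree_hasseDeriv_le _ _).trans_lt ?_
      rw [H.natDegree_eq]; omega
  have h2 := H.rem_dvd j _ 0 _ h1 hdeg (by simp) D hD
  have h3 := coeff_mem_ordIdeal_of_C_dvd h2 0
  rw [Polynomial.coeff_coe, Polynomial.hasseDeriv_coeff, zero_add, Nat.choose_self, Nat.cast_one,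
    one_mul] at h3
  refine ordIdeal_anti ?_ h3
  rw [mu]
  calc (j : ℚ) * ((T.mult D : ℚ) / T.level) = (T.mult D : ℚ) * j / T.level := by ring
    _ ≤ _ := Nat.le_ceil _

theorem coeff_mem {v : Place} (hv : IsPlace T v) {j : ℕ} (hj : j ∈ Finset.Ioo 0 (p ^ e)) :
    H.W.coeff (p ^ e - j) ∈ ordIdeal k (H.wt v) (j * mu T v) := by
  cases v with
  | pt => exact mem_ordIdeal_pt H.slot H.slot_injOn fun D hD => H.coeff_mem_gen hD hj
  | gen D => exact H.coeff_mem_gen (hv D rfl) hj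

theorem coeff_mem_succ {j : ℕ} (hj : j ∈ Finset.Icc 1 (p ^ e)) :
    H.W.coeff (p ^ e - j) ∈ ordIdeal k (fun _ => 1) (j + 1) :=
  mem_ordIdeal_of_lt_order (H.lt_order j hj)

theorem aLast_mem (hp : 0 < p) : H.aLast ∈ ordIdeal k (fun _ => 1) ((p : ℚ) ^ e + 1) := by
  have := H.coeff_mem_succ (j := p ^ e) (Finset.mem_Icc.2 ⟨Nat.pow_pos hp, le_rfl⟩)
  rw [Nat.sub_self] at this
  exact_mod_cast this

theorem one_lt_mu (H : Presentation p e T) : 1 < mu T .pt := by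
  rw [mu, one_lt_div (by exact_mod_cast H.level_pos)]
  exact_mod_cast H.level_lt

theorem coeff_natDegree : H.W.coeff (p ^ e) = 1 := by
  rw [← H.natDegree_eq]; exact H.monic

/-- `h` is congruent to `z ^ q` modulo `m ^ (q + 1)`. -/
theorem sub_X_pow_mem : (H.W : Loc k) - PowerSeries.X ^ p ^ e ∈
    maximalIdeal (Loc k) ^ (p ^ e + 1) := by
  rw [mem_maximalIdeal_pow_iff]
  intro m
  rw [map_sub, Polynomial.coeff_coe, PowerSeries.coeff_X_pow]
  rcases lt_trichotomy m (p ^ e) with h | h | h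
  · rw [if_neg h.ne, sub_zero]
    have := H.coeff_mem_succ (j := p ^ e - m) (Finset.mem_Icc.2 ⟨by omega, Nat.sub_le _ _⟩)
    rw [Nat.sub_sub_self h.le, Nat.cast_sub h.le] at this
    refine ordIdeal_anti (le_of_eq ?_) this
    push_cast; ring
  · rw [if_pos h, h, H.coeff_natDegree, sub_self]; exact Ideal.zero_mem _
  · rw [if_neg h.ne', sub_zero, Polynomial.coeff_eq_zero_of_natDegree_lt (by rwa [H.natDegree_eq])]
    exact Ideal.zero_mem _

end Presentation

/-! ### Cleaning: well-adapted presentations -/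

namespace Presentation

variable {k : Type*} [Field k] {p e : ℕ} {T : Triplet k}

/-- The translate of a presentation by `z ↦ z - b`; the element `h` does not change. -/
theorem exists_translate [ExpChar k p] (H : Presentation p e T) {b : Base k}
    (hb : b ∈ ordIdeal k (fun _ => 1) 2) :
    ∃ H' : Presentation p e T, H'.slot = H.slot ∧ H'.aLast = H.W.eval b := by
  have hb0 : MvPowerSeries.constantCoeff b = 0 :=
    constantCoeff_eq_zero_iff_mem.2 (ordIdeal_anti (by norm_num) hb)
  have hq : 0 < p ^ e := pow_pos (expChar_pos k p) e
  obtain ⟨τ, hC, hτ⟩ := exists_translation hb0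
  have hτs : ∀ P : Polynomial (Base k),
      τ.symm (P : Loc k) = (Polynomial.taylor b P : Polynomial (Base k)) := fun P => by
    rw [← hτ, AlgEquiv.symm_apply_apply]
  have hCs : ∀ f : Base k, τ.symm (PowerSeries.C f) = PowerSeries.C f := fun f => by
    rw [AlgEquiv.symm_apply_eq, hC]
  have hxy : ∀ j, Coord.xy (τ.trans H.X) j = H.X.xy j := fun j => by
    simp [Coord.xy, AlgEquiv.trans_apply, hC]
  have hW : τ.trans H.X (Polynomial.taylor b H.W : Polynomial (Base k)) = H.X (H.W : Loc k) := by
    rw [AlgEquiv.trans_apply, hτ]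
  -- the leading form stays `z ^ q`, as `(z + b) ^ q = z ^ q + b ^ q` and `b` has order at least two
  have hord : ((Polynomial.taylor b H.W : Polynomial (Base k)) : Loc k) - PowerSeries.X ^ p ^ e ∈
      maximalIdeal (Loc k) ^ (p ^ e + 1) := by
    have h1 : τ.symm ((H.W : Loc k) - PowerSeries.X ^ p ^ e) ∈
        maximalIdeal (Loc k) ^ (p ^ e + 1) :=
      (coord_mem_pow_iff τ.symm).2 H.sub_X_pow_mem
    have h2 : τ.symm (PowerSeries.X : Loc k) = PowerSeries.X + PowerSeries.C b := by
      have := hτs Polynomial.X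
      simpa using this
    have h3 : ((Polynomial.taylor b H.W : Polynomial (Base k)) : Loc k) - PowerSeries.X ^ p ^ e =
        τ.symm ((H.W : Loc k) - PowerSeries.X ^ p ^ e) +
          (τ.symm (PowerSeries.X : Loc k) ^ p ^ e - PowerSeries.X ^ p ^ e) := by
      rw [map_sub, map_pow, hτs]; ring
    have : ExpChar (Loc k) p := expChar_of_injective_algebraMap (algebraMap k (Loc k)).injective p
    rw [h3, h2, add_pow_expChar_pow, add_sub_cancel_left]
    refine Ideal.add_mem _ h1 ?_
    have h4 : (PowerSeries.C b : Loc k) ∈ maximalIdeal (Loc k) ^ 2 := by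
      rw [mem_maximalIdeal_pow_iff]; exact C_mem_locIdeal hb
    have h5 := Ideal.pow_mem_pow h4 (p ^ e)
    rw [← pow_mul] at h5
    exact Ideal.pow_le_pow_right (by omega) h5
  refine ⟨{ X := τ.trans H.X, W := Polynomial.taylor b H.W, slot := H.slot,
            slot_injOn := H.slot_injOn,
            div_eq := fun D hD => by rw [hxy]; exact H.div_eq D hD,
            monic := by
              rw [Polynomial.Monic, Polynomial.leadingCoeff_taylor]; exact H.monic
            natDegree_eq := by rw [Polynomial.natDegree_taylor, H.natDegree_eq],
            lt_order := ?_,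
            h_mem := by rw [hW]; exact H.h_mem,
            lgs := by rw [hW]; exact H.lgs,
            level_pos := H.level_pos, level_lt := H.level_lt,
            monomial_mem := by simp only [hxy]; exact H.monomial_mem,
            rem_dvd := ?_, hasse_mem := ?_ }, rfl, ?_⟩
  · intro i hi
    have hi' := Finset.mem_Icc.1 hi
    apply lt_order_of_mem
    have h1 := mem_maximalIdeal_pow_iff.1 hord (p ^ e - i)
    rw [map_sub, Polynomial.coeff_coe, PowerSeries.coeff_X_pow, if_neg (by omega), sub_zero,
      Nat.cast_sub hi'.2] at h1
    refine ordIdeal_anti (le_of_eq ?_) h1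
    push_cast; ring
  · intro n f g r hf hr hfg D hD
    have h1 := H.rem_dvd n (τ f) (τ g) (Polynomial.taylor (-b) r) hf
      (by rwa [Polynomial.degree_taylor]) (by
        rw [hfg, map_add, map_mul, hτ, ← hτ (Polynomial.taylor (-b) r), Polynomial.taylor_taylor]
        simp) D hD
    have h2 := map_dvd τ.symm h1
    rw [map_pow, hCs, hτs, Polynomial.taylor_taylor] at h2
    simpa using h2
  · intro n m f hf
    rw [AlgEquiv.trans_apply] at hf ⊢
    rw [← hasseZ_translation hτ]
    exact H.hasse_mem n m _ hf
  · rw [aLast, Polynomial.taylor_coeff_zero]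

theorem eval_eq [ExpChar k p] (H : Presentation p e T) (b : Base k) :
    H.W.eval b = b ^ p ^ e +
      ∑ j ∈ Finset.Ioo 0 (p ^ e), H.W.coeff (p ^ e - j) * b ^ (p ^ e - j) + H.aLast := by
  have hq : 0 < p ^ e := pow_pos (expChar_pos k p) e
  rw [Polynomial.eval_eq_sum_range, H.natDegree_eq,
    sum_range_succ_eq (fun m => H.W.coeff m * b ^ m) hq, H.coeff_natDegree, one_mul, pow_zero,
    mul_one, aLast]

/-- A presentation is clean at a place if no term of lowest weight of `a_q`, as long as its weight
is below `q * μ`, is a `q`-th power. This is stronger than being well-adapted, and it is stable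
under cleaning at other places. -/
def Clean (H : Presentation p e T) (v : Place) : Prop :=
  ∀ n, MvPowerSeries.coeff n H.aLast ≠ 0 →
    (∀ n', MvPowerSeries.coeff n' H.aLast ≠ 0 →
      Finsupp.weight (H.wt v) n ≤ Finsupp.weight (H.wt v) n') →
    ((Finsupp.weight (H.wt v) n : ℕ) : ℚ) < (p : ℚ) ^ e * mu T v → ¬ ∀ i, p ^ e ∣ n i

/-- Removing all terms of `a_q` which are `q`-th powers keeps the presentation clean where it is, and
elsewhere makes it clean or raises the order of `a_q`. -/
theorem exists_cleaner [IsAlgClosed k] [ExpChar k p] (H : Presentation p e T) :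
    ∃ H' : Presentation p e T, H'.slot = H.slot ∧ ∀ v, IsPlace T v → H'.Clean v ∨
      (¬ H.Clean v ∧ ∀ K : ℕ, H.aLast ∈ ordIdeal k (H.wt v) K →
        H'.aLast ∈ ordIdeal k (H.wt v) (K + 1)) := by
  classical
  have hq : 0 < p ^ e := pow_pos (expChar_pos k p) e
  have hq' : (0 : ℚ) < (p : ℚ) ^ e := by exact_mod_cast hq
  -- `b` is the `q`-th root of minus the sum of all terms of `a_q` which are `q`-th powers
  let d : Base k := fun n => if ∀ i, p ^ e ∣ n i then -MvPowerSeries.coeff n H.aLast else 0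
  have hd : ∀ n, MvPowerSeries.coeff n d =
      if ∀ i, p ^ e ∣ n i then -MvPowerSeries.coeff n H.aLast else 0 := fun n => rfl
  obtain ⟨b, hbd, hbs⟩ := exists_pow_eq (p := p) (e := e) (f := d) (by
    intro n hn
    rw [hd] at hn
    by_contra h
    rw [if_neg h] at hn
    exact hn rfl)
  have hbs' : ∀ n, MvPowerSeries.coeff n b ≠ 0 →
      MvPowerSeries.coeff (p ^ e • n) H.aLast ≠ 0 := by
    intro n hn h0
    refine hbs n hn ?_
    rw [hd, h0, neg_zero, ite_self]
  have hbw : ∀ (w : Fin 2 → ℕ) (s : ℚ), H.aLast ∈ ordIdeal k w ((p : ℚ) ^ e * s) →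
      b ∈ ordIdeal k w s := by
    intro w s h n hn
    have := h _ (hbs' n hn)
    rw [map_nsmul, smul_eq_mul] at this
    push_cast at this
    exact le_of_mul_le_mul_left this hq'
  -- `a_q` has order greater than `q`, so that `b` has order greater than one
  have hb2 : b ∈ ordIdeal k (fun _ => 1) 2 := by
    have h1 : b ∈ ordIdeal k (fun _ => 1) (1 + ((p : ℚ) ^ e)⁻¹) := by
      apply hbw
      rw [mul_add, mul_inv_cancel₀ hq'.ne', mul_one]
      exact H.aLast_mem (expChar_pos k p)
    intro n hn
    have h2 := h1 n hn
    have h3 : (1 : ℚ) < (Finsupp.weight (fun _ : Fin 2 => 1) n : ℕ) :=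
      lt_of_lt_of_le (by linarith [inv_pos.2 hq']) h2
    exact_mod_cast h3
  obtain ⟨H', hslot, ha'⟩ := H.exists_translate hb2
  refine ⟨H', hslot, fun v hv => ?_⟩
  have hwt : H'.wt v = H.wt v := by cases v <;> simp [wt, hslot]
  rw [H.eval_eq] at ha'
  have hnew : ∀ n, MvPowerSeries.coeff n (b ^ p ^ e) + MvPowerSeries.coeff n H.aLast =
      if ∀ i, p ^ e ∣ n i then 0 else MvPowerSeries.coeff n H.aLast := by
    intro n
    rw [hbd, hd]
    split_ifs <;> simp
  -- either `a_q` has order at least `q μ`, and stays so, or it has terms of lowest weight `N < q μ`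
  by_cases hhigh : H.aLast ∈ ordIdeal k (H.wt v) ((p : ℚ) ^ e * mu T v)
  · left
    have hbμ := hbw _ _ hhigh
    have h1 : H'.aLast ∈ ordIdeal k (H.wt v) ((p : ℚ) ^ e * mu T v) := by
      rw [ha']
      refine Ideal.add_mem _ (Ideal.add_mem _ ?_ (Ideal.sum_mem _ fun j hj => ?_)) hhigh
      · exact_mod_cast pow_mem_ordIdeal hbμ (p ^ e)
      · have h2 := mul_mem_ordIdeal (H.coeff_mem hv hj) (pow_mem_ordIdeal hbμ (p ^ e - j))
        refine ordIdeal_anti (le_of_eq ?_) h2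
        rw [Nat.cast_sub (Finset.mem_Ioo.1 hj).2.le]
        push_cast; ring
    intro n hn _ hlt
    rw [hwt] at hlt
    exact absurd (h1 n hn) (not_le.2 hlt)
  · rw [mem_ordIdeal] at hhigh
    push Not at hhigh
    have hex : ∃ N, ∃ n, MvPowerSeries.coeff n H.aLast ≠ 0 ∧ Finsupp.weight (H.wt v) n = N :=
      ⟨_, hhigh.choose, hhigh.choose_spec.1, rfl⟩
    obtain ⟨n₀, hn₀, hn₀N⟩ := Nat.find_spec hex
    set N := Nat.find hex
    have hmin : ∀ n, MvPowerSeries.coeff n H.aLast ≠ 0 → N ≤ Finsupp.weight (H.wt v) n :=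
      fun n hn => Nat.find_min' hex ⟨n, hn, rfl⟩
    have hN : (N : ℚ) < (p : ℚ) ^ e * mu T v := by
      obtain ⟨n, hn, hlt⟩ := hhigh
      exact lt_of_le_of_lt (by exact_mod_cast hmin n hn) hlt
    have hbN : b ∈ ordIdeal k (H.wt v) (N / (p : ℚ) ^ e) := by
      apply hbw
      rw [mul_div_cancel₀ _ hq'.ne']
      exact fun n hn => by exact_mod_cast hmin n hn
    -- up to weight `N`, the mixed terms vanish, and exactly the `q`-th powers are removed
    have hcoef : ∀ n, Finsupp.weight (H.wt v) n ≤ N → MvPowerSeries.coeff n H'.aLast =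
        if ∀ i, p ^ e ∣ n i then 0 else MvPowerSeries.coeff n H.aLast := by
      intro n hn
      have hnQ : ((Finsupp.weight (H.wt v) n : ℕ) : ℚ) ≤ N := by exact_mod_cast hn
      rw [← hnew, ha', map_add, map_add,
        coeff_mixed_eq_zero (fun j hj => H.coeff_mem hv hj) hbN (hnQ.trans_lt hN)
          (by rw [mul_div_cancel₀ _ hq'.ne']; exact hnQ) rfl, add_zero]
    have hmem : H'.aLast ∈ ordIdeal k (H.wt v) N := by
      intro n hn
      by_contra hlt
      rw [not_le, Nat.cast_lt] at hlt
      rw [hcoef n hlt.le] at hn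
      split_ifs at hn with h
      · exact hn rfl
      · exact absurd (hmin n hn) (not_le.2 hlt)
    by_cases hterm : ∃ n, MvPowerSeries.coeff n H.aLast ≠ 0 ∧ Finsupp.weight (H.wt v) n = N ∧
        ¬ ∀ i, p ^ e ∣ n i
    · left
      obtain ⟨n₁, hn₁, hw₁, hdiv₁⟩ := hterm
      intro n hn hle _
      rw [hwt] at hle
      have h1 : Finsupp.weight (H.wt v) n ≤ N := by
        rw [← hw₁]
        refine hle n₁ ?_
        rw [hcoef n₁ hw₁.le, if_neg hdiv₁]
        exact hn₁
      intro hdiv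
      rw [hcoef n h1, if_pos hdiv] at hn
      exact hn rfl
    · right
      push Not at hterm
      refine ⟨fun hclean => ?_, fun K hK n hn => ?_⟩
      · refine hclean n₀ hn₀ (fun n' hn' => ?_) (by rw [hn₀N]; exact hN) (hterm n₀ hn₀ hn₀N)
        rw [hn₀N]; exact hmin n' hn'
      · have h1 : (N : ℚ) ≤ _ := hmem n hn
        have h2 : (K : ℚ) ≤ N := by have := hK n₀ hn₀; rwa [hn₀N] at this
        have h3 : Finsupp.weight (H.wt v) n ≠ N := by
          intro h3
          rw [hcoef n h3.le] at hn
          split_ifs at hn with h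
          · exact hn rfl
          · exact h (hterm n hn h3)
        have h4 : N < Finsupp.weight (H.wt v) n :=
          lt_of_le_of_ne (by exact_mod_cast h1) (Ne.symm h3)
        have h5 : ((N + 1 : ℕ) : ℚ) ≤ (Finsupp.weight (H.wt v) n : ℕ) := by exact_mod_cast h4
        push_cast at h5
        linarith

/-- There is a presentation which is clean at the point and at all boundary components. -/
theorem exists_clean [IsAlgClosed k] [ExpChar k p] (H : Presentation p e T) :
    ∃ H' : Presentation p e T, ∀ v, IsPlace T v → H'.Clean v := by
  have key : ∀ K : ℕ, ∃ H' : Presentation p e T, H'.slot = H.slot ∧ ∀ v, IsPlace T v →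
      H'.Clean v ∨ H'.aLast ∈ ordIdeal k (H.wt v) K := by
    intro K
    induction K with
    | zero => exact ⟨H, rfl, fun v _ => Or.inr (mem_ordIdeal_of_nonpos (by simp) _)⟩
    | succ K ih =>
      obtain ⟨H₁, hs, h₁⟩ := ih
      obtain ⟨H₂, hs₂, h₂⟩ := H₁.exists_cleaner
      have hwt : ∀ v, H₁.wt v = H.wt v := fun v => by cases v <;> simp [wt, hs]
      refine ⟨H₂, hs₂.trans hs, fun v hv => ?_⟩
      rcases h₂ v hv with h | ⟨hn, h⟩
      · exact Or.inl h
      · right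
        rw [hwt] at h
        exact_mod_cast h K ((h₁ v hv).resolve_left hn)
  -- a presentation whose `a_q` has order at least `q μ` is clean for trivial reasons
  obtain ⟨K, hK⟩ := exists_nat_ge ((p : ℚ) ^ e * (mu T .pt + ∑ D ∈ T.bdry, mu T (.gen D)))
  obtain ⟨H', hs, h⟩ := key K
  have hnn : ∀ v, 0 ≤ mu T v := by
    intro v
    cases v <;> simp only [mu] <;> positivity
  refine ⟨H', fun v hv => (h v hv).elim id fun hm n hn _ hlt => ?_⟩
  have hwt : H'.wt v = H.wt v := by cases v <;> simp [wt, hs]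
  exfalso
  rw [← hwt] at hm
  have h1 := hm n hn
  have h2 : mu T v ≤ mu T .pt + ∑ D ∈ T.bdry, mu T (.gen D) := by
    cases v with
    | pt => linarith [Finset.sum_nonneg fun D (_ : D ∈ T.bdry) => hnn (.gen D)]
    | gen D =>
      have := Finset.single_le_sum (fun D (_ : D ∈ T.bdry) => hnn (.gen D)) (hv D rfl)
      linarith [hnn .pt]
  have h3 := mul_le_mul_of_nonneg_left h2
    (pow_nonneg (Nat.cast_nonneg p : (0 : ℚ) ≤ p) e)
  linarith

end Presentation

/-! ### Rows of a power series in two variables -/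

section Rows

variable {k : Type*} [Field k]

/-- The exponent of the monomial `x_i ^ r * x_(1 - i) ^ l`. -/
def expo (i : Fin 2) (r l : ℕ) : Fin 2 →₀ ℕ := Finsupp.single i r + Finsupp.single (1 - i) l

theorem one_sub_ne (i : Fin 2) : 1 - i ≠ i := by fin_cases i <;> decide

theorem one_sub_one_sub (i : Fin 2) : 1 - (1 - i) = i := by fin_cases i <;> decide

theorem eq_or_eq_one_sub (i j : Fin 2) : j = i ∨ j = 1 - i := by
  fin_cases i <;> fin_cases j <;> decide

@[simp] theorem expo_same (i : Fin 2) (r l : ℕ) : expo i r l i = r := by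
  simp [expo, one_sub_ne i]

@[simp] theorem expo_other (i : Fin 2) (r l : ℕ) : expo i r l (1 - i) = l := by
  simp [expo, (one_sub_ne i).symm]

theorem eq_expo (i : Fin 2) (n : Fin 2 →₀ ℕ) : n = expo i (n i) (n (1 - i)) := by
  ext j
  rcases eq_or_eq_one_sub i j with rfl | rfl <;> simp

theorem expo_swap (i : Fin 2) (r l : ℕ) : expo (1 - i) l r = expo i r l := by
  rw [expo, expo, one_sub_one_sub, add_comm]

theorem add_eq_add (i : Fin 2) (n : Fin 2 →₀ ℕ) : n 0 + n 1 = n i + n (1 - i) := by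
  fin_cases i
  · rfl
  · exact add_comm _ _

theorem forall_dvd_iff (i : Fin 2) (n : Fin 2 →₀ ℕ) (q : ℕ) :
    (∀ j, q ∣ n j) ↔ q ∣ n i ∧ q ∣ n (1 - i) := by
  refine ⟨fun h => ⟨h _, h _⟩, fun h j => ?_⟩
  rcases eq_or_eq_one_sub i j with rfl | rfl
  exacts [h.1, h.2]

/-- The restriction of a power series to the line `x_i = 0`. -/
def restrictX (k : Type*) [Field k] (i : Fin 2) : Base k →+* PowerSeries k where
  toFun f := PowerSeries.mk fun l => MvPowerSeries.coeff (Finsupp.single (1 - i) l) f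
  map_zero' := by ext l; simp
  map_one' := by
    classical
    ext l
    rw [PowerSeries.coeff_mk, MvPowerSeries.coeff_one, PowerSeries.coeff_one]
    simp
  map_add' f g := by ext l; simp
  map_mul' f g := by
    classical
    ext l
    rw [PowerSeries.coeff_mk, MvPowerSeries.coeff_mul, PowerSeries.coeff_mul,
      Finsupp.antidiagonal_single, Finset.sum_map]
    simp

theorem coeff_restrictX (i : Fin 2) (l : ℕ) (f : Base k) :
    PowerSeries.coeff l (restrictX k i f) = MvPowerSeries.coeff (expo i 0 l) f := by
  simp [restrictX, expo]

theorem constantCoeff_restrictX (i : Fin 2) (f : Base k) :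
    PowerSeries.constantCoeff (restrictX k i f) = MvPowerSeries.constantCoeff f := by
  rw [← PowerSeries.coeff_zero_eq_constantCoeff_apply, coeff_restrictX]
  simp [expo]

theorem coeff_expo_X_pow_mul (i : Fin 2) (r l : ℕ) (g : Base k) :
    MvPowerSeries.coeff (expo i r l) (MvPowerSeries.X i ^ r * g) =
      PowerSeries.coeff l (restrictX k i g) := by
  rw [coeff_restrictX, expo, coeff_X_pow_mul, expo, Finsupp.single_zero, zero_add]

theorem restrictX_eq_zero_iff {i : Fin 2} {f : Base k} :
    restrictX k i f = 0 ↔ (MvPowerSeries.X i : Base k) ∣ f := by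
  rw [MvPowerSeries.X_dvd_iff]
  constructor
  · intro h n hn
    have := congrArg (PowerSeries.coeff (n (1 - i))) h
    rw [coeff_restrictX, ← hn, ← eq_expo] at this
    simpa using this
  · intro h
    ext l
    rw [coeff_restrictX, h _ (by simp)]; simp

theorem restrictX_X_self (i : Fin 2) : restrictX k i (MvPowerSeries.X i) = 0 :=
  restrictX_eq_zero_iff.2 dvd_rfl

theorem restrictX_X_other (i : Fin 2) :
    restrictX k i (MvPowerSeries.X (1 - i)) = PowerSeries.X := by
  classical
  ext l
  rw [coeff_restrictX, MvPowerSeries.coeff_X, PowerSeries.coeff_X]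
  congr 1
  apply propext
  constructor
  · intro h
    have := DFunLike.congr_fun h (1 - i)
    simpa using this
  · rintro rfl
    simp [expo]

theorem exists_eq_X_pow_mul {i : Fin 2} {r : ℕ} {a : Base k}
    (h : a ∈ ordIdeal k (Pi.single i 1) r) : ∃ g, a = MvPowerSeries.X i ^ r * g :=
  X_pow_dvd_iff_mem.2 h

theorem X_pow_mul_mem (i : Fin 2) (r : ℕ) (g : Base k) :
    MvPowerSeries.X i ^ r * g ∈ ordIdeal k (Pi.single i 1) r :=
  X_pow_dvd_iff_mem.1 (Dvd.intro _ rfl)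

/-- Multiplication by a unit does not change the first term of a row. -/
theorem coeff_unit_mul {i : Fin 2} {r l : ℕ} {a : Base k} (u : Base k)
    (ha : a ∈ ordIdeal k (Pi.single i 1) r)
    (hl : ∀ l' < l, MvPowerSeries.coeff (expo i r l') a = 0) :
    (∀ l' < l, MvPowerSeries.coeff (expo i r l') (u * a) = 0) ∧
      MvPowerSeries.coeff (expo i r l) (u * a) =
        MvPowerSeries.constantCoeff u * MvPowerSeries.coeff (expo i r l) a := by
  obtain ⟨g, rfl⟩ := exists_eq_X_pow_mul ha
  simp only [mul_left_comm u, coeff_expo_X_pow_mul, map_mul] at hl ⊢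
  obtain ⟨c, hc⟩ := PowerSeries.X_pow_dvd_iff.2 hl
  rw [hc, mul_left_comm]
  refine ⟨fun l' hl' => PowerSeries.X_pow_dvd_iff.1 (Dvd.intro _ rfl) l' hl', ?_⟩
  have h1 := PowerSeries.coeff_X_pow_mul (restrictX k i u * c) l 0
  have h2 := PowerSeries.coeff_X_pow_mul c l 0
  rw [zero_add] at h1 h2
  rw [h1, h2, PowerSeries.coeff_zero_eq_constantCoeff_apply,
    PowerSeries.coeff_zero_eq_constantCoeff_apply, map_mul, constantCoeff_restrictX]

/-- `x_i ^ r x_(1-i) ^ l` is the first monomial which is not a `q`-th power in the lowest row of `a`,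
the row `r`, where rows are formed by the monomials with a fixed exponent of `x_i`. -/
structure RowData (q : ℕ) (a : Base k) (i : Fin 2) (r l : ℕ) : Prop where
  mem : a ∈ ordIdeal k (Pi.single i 1) r
  coeff_ne : MvPowerSeries.coeff (expo i r l) a ≠ 0
  not_dvd : ¬ (q ∣ r ∧ q ∣ l)
  dvd : ∀ l' < l, MvPowerSeries.coeff (expo i r l') a ≠ 0 → q ∣ r ∧ q ∣ l'

theorem RowData.unique {q : ℕ} {a : Base k} {i : Fin 2} {r l r' l' : ℕ} (h : RowData q a i r l)
    (h' : RowData q a i r' l') : r = r' ∧ l = l' := by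
  have h1 := h.mem _ h'.coeff_ne
  have h2 := h'.mem _ h.coeff_ne
  rw [weight_single, expo_same, Nat.cast_le] at h1 h2
  obtain rfl := le_antisymm h1 h2
  refine ⟨rfl, ?_⟩
  rcases lt_trichotomy l l' with hl | hl | hl
  · exact absurd (h'.dvd l hl h.coeff_ne) h.not_dvd
  · exact hl
  · exact absurd (h.dvd l' hl h'.coeff_ne) h'.not_dvd

/-- Row data are preserved by a change of parameters which keeps the line `x_j = 0`. The linear term of
`x_(1 - j)` along this line must survive. -/
theorem RowData.map [IsAlgClosed k] {p e : ℕ} [ExpChar k p] {a : Base k} {i j : Fin 2} {r l : ℕ}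
    (h : RowData (p ^ e) a j r l) (θ : Base k →+* Base k) {v : Base k}
    (hv : MvPowerSeries.constantCoeff v ≠ 0) (hθ : θ (MvPowerSeries.X j) = v * MvPowerSeries.X i)
    (h0 : PowerSeries.coeff 0 (restrictX k i (θ (MvPowerSeries.X (1 - j)))) = 0)
    (h1 : PowerSeries.coeff 1 (restrictX k i (θ (MvPowerSeries.X (1 - j)))) ≠ 0) :
    RowData (p ^ e) (θ a) i r l := by
  classical
  obtain ⟨hmem, hne, hnd, hd⟩ := h
  obtain ⟨g, rfl⟩ := exists_eq_X_pow_mul hmem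
  simp only [coeff_expo_X_pow_mul] at hne hd
  -- `P` consists of the terms of the lowest row before the first one which is not a `q`-th power
  let P : Base k := fun n =>
    if n j = 0 ∧ n (1 - j) < l then MvPowerSeries.coeff n g else 0
  have hP : ∀ n, MvPowerSeries.coeff n P =
      if n j = 0 ∧ n (1 - j) < l then MvPowerSeries.coeff n g else 0 := fun n => rfl
  have hPc : ∀ m, PowerSeries.coeff m (restrictX k j P) =
      if m < l then PowerSeries.coeff m (restrictX k j g) else 0 := by
    intro m
    rw [coeff_restrictX, hP, coeff_restrictX]; simp
  -- up to terms with a power of `x_j`, `g` is a `q`-th power plus `x_(1-j) ^ l` times a unit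
  obtain ⟨u, hu⟩ : PowerSeries.X ^ l ∣ restrictX k j (g - P) := by
    rw [PowerSeries.X_pow_dvd_iff]
    intro m hm
    rw [map_sub, map_sub, hPc, if_pos hm, sub_self]
  let U : Base k := fun n => if n j = 0 then PowerSeries.coeff (n (1 - j)) u else 0
  have hU : restrictX k j U = u := by
    ext m
    rw [coeff_restrictX]
    change (if expo j 0 m j = 0 then PowerSeries.coeff (expo j 0 m (1 - j)) u else 0) = _
    simp
  have hU0 : MvPowerSeries.constantCoeff U ≠ 0 := by
    have h2 := PowerSeries.coeff_X_pow_mul u l 0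
    rw [zero_add, ← hu, map_sub, map_sub, hPc, if_neg (lt_irrefl _), sub_zero,
      PowerSeries.coeff_zero_eq_constantCoeff_apply] at h2
    rw [← constantCoeff_restrictX j, hU, ← h2]
    exact hne
  obtain ⟨c, hc⟩ : (MvPowerSeries.X j : Base k) ∣ g - P - MvPowerSeries.X (1 - j) ^ l * U := by
    rw [← restrictX_eq_zero_iff, map_sub, hu, map_mul, map_pow, restrictX_X_other, hU, sub_self]
  have hg : g = P + MvPowerSeries.X (1 - j) ^ l * U + MvPowerSeries.X j * c := by
    rw [← hc]; ring
  have hθa : θ (MvPowerSeries.X j ^ r * g) = MvPowerSeries.X i ^ r * (v ^ r * θ g) := by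
    rw [map_mul, map_pow, hθ]; ring
  obtain ⟨β, hβ⟩ := PowerSeries.X_dvd_iff.2
    ((PowerSeries.coeff_zero_eq_constantCoeff_apply _).symm.trans h0)
  have hβ0 : PowerSeries.constantCoeff β ≠ 0 := by
    have := PowerSeries.coeff_succ_X_mul 0 β
    rw [← hβ, zero_add, PowerSeries.coeff_zero_eq_constantCoeff_apply] at this
    rw [← this]; exact h1
  have hres : restrictX k i (v ^ r * θ g) = restrictX k i (v ^ r * θ P) +
      PowerSeries.X ^ l * (restrictX k i v ^ r * β ^ l * restrictX k i (θ U)) := by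
    rw [hg]
    simp only [map_add, map_mul, map_pow, hθ, restrictX_X_self, hβ]
    ring
  -- the image of `x_j ^ r P` is a `q`-th power or zero, and does not contribute to the other terms
  have hPz : ∀ m, ¬ (p ^ e ∣ r ∧ p ^ e ∣ m) →
      PowerSeries.coeff m (restrictX k i (v ^ r * θ P)) = 0 := by
    intro m hm
    have hsup : ∀ n, MvPowerSeries.coeff n P ≠ 0 → p ^ e ∣ r ∧ n j = 0 ∧ p ^ e ∣ n (1 - j) := by
      intro n hn
      rw [hP] at hn
      split_ifs at hn with hn'
      · have := hd (n (1 - j)) hn'.2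
        rw [coeff_restrictX, ← hn'.1, ← eq_expo] at this
        exact ⟨(this hn).1, hn'.1, (this hn).2⟩
      · exact absurd rfl hn
    by_cases hr : p ^ e ∣ r
    · obtain ⟨G, hG, -⟩ := exists_pow_eq (p := p) (e := e) (f := P) (by
        intro n hn
        rw [forall_dvd_iff j]
        obtain ⟨-, h3, h4⟩ := hsup n hn
        rw [h3]
        exact ⟨dvd_zero _, h4⟩)
      obtain ⟨s, hs⟩ := hr
      rw [coeff_restrictX, ← hG, map_pow, hs, mul_comm (p ^ e) s, pow_mul, ← mul_pow]
      refine coeff_pow_eq_zero (i := 1 - i) _ fun h => hm ⟨⟨s, hs⟩, ?_⟩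
      simpa using h
    · have : P = 0 := by
        ext n
        by_contra hn
        exact hr (hsup n hn).1
      rw [this]; simp
  have hθU : MvPowerSeries.constantCoeff (θ U) ≠ 0 := by
    have h2 : IsUnit U := by
      rw [MvPowerSeries.isUnit_iff_constantCoeff]; exact isUnit_iff_ne_zero.2 hU0
    have h3 := h2.map θ
    rw [MvPowerSeries.isUnit_iff_constantCoeff] at h3
    exact h3.ne_zero
  rw [hθa]
  refine ⟨X_pow_mul_mem _ _ _, ?_, hnd, fun l' hl' hne' => ?_⟩
  · rw [coeff_expo_X_pow_mul, hres, map_add, hPz l hnd, zero_add]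
    have h2 := PowerSeries.coeff_X_pow_mul (restrictX k i v ^ r * β ^ l * restrictX k i (θ U)) l 0
    rw [zero_add] at h2
    rw [h2, PowerSeries.coeff_zero_eq_constantCoeff_apply, map_mul, map_mul, map_pow, map_pow,
      constantCoeff_restrictX, constantCoeff_restrictX]
    exact mul_ne_zero (mul_ne_zero (pow_ne_zero _ hv) (pow_ne_zero _ hβ0)) hθU
  · by_contra hcon
    rw [coeff_expo_X_pow_mul, hres, map_add, hPz l' hcon, zero_add] at hne'
    exact hne' (PowerSeries.X_pow_dvd_iff.1 (Dvd.intro _ rfl) l' hl')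

theorem natCeil_mem_iff {w : Fin 2 → ℕ} {s : ℚ} {f : Base k} :
    f ∈ ordIdeal k w s ↔ f ∈ ordIdeal k w (⌈s⌉₊ : ℚ) := by
  constructor
  · intro h n hn
    exact_mod_cast Nat.ceil_le.2 (h n hn)
  · exact fun h => ordIdeal_anti (Nat.le_ceil s) h

theorem map_mem_ordIdeal_single {θ : Base k →+* Base k} {i j : Fin 2} {s : ℚ} {f : Base k}
    (hθ : (MvPowerSeries.X i : Base k) ∣ θ (MvPowerSeries.X j))
    (hf : f ∈ ordIdeal k (Pi.single j 1) s) : θ f ∈ ordIdeal k (Pi.single i 1) s := by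
  rw [natCeil_mem_iff] at hf ⊢
  obtain ⟨g, rfl⟩ := exists_eq_X_pow_mul hf
  rw [map_mul, map_pow]
  exact X_pow_dvd_iff_mem.1 (Dvd.dvd.mul_right (pow_dvd_pow_of_dvd hθ _) _)

theorem map_mem_ordIdeal_one {θ : Base k →+* Base k} {w : Fin 2 → ℕ} {c : ℕ} {s : ℚ} {f : Base k}
    (hθ : ∀ j, θ (MvPowerSeries.X j) ∈ ordIdeal k w c)
    (hf : f ∈ ordIdeal k (fun _ => 1) s) : θ f ∈ ordIdeal k w (s * c) := by
  rw [natCeil_mem_iff] at hf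
  have h1 := map_mem_pow_of_mem_ordIdeal θ hθ hf
  have h2 : ∀ m : ℕ, ordIdeal k w c ^ m ≤ ordIdeal k w (m * c) := by
    intro m
    induction m with
    | zero => intro f _; exact mem_ordIdeal_of_nonpos (by simp) _
    | succ m ih =>
      rw [pow_succ, Ideal.mul_le]
      intro a ha b hb
      have := mul_mem_ordIdeal (ih ha) hb
      push_cast
      rwa [add_mul, one_mul]
  refine ordIdeal_anti ?_ (h2 _ h1)
  exact mul_le_mul_of_nonneg_right (Nat.le_ceil s) (Nat.cast_nonneg _)

end Rows

/-! ### Comparison of a presentation with other elements in Weierstrass form -/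

section Frames

variable {k : Type*} [Field k]

/-- The power series `z ^ q + ∑ A_j z ^ (q - j)`. -/
def weierstrassForm (q : ℕ) (A : ℕ → Base k) : Loc k :=
  PowerSeries.X ^ q + ∑ j ∈ Finset.Ioo 0 q, PowerSeries.C (A j) * PowerSeries.X ^ (q - j) +
    PowerSeries.C (A q)

/-- A regular system of parameters `(z, x, y)` together with an element `z ^ q + ∑ A_j z ^ (q - j)` of
level `q = p ^ e` of the idealistic filtration. This has just enough of the properties of a
presentation in order to compute the invariants from it, and it is easily transformed under
blow-ups. -/
structure Frame (p e : ℕ) (T : Triplet k) where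
  X : Coord k
  A : ℕ → Base k
  slot : ℕ → Fin 2
  div_eq : ∀ D ∈ T.bdry, T.div D = Ideal.span {X.xy (slot D)}
  mem : X (weierstrassForm (p ^ e) A) ∈ T.R.ideal (p ^ e)
  dvd : ∀ D ∈ T.bdry, ∀ j ∈ Finset.Ioo 0 (p ^ e),
    A j ∈ ordIdeal k (Pi.single (slot D) 1) (j * mu T (.gen D))

variable {p e : ℕ} {T : Triplet k}

theorem Presentation.coe_W_eq (H : Presentation p e T) (hp : 0 < p) :
    (H.W : Loc k) = weierstrassForm (p ^ e) fun j => H.W.coeff (p ^ e - j) := by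
  have hq : 0 < p ^ e := Nat.pow_pos hp
  have h1 := H.W.as_sum_range_C_mul_X_pow
  rw [H.natDegree_eq, sum_range_succ_eq _ hq, H.coeff_natDegree] at h1
  rw [weierstrassForm]
  conv_lhs => rw [h1]
  simp only [← Polynomial.coeToPowerSeries.ringHom_apply, map_add, map_mul, map_pow, map_sum]
  simp

/-- A presentation, seen as a frame. -/
def Presentation.toFrame (H : Presentation p e T) (hp : 0 < p) : Frame p e T where
  X := H.X
  A j := H.W.coeff (p ^ e - j)
  slot := H.slot
  div_eq := H.div_eq
  mem := by rw [← H.coe_W_eq hp]; exact H.h_mem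
  dvd _ hD _ hj := H.coeff_mem_gen hD hj

theorem Presentation.toFrame_last (H : Presentation p e T) (hp : 0 < p) :
    (H.toFrame hp).A (p ^ e) = H.aLast := by
  simp [toFrame, aLast]

instance : IsDomain (Loc k) := NoZeroDivisors.to_isDomain _

theorem maximalIdeal_base_eq :
    maximalIdeal (Base k) = Ideal.span (Set.range MvPowerSeries.X) := by
  apply le_antisymm
  · intro f hf
    rw [mem_maximalIdeal, mem_nonunits_iff, MvPowerSeries.isUnit_iff_constantCoeff,
      isUnit_iff_ne_zero, not_not] at hf
    obtain ⟨g₀, -, g₁, -, h⟩ := exists_eq_X_mul_add (s := -1) hf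
      (mem_ordIdeal_of_nonpos (by norm_num) _)
    rw [h]
    exact Ideal.add_mem _ (Ideal.mul_mem_right _ _ (Ideal.subset_span ⟨0, rfl⟩))
      (Ideal.mul_mem_right _ _ (Ideal.subset_span ⟨1, rfl⟩))
  · rw [Ideal.span_le]
    rintro _ ⟨j, rfl⟩
    rw [SetLike.mem_coe, mem_maximalIdeal, mem_nonunits_iff,
      MvPowerSeries.isUnit_iff_constantCoeff]
    simp

/-- Weierstrass division by `h`. -/
theorem Presentation.exists_division (H : Presentation p e T) (f : Loc k) :
    ∃ (Q : Loc k) (r : Polynomial (Base k)), r.degree < (p ^ e : ℕ) ∧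
      f = Q * (H.W : Loc k) + (r : Loc k) := by
  have : IsAdicComplete (maximalIdeal (Base k)) (Base k) := by
    rw [maximalIdeal_base_eq]; infer_instance
  have hlow : ∀ m < p ^ e, PowerSeries.coeff m ((H.W : Loc k).map (residue (Base k))) = 0 := by
    intro m hm
    rw [PowerSeries.coeff_map, Polynomial.coeff_coe, residue_eq_zero_iff, mem_maximalIdeal,
      mem_nonunits_iff, MvPowerSeries.isUnit_iff_constantCoeff, isUnit_iff_ne_zero, not_not,
      constantCoeff_eq_zero_iff_mem]
    have := H.coeff_mem_succ (j := p ^ e - m) (Finset.mem_Icc.2 ⟨by omega, Nat.sub_le _ _⟩)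
    rw [Nat.sub_sub_self hm.le] at this
    exact ordIdeal_anti (by simp) this
  have htop : PowerSeries.coeff (p ^ e) ((H.W : Loc k).map (residue (Base k))) = 1 := by
    rw [PowerSeries.coeff_map, Polynomial.coeff_coe, H.coeff_natDegree, map_one]
  have hord : ((H.W : Loc k).map (residue (Base k))).order = (p ^ e : ℕ) :=
    PowerSeries.order_eq_nat.2 ⟨by rw [htop]; exact one_ne_zero, hlow⟩
  obtain ⟨Q, r, hd⟩ := PowerSeries.exists_isWeierstrassDivision (f := f)
    (g := (H.W : Loc k)) (by
      intro h0
      rw [h0, map_zero] at htop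
      exact zero_ne_one htop)
  refine ⟨Q, r, ?_, by rw [hd.eq_mul_add, mul_comm]⟩
  have h1 := hd.degree_lt
  have h2 : ((H.W : Loc k).map (Ideal.Quotient.mk (maximalIdeal (Base k)))).order = (p ^ e : ℕ) :=
    hord
  rw [h2, ENat.toNat_natCast] at h1
  exact h1

/-- The relation between the last coefficient `a` of a presentation and a frame: the substitution `θ`
writes the parameters `x, y` of the frame in those of the presentation, up to multiples of `z`,
and `b` is the part of the parameter `z` of the frame which does not involve the one of the
presentation. -/
structure Comparison (H : Presentation p e T) (F : Frame p e T) where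
  θ : Base k →ₐ[k] Base k
  b : Base k
  Q : Base k
  r : Base k
  Q_unit : MvPowerSeries.constantCoeff Q ≠ 0
  r_mem : ∀ D ∈ T.bdry,
    r ∈ ordIdeal k (Pi.single (H.slot D) 1) ((p : ℚ) ^ e * mu T (.gen D))
  eq : Q * H.aLast + r = b ^ p ^ e +
    ∑ j ∈ Finset.Ioo 0 (p ^ e), θ (F.A j) * b ^ (p ^ e - j) + θ (F.A (p ^ e))
  map_slot : ∀ D ∈ T.bdry, ∃ v, MvPowerSeries.constantCoeff v ≠ 0 ∧
    θ (MvPowerSeries.X (F.slot D)) = v * MvPowerSeries.X (H.slot D)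
  b_zero : MvPowerSeries.constantCoeff b = 0
  map_X : ∀ j, MvPowerSeries.constantCoeff (θ (MvPowerSeries.X j)) = 0
  gen : ∀ j, (MvPowerSeries.X j : Base k) ∈
    Ideal.span {b, θ (MvPowerSeries.X 0), θ (MvPowerSeries.X 1)}

theorem weierstrassForm_not_mem (hp : 0 < p) (A : ℕ → Base k) :
    weierstrassForm (p ^ e) A ∉ maximalIdeal (Loc k) ^ (p ^ e + 1) := by
  have hq : 0 < p ^ e := Nat.pow_pos hp
  intro h
  have h1 := mem_maximalIdeal_pow_iff.1 h (p ^ e)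
  have h2 : PowerSeries.coeff (p ^ e) (weierstrassForm (p ^ e) A) = 1 := by
    rw [weierstrassForm, map_add, map_add, PowerSeries.coeff_X_pow_self, map_sum,
      Finset.sum_eq_zero, PowerSeries.coeff_C, if_neg hq.ne', add_zero, add_zero]
    intro j hj
    have := Finset.mem_Ioo.1 hj
    rw [PowerSeries.coeff_C_mul, PowerSeries.coeff_X_pow, if_neg (by omega), mul_zero]
  rw [h2] at h1
  have h3 := constantCoeff_eq_zero_iff_mem.2 (ordIdeal_anti (by push_cast; linarith) h1)
  simp at h3

/-- The comparison is obtained by dividing the element of the frame by `h` and setting `z = 0`. -/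
theorem Presentation.nonempty_comparison [ExpChar k p] (H : Presentation p e T)
    (F : Frame p e T) : Nonempty (Comparison H F) := by
  have hp : 0 < p := expChar_pos k p
  set q := p ^ e with hqdef
  have hqQ : (q : ℚ) = (p : ℚ) ^ e := by rw [hqdef]; push_cast; rfl
  -- `ψ` expresses the parameters of the frame in those of the presentation; `θ` then sets `z = 0`
  let ψ : Loc k →ₐ[k] Loc k := (F.X.trans H.X.symm : Coord k)
  have hψ : ∀ f, ψ f = H.X.symm (F.X f) := fun f => rfl
  let θ : Base k →ₐ[k] Base k :=
    { (restrictZ k).comp ((ψ : Loc k →+* Loc k).comp PowerSeries.C) with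
      commutes' := fun c => by
        have h1 : (PowerSeries.C (algebraMap k (Base k) c) : Loc k) = algebraMap k (Loc k) c := by
          rw [PowerSeries.algebraMap_apply]
        change restrictZ k (ψ (PowerSeries.C (algebraMap k (Base k) c))) = _
        rw [h1, AlgHom.commutes, PowerSeries.algebraMap_apply, PowerSeries.constantCoeff_C] }
  have hθ : ∀ f, θ f = restrictZ k (ψ (PowerSeries.C f)) := fun f => rfl
  obtain ⟨Q, r, hr, hdiv⟩ := H.exists_division (ψ (weierstrassForm q F.A))
  have hmem : H.X (ψ (weierstrassForm q F.A)) ∈ T.R.ideal q := by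
    rw [hψ, AlgEquiv.apply_symm_apply]; exact F.mem
  have hrD : ∀ D ∈ T.bdry, ∀ m, r.coeff m ∈
      ordIdeal k (Pi.single (H.slot D) 1) (q * mu T (.gen D)) := by
    intro D hD m
    have h1 := coeff_mem_ordIdeal_of_C_dvd (H.rem_dvd q _ Q r hmem hr hdiv D hD) m
    rw [Polynomial.coeff_coe] at h1
    refine ordIdeal_anti ?_ h1
    rw [mu]
    calc (q : ℚ) * ((T.mult D : ℚ) / T.level) = (T.mult D : ℚ) * q / T.level := by ring
      _ ≤ _ := Nat.le_ceil _
  -- since `μ(P) > 1`, the remainder has order greater than `q`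
  have hrm : (r : Loc k) ∈ maximalIdeal (Loc k) ^ (q + 1) := by
    rw [mem_maximalIdeal_pow_iff]
    intro m
    rw [Polynomial.coeff_coe]
    have h1 := mem_ordIdeal_pt H.slot H.slot_injOn fun D hD => hrD D hD m
    have h2 : (q : ℚ) < q * mu T .pt := by
      have := H.one_lt_mu
      have hq0 : (0 : ℚ) < q := by exact_mod_cast Nat.pow_pos hp
      nlinarith
    intro n hn
    have h3 := h2.trans_le (h1 n hn)
    rw [Nat.cast_lt] at h3
    have h4 : ((q + 1 : ℕ) : ℚ) ≤ (Finsupp.weight (fun _ : Fin 2 => 1) n : ℕ) := by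
      exact_mod_cast h3
    have h5 : (0 : ℚ) ≤ m := Nat.cast_nonneg _
    linarith
  refine ⟨⟨θ, restrictZ k (ψ PowerSeries.X), restrictZ k Q, restrictZ k (r : Loc k), ?_, ?_, ?_, ?_,
    ?_, ?_, ?_⟩⟩
  -- otherwise the frame element would have order greater than `q`
  · intro h0
    have hQ := mem_maximalIdeal_loc_iff.2 h0
    have hW : (H.W : Loc k) ∈ maximalIdeal (Loc k) ^ q := by
      have h1 := Ideal.pow_le_pow_right (Nat.le_succ q) H.sub_X_pow_mem
      have h2 := Ideal.add_mem _ h1 (Ideal.pow_mem_pow (X_mem_maximalIdeal (k := k)) q)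
      rwa [sub_add_cancel] at h2
    have h3 : ψ (weierstrassForm q F.A) ∈ maximalIdeal (Loc k) ^ (q + 1) := by
      rw [hdiv]
      refine Ideal.add_mem _ ?_ hrm
      rw [pow_succ']
      exact Ideal.mul_mem_mul hQ hW
    exact weierstrassForm_not_mem hp F.A
      ((coord_mem_pow_iff (F.X.trans H.X.symm)).1 h3)
  · intro D hD
    have := hrD D hD 0
    rw [hqQ] at this
    rw [← PowerSeries.coeff_zero_eq_constantCoeff_apply, Polynomial.coeff_coe]
    exact this
  · have h1 := congrArg (restrictZ k) hdiv
    rw [map_add, map_mul] at h1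
    have h2 : restrictZ k (H.W : Loc k) = H.aLast := by
      rw [← PowerSeries.coeff_zero_eq_constantCoeff_apply, Polynomial.coeff_coe]; rfl
    rw [h2] at h1
    rw [← h1, weierstrassForm]
    simp only [map_add, map_pow, map_sum, map_mul, hθ]
    rfl
  · intro D hD
    have h1 := (F.div_eq D hD).symm.trans (H.div_eq D hD)
    rw [Ideal.span_singleton_eq_span_singleton] at h1
    obtain ⟨u, hu⟩ := h1.symm
    have hu' : IsUnit (H.X.symm (u : Loc k)) := u.isUnit.map H.X.symm
    refine ⟨restrictZ k (H.X.symm u), isUnit_loc_iff.1 hu', ?_⟩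
    rw [hθ, hψ]
    have h2 : F.X (PowerSeries.C (MvPowerSeries.X (F.slot D) : Base k)) = F.X.xy (F.slot D) := rfl
    rw [h2, ← hu, map_mul, Coord.xy, AlgEquiv.symm_apply_apply, map_mul,
      PowerSeries.constantCoeff_C, mul_comm]
  · rw [← mem_maximalIdeal_loc_iff]
    exact algHom_map_mem X_mem_maximalIdeal
  · intro j
    rw [hθ, ← mem_maximalIdeal_loc_iff]
    exact algHom_map_mem (C_X_mem_maximalIdeal j)
  · intro j
    have h1 := C_X_mem_maximalIdeal (k := k) j
    have h2 : (F.X.trans H.X.symm : Coord k).symm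
        (PowerSeries.C (MvPowerSeries.X j : Base k)) ∈ maximalIdeal (Loc k) :=
      (coord_mem_iff (F.X.trans H.X.symm : Coord k).symm).2 h1
    rw [maximalIdeal_loc_eq] at h2
    have h3 := Ideal.mem_map_of_mem ((restrictZ k).comp (ψ : Loc k →+* Loc k)) h2
    rw [Ideal.map_span] at h3
    have h4 : ((restrictZ k).comp (ψ : Loc k →+* Loc k))
      ((F.X.trans H.X.symm : Coord k).symm (PowerSeries.C (MvPowerSeries.X j : Base k))) =
        MvPowerSeries.X j := by
      have : ψ ((F.X.trans H.X.symm : Coord k).symm (PowerSeries.C (MvPowerSeries.X j : Base k))) =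
        PowerSeries.C (MvPowerSeries.X j : Base k) :=
        AlgEquiv.apply_symm_apply (F.X.trans H.X.symm : Coord k) _
      rw [RingHom.comp_apply, RingHom.coe_coe, this, PowerSeries.constantCoeff_C]
    rw [h4] at h3
    simpa [Set.image_insert_eq, hθ] using h3

/-- The elements of level `n` of the filtration have order at least `n` if the closed point is in the
singular locus. -/
theorem ideal_le_pow (h : closedPoint (Loc k) ∈ T.R.Sing) (n : ℕ) :
    T.R.ideal n ≤ maximalIdeal (Loc k) ^ n := by
  have hcomap : (maximalIdeal (Localization.AtPrime (maximalIdeal (Loc k))) ^ n).comap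
      (algebraMap (Loc k) (Localization.AtPrime (maximalIdeal (Loc k)))) ≤
        maximalIdeal (Loc k) ^ n := by
    intro f hf
    rw [Ideal.mem_comap, ← Localization.AtPrime.map_eq_maximalIdeal, ← Ideal.map_pow] at hf
    obtain ⟨⟨⟨a, ha⟩, s⟩, hs⟩ :=
      (IsLocalization.mem_map_algebraMap_iff (maximalIdeal (Loc k)).primeCompl _).1 hf
    simp only at hs
    rw [← map_mul] at hs
    have hinj : Function.Injective
        (algebraMap (Loc k) (Localization.AtPrime (maximalIdeal (Loc k)))) :=
      IsLocalization.injective _ (maximalIdeal (Loc k)).primeCompl_le_nonZeroDivisors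
    have h1 := hinj hs
    have hsu : IsUnit (s : Loc k) := by
      by_contra hcon
      exact s.2 ((mem_maximalIdeal _).2 hcon)
    rw [← h1] at ha
    exact (Ideal.mul_unit_mem_iff_mem _ hsu).1 ha
  exact (Ideal.map_le_iff_le_comap.1 (h n)).trans hcomap

theorem Frame.last_mem (F : Frame p e T) (hp : 0 < p) (h : closedPoint (Loc k) ∈ T.R.Sing) :
    F.A (p ^ e) ∈ ordIdeal k (fun _ => 1) ((p : ℚ) ^ e) := by
  have h1 := (coord_mem_pow_iff F.X).1 (ideal_le_pow h _ F.mem)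
  have h2 := mem_maximalIdeal_pow_iff.1 h1 0
  have hq : 0 < p ^ e := Nat.pow_pos hp
  have h3 : PowerSeries.coeff 0 (weierstrassForm (p ^ e) F.A) = F.A (p ^ e) := by
    rw [weierstrassForm, map_add, map_add, PowerSeries.coeff_X_pow, if_neg hq.ne, map_sum,
      Finset.sum_eq_zero, PowerSeries.coeff_zero_C, zero_add, zero_add]
    intro j hj
    have := Finset.mem_Ioo.1 hj
    rw [PowerSeries.coeff_C_mul, PowerSeries.coeff_X_pow, if_neg (by omega), mul_zero]
  rw [h3] at h2
  simpa using h2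

end Frames

/-! ### The invariants do not depend on the presentation -/

section Slope

variable {k : Type*} [Field k] {p e : ℕ} {T : Triplet k}

theorem exists_lowest {w : Fin 2 → ℕ} {s : ℚ} {a : Base k} (h : a ∉ ordIdeal k w s) :
    ∃ N : ℕ, a ∈ ordIdeal k w N ∧
      (∃ n, MvPowerSeries.coeff n a ≠ 0 ∧ Finsupp.weight w n = N) ∧ (N : ℚ) < s := by
  classical
  rw [mem_ordIdeal] at h
  push Not at h
  have hex : ∃ N, ∃ n, MvPowerSeries.coeff n a ≠ 0 ∧ Finsupp.weight w n = N :=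
    ⟨_, h.choose, h.choose_spec.1, rfl⟩
  have hmem : a ∈ ordIdeal k w (Nat.find hex : ℕ) := fun n hn => by
    exact_mod_cast Nat.find_min' hex ⟨n, hn, rfl⟩
  refine ⟨Nat.find hex, hmem, Nat.find_spec hex, ?_⟩
  obtain ⟨n, hn, hlt⟩ := h
  exact (hmem n hn).trans_lt hlt

theorem weightedOrder_of_lowest {w : Fin 2 → ℕ} {N : ℕ} {a : Base k} (h : a ∈ ordIdeal k w N)
    (h' : ∃ n, MvPowerSeries.coeff n a ≠ 0 ∧ Finsupp.weight w n = N) :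
    a.weightedOrder w = N := by
  rw [MvPowerSeries.weightedOrder_eq_nat]
  exact ⟨h', fun n hn => coeff_eq_zero_of_mem h (by exact_mod_cast hn)⟩

namespace Presentation

variable (H : Presentation p e T)

theorem slope_of_mem (hp : 0 < p) {v : Place}
    (h : H.aLast ∈ ordIdeal k (H.wt v) ((p : ℚ) ^ e * mu T v)) : H.slope v = mu T v := by
  have hq : (0 : ℚ) < (p : ℚ) ^ e := by positivity
  rw [slope]
  split_ifs with h0
  · rfl
  · rw [min_eq_right]
    obtain ⟨n, hn⟩ : ∃ n, MvPowerSeries.coeff n H.aLast ≠ 0 := by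
      by_contra hcon
      push Not at hcon
      exact h0 (by ext n; simpa using hcon n)
    obtain ⟨N, hN, hN', -⟩ := exists_lowest (w := H.wt v) (a := H.aLast)
      (s := (Finsupp.weight (H.wt v) n : ℕ) + 1) (fun h => by have := h n hn; linarith)
    rw [weightedOrder_of_lowest hN hN', ENat.toNat_natCast, le_div_iff₀ hq, mul_comm]
    obtain ⟨n', hn', hw⟩ := hN'
    rw [← hw]
    exact h n' hn'

theorem lowest (hp : 0 < p) {v : Place}
    (h : H.aLast ∉ ordIdeal k (H.wt v) ((p : ℚ) ^ e * mu T v)) :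
    ∃ N : ℕ, H.aLast ∈ ordIdeal k (H.wt v) N ∧
      (∃ n, MvPowerSeries.coeff n H.aLast ≠ 0 ∧ Finsupp.weight (H.wt v) n = N) ∧
      (N : ℚ) < (p : ℚ) ^ e * mu T v ∧ H.slope v = N / (p : ℚ) ^ e ∧ H.slope v < mu T v ∧
      ∀ n, MvPowerSeries.coeff n (initialForm (H.wt v) H.aLast) =
        if Finsupp.weight (H.wt v) n = N then MvPowerSeries.coeff n H.aLast else 0 := by
  classical
  have hq : (0 : ℚ) < (p : ℚ) ^ e := by positivity
  obtain ⟨N, hN, hN', hlt⟩ := exists_lowest h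
  have hlt' : (N : ℚ) / (p : ℚ) ^ e < mu T v := by
    rw [div_lt_iff₀ hq]; linarith
  have hs : H.slope v = N / (p : ℚ) ^ e := by
    rw [slope, if_neg, weightedOrder_of_lowest hN hN', ENat.toNat_natCast, min_eq_left hlt'.le]
    intro h0
    exact h (h0 ▸ Ideal.zero_mem _)
  refine ⟨N, hN, hN', hlt, hs, hs ▸ hlt', fun n => ?_⟩
  rw [initialForm, weightedOrder_of_lowest hN hN', ENat.toNat_natCast,
    MvPowerSeries.coeff_weightedHomogeneousComponent]

theorem Clean.wellAdapted [IsAlgClosed k] [ExpChar k p] {v : Place} {H : Presentation p e T}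
    (hc : H.Clean v) : H.WellAdapted v := by
  have hp : 0 < p := expChar_pos k p
  by_cases h : H.aLast ∈ ordIdeal k (H.wt v) ((p : ℚ) ^ e * mu T v)
  · exact Or.inl (H.slope_of_mem hp h)
  · obtain ⟨N, hN, ⟨n, hn, hw⟩, hlt, hs, hs', hI⟩ := H.lowest hp h
    refine Or.inr ⟨hs', fun hpow => ?_⟩
    rw [exists_pow_eq_iff] at hpow
    refine hc n hn (fun n' hn' => ?_) (by rw [hw]; exact hlt)
      (hpow n (by rw [hI, if_pos hw]; exact hn))
    rw [hw]
    exact_mod_cast hN n' hn'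

theorem resOrd_eq [IsAlgClosed k] [ExpChar k p] {f : Base k} {d : ℕ}
    (h1 : ∃ n, MvPowerSeries.coeff n f ≠ 0 ∧ (¬ ∀ i, p ^ e ∣ n i) ∧ n 0 + n 1 = d)
    (h2 : ∀ n, MvPowerSeries.coeff n f ≠ 0 → (¬ ∀ i, p ^ e ∣ n i) → d ≤ n 0 + n 1) :
    resOrd (p ^ e) f = d := by
  classical
  have hiff : ∀ n, MvPowerSeries.coeff n f ≠ 0 →
      ((¬ ∃ g : Base k, g ^ p ^ e = MvPowerSeries.monomial n (MvPowerSeries.coeff n f)) ↔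
        ¬ ∀ i, p ^ e ∣ n i) := by
    intro n hn
    rw [exists_pow_eq_iff]
    refine not_congr ⟨fun h => h n (by simpa using hn), fun h n' hn' => ?_⟩
    rw [MvPowerSeries.coeff_monomial] at hn'
    split_ifs at hn' with h'
    · rw [h']; exact h
    · exact absurd rfl hn'
  have hdeg : ∀ n : Fin 2 →₀ ℕ, n.degree = n 0 + n 1 := fun n => by
    rw [Finsupp.degree_eq_sum, Fin.sum_univ_two]
  rw [resOrd]
  apply le_antisymm
  · obtain ⟨n, hn, hd, hnd⟩ := h1
    exact Nat.sInf_le ⟨n, hn, (hiff n hn).2 hd, (hdeg n).trans hnd⟩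
  · obtain ⟨n, hn, hd, hnd⟩ := h1
    refine le_csInf ⟨d, n, hn, (hiff n hn).2 hd, (hdeg n).trans hnd⟩ ?_
    rintro _ ⟨n', hn', hd', rfl⟩
    rw [hdeg]
    exact h2 n' hn' ((hiff n' hn').1 hd')

/-- At a bad component, a well-adapted presentation has row data, and these give the slope and the residual
order. -/
theorem WellAdapted.rowData [IsAlgClosed k] [ExpChar k p] {H : Presentation p e T} {D : ℕ}
    (hw : H.WellAdapted (.gen D))
    (h : H.aLast ∉ ordIdeal k (Pi.single (H.slot D) 1) ((p : ℚ) ^ e * mu T (.gen D))) :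
    ∃ r l, RowData (p ^ e) H.aLast (H.slot D) r l ∧ (r : ℚ) < (p : ℚ) ^ e * mu T (.gen D) ∧
      H.slope (.gen D) = r / (p : ℚ) ^ e ∧
      resOrd (p ^ e) (initialForm (H.wt (.gen D)) H.aLast) = r + l := by
  classical
  have hp : 0 < p := expChar_pos k p
  obtain ⟨N, hN, -, hlt, hs, hs', hI⟩ := H.lowest hp h
  rw [wt_gen] at hN
  have hI' : ∀ n, MvPowerSeries.coeff n (initialForm (H.wt (.gen D)) H.aLast) =
      if n (H.slot D) = N then MvPowerSeries.coeff n H.aLast else 0 := by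
    intro n
    have := hI n
    rwa [wt_gen, weight_single] at this
  have hnp : ¬ ∃ g : Base k, g ^ p ^ e = initialForm (H.wt (.gen D)) H.aLast := by
    rcases hw with hw | hw
    · exact absurd hw hs'.ne
    · exact hw.2
  rw [exists_pow_eq_iff] at hnp
  push Not at hnp
  obtain ⟨n, hn, hnd⟩ := hnp
  rw [hI'] at hn
  have hnN : n (H.slot D) = N := by
    by_contra hcon
    rw [if_neg hcon] at hn
    exact hn rfl
  rw [if_pos hnN] at hn
  -- the initial form at `ξ_D` is the row `N`, and it contains a term which is not a `q`-th power
  have hnd' : ¬ (p ^ e ∣ N ∧ p ^ e ∣ n (1 - H.slot D)) := by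
    rw [← hnN, ← forall_dvd_iff]
    push Not
    exact hnd
  have hex : ∃ l, MvPowerSeries.coeff (expo (H.slot D) N l) H.aLast ≠ 0 ∧
      ¬ (p ^ e ∣ N ∧ p ^ e ∣ l) :=
    ⟨n (1 - H.slot D), by rw [← hnN, ← eq_expo]; exact hn, hnd'⟩
  have hrow : RowData (p ^ e) H.aLast (H.slot D) N (Nat.find hex) :=
    ⟨hN, (Nat.find_spec hex).1, (Nat.find_spec hex).2, fun l' hl' hne => by
      by_contra hcon
      exact Nat.find_min hex hl' ⟨hne, hcon⟩⟩
  refine ⟨N, Nat.find hex, hrow, hlt, hs, resOrd_eq ?_ ?_⟩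
  · refine ⟨expo (H.slot D) N (Nat.find hex), ?_, ?_, ?_⟩
    · rw [hI', if_pos (by simp)]; exact hrow.coeff_ne
    · rw [forall_dvd_iff (H.slot D)]; simpa using hrow.not_dvd
    · rw [add_eq_add (H.slot D)]; simp
  · intro n' hn' hd'
    rw [hI'] at hn'
    split_ifs at hn' with hN'
    · rw [add_eq_add (H.slot D), hN']
      refine Nat.add_le_add_left (Nat.find_min' hex ⟨?_, ?_⟩) _
      · rw [← hN', ← eq_expo]; exact hn'
      · rwa [forall_dvd_iff (H.slot D), hN'] at hd'
    · exact absurd rfl hn'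

end Presentation

end Slope

section Compare

variable {k : Type*} [Field k] {p e : ℕ} {T : Triplet k} {H : Presentation p e T}
  {F : Frame p e T}

namespace Comparison

variable (C : Comparison H F)
include C

theorem theta_coeff_mem {v : Place} (hv : IsPlace T v) {j : ℕ} (hj : j ∈ Finset.Ioo 0 (p ^ e)) :
    C.θ (F.A j) ∈ ordIdeal k (H.wt v) (j * mu T v) := by
  have h1 : ∀ D ∈ T.bdry, C.θ (F.A j) ∈ ordIdeal k (Pi.single (H.slot D) 1)
      (j * mu T (.gen D)) := by
    intro D hD
    obtain ⟨u, -, hu⟩ := C.map_slot D hD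
    exact map_mem_ordIdeal_single (θ := (C.θ : Base k →+* Base k)) (j := F.slot D)
      (Dvd.intro_left u hu.symm) (F.dvd D hD j hj)
  cases v with
  | pt => exact Presentation.mem_ordIdeal_pt H.slot H.slot_injOn h1
  | gen D => exact h1 D (hv D rfl)

theorem r_mem_wt {v : Place} (hv : IsPlace T v) :
    C.r ∈ ordIdeal k (H.wt v) ((p : ℚ) ^ e * mu T v) := by
  cases v with
  | pt => exact Presentation.mem_ordIdeal_pt H.slot H.slot_injOn C.r_mem
  | gen D => exact C.r_mem D (hv D rfl)

/-- In weights below `q * μ`, the lowest terms of `a` agree with those of the last coefficient of the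
frame up to a unit and `q`-th powers. -/
theorem coeff_eq [ExpChar k p] {v : Place} (hv : IsPlace T v) {N : ℕ}
    (hN : (N : ℚ) < (p : ℚ) ^ e * mu T v) (ha : H.aLast ∈ ordIdeal k (H.wt v) N)
    (hA : C.θ (F.A (p ^ e)) ∈ ordIdeal k (H.wt v) N) {n : Fin 2 →₀ ℕ}
    (hn : Finsupp.weight (H.wt v) n = N) :
    MvPowerSeries.coeff n (C.Q * H.aLast) =
      MvPowerSeries.coeff n (C.b ^ p ^ e) + MvPowerSeries.coeff n (C.θ (F.A (p ^ e))) := by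
  have h1 := (coeff_eq_of_level hN (Ideal.add_mem _ (Ideal.mul_mem_left _ C.Q ha)
    (ordIdeal_anti hN.le (C.r_mem_wt hv))) hA (fun j hj => C.theta_coeff_mem hv hj) C.eq).2 n hn
  rw [map_add, coeff_eq_zero_of_mem (C.r_mem_wt hv) (by rw [hn]; exact hN), add_zero] at h1
  exact h1

theorem exists_of_not_mem [ExpChar k p] {v : Place} (hv : IsPlace T v) {s : ℚ}
    (hs : s ≤ (p : ℚ) ^ e * mu T v) (hA : C.θ (F.A (p ^ e)) ∈ ordIdeal k (H.wt v) s)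
    (ha : H.aLast ∉ ordIdeal k (H.wt v) s) :
    ∃ N : ℕ, H.aLast ∈ ordIdeal k (H.wt v) N ∧
      (∃ n, MvPowerSeries.coeff n H.aLast ≠ 0 ∧ Finsupp.weight (H.wt v) n = N) ∧ (N : ℚ) < s ∧
      ∀ n, Finsupp.weight (H.wt v) n = N → MvPowerSeries.coeff n (C.Q * H.aLast) ≠ 0 →
        ∀ i, p ^ e ∣ n i := by
  obtain ⟨N, hN, hN', hlt⟩ := exists_lowest ha
  refine ⟨N, hN, hN', hlt, fun n hn hne i => ?_⟩
  by_contra hi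
  rw [C.coeff_eq hv (hlt.trans_le hs) hN (ordIdeal_anti hlt.le hA) hn, coeff_pow_eq_zero _ hi,
    zero_add, coeff_eq_zero_of_mem hA (by rw [hn]; exact hlt)] at hne
  exact hne rfl

theorem mem_gen [ExpChar k p] {D : ℕ} (hD : D ∈ T.bdry) (hc : H.Clean (.gen D)) {s : ℚ}
    (hs : s ≤ (p : ℚ) ^ e * mu T (.gen D))
    (hA : F.A (p ^ e) ∈ ordIdeal k (Pi.single (F.slot D) 1) s) :
    H.aLast ∈ ordIdeal k (Pi.single (H.slot D) 1) s := by
  classical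
  have hv : IsPlace T (.gen D) := fun D' h => by cases h; exact hD
  obtain ⟨u, -, hu⟩ := C.map_slot D hD
  have hA' := map_mem_ordIdeal_single (θ := (C.θ : Base k →+* Base k)) (i := H.slot D)
    (Dvd.intro_left u hu.symm) hA
  by_contra hcon
  obtain ⟨N, hN, ⟨n, hn, hnN⟩, hlt, hdiv⟩ := C.exists_of_not_mem hv hs hA' hcon
  rw [H.wt_gen, weight_single] at hnN
  have hex : ∃ l, MvPowerSeries.coeff (expo (H.slot D) N l) H.aLast ≠ 0 :=
    ⟨n (1 - H.slot D), by rw [← hnN, ← eq_expo]; exact hn⟩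
  have h1 := coeff_unit_mul (l := Nat.find hex) C.Q hN (fun l' hl' => by
    simpa using Nat.find_min hex hl')
  have h2 : Finsupp.weight (H.wt (.gen D)) (expo (H.slot D) N (Nat.find hex)) = N := by
    rw [H.wt_gen, weight_single, expo_same]
  refine hc _ (Nat.find_spec hex) (fun n' hn' => ?_) ?_ (hdiv _ h2 ?_)
  · rw [h2]; exact_mod_cast hN n' hn'
  · rw [h2]; exact hlt.trans_le hs
  · rw [h1.2]
    exact mul_ne_zero C.Q_unit (Nat.find_spec hex)

theorem mem_pt [IsAlgClosed k] [ExpChar k p] (hw : H.WellAdapted .pt) {s : ℚ}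
    (hs : s ≤ (p : ℚ) ^ e * mu T .pt) (hA : F.A (p ^ e) ∈ ordIdeal k (fun _ => 1) s) :
    H.aLast ∈ ordIdeal k (fun _ => 1) s := by
  have hp : 0 < p := expChar_pos k p
  have hv : IsPlace T .pt := fun D' h => by cases h
  have hA' := map_mem_ordIdeal_one (θ := (C.θ : Base k →+* Base k)) (w := fun _ => 1) (c := 1)
    (fun j => by
      rw [Nat.cast_one]
      exact constantCoeff_eq_zero_iff_mem.1 (C.map_X j)) hA
  rw [Nat.cast_one, mul_one] at hA'
  by_contra hcon
  obtain ⟨N, hN, hN', hlt, hdiv⟩ := C.exists_of_not_mem hv hs hA' hcon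
  obtain ⟨N₁, hN₁, ⟨n₁, hn₁, hw₁⟩, hlt₁, -, hs₁, hI⟩ := H.lowest hp (v := .pt) (fun h =>
    hcon (ordIdeal_anti hs h))
  obtain rfl : N = N₁ := by
    obtain ⟨n, hn, hw⟩ := hN'
    have h1 := hN₁ n hn
    have h2 := hN n₁ hn₁
    rw [hw, Nat.cast_le] at h1
    rw [hw₁, Nat.cast_le] at h2
    exact le_antisymm h2 h1
  rcases hw with hw | hw
  · exact hs₁.ne hw
  · refine hw.2 (exists_pow_eq_iff.2 fun n hn => ?_)
    rw [hI] at hn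
    split_ifs at hn with hnN
    · refine hdiv n hnN ?_
      -- in the lowest degree only the constant term of the unit matters
      have h1 : C.Q * H.aLast = MvPowerSeries.C (MvPowerSeries.constantCoeff C.Q) * H.aLast +
          (C.Q - MvPowerSeries.C (MvPowerSeries.constantCoeff C.Q)) * H.aLast := by ring
      have h2 := mul_mem_ordIdeal (constantCoeff_eq_zero_iff_mem.1 (by simp :
        MvPowerSeries.constantCoeff (C.Q - MvPowerSeries.C (MvPowerSeries.constantCoeff C.Q)) = 0))
        hN
      rw [h1, map_add, coeff_eq_zero_of_mem h2, add_zero, MvPowerSeries.coeff_C_mul]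
      · exact mul_ne_zero C.Q_unit hn
      · rw [H.wt_pt] at hnN
        rw [hnN]; linarith
    · exact absurd rfl hn

/-- Modulo `x_D`, the other parameter of the frame is the other parameter of the presentation, up to a
unit. -/
theorem coeff_other_ne [ExpChar k p] (hT : closedPoint (Loc k) ∈ T.R.Sing) {D : ℕ}
    (hD : D ∈ T.bdry) (hμ : 0 < mu T (.gen D)) :
    PowerSeries.coeff 1 (restrictX k (H.slot D) (C.θ (MvPowerSeries.X (1 - F.slot D)))) ≠ 0 := by
  classical
  have hp : 0 < p := expChar_pos k p
  have hq : 0 < p ^ e := Nat.pow_pos hp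
  have hv : IsPlace T (.gen D) := fun D' h => by cases h; exact hD
  set i := H.slot D with hi
  obtain ⟨u, hu0, hu⟩ := C.map_slot D hD
  intro h0
  have hρ1 : restrictX k i (C.θ (MvPowerSeries.X (F.slot D))) = 0 := by
    rw [restrictX_eq_zero_iff]; exact Dvd.intro_left u hu.symm
  have hdvd2 : ∀ f : PowerSeries k, PowerSeries.constantCoeff f = 0 → PowerSeries.coeff 1 f = 0 →
      f ∈ Ideal.span {(PowerSeries.X : PowerSeries k) ^ 2} := by
    intro f h1 h2
    rw [Ideal.mem_span_singleton, PowerSeries.X_pow_dvd_iff]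
    intro m hm
    interval_cases m
    · rwa [PowerSeries.coeff_zero_eq_constantCoeff_apply]
    · exact h2
  have hθj : ∀ j, restrictX k i (C.θ (MvPowerSeries.X j)) ∈
      Ideal.span {(PowerSeries.X : PowerSeries k) ^ 2} := by
    intro j
    rcases eq_or_eq_one_sub (F.slot D) j with rfl | rfl
    · rw [hρ1]; exact Ideal.zero_mem _
    · exact hdvd2 _ (by rw [constantCoeff_restrictX, C.map_X]) h0
  have hb0 : PowerSeries.constantCoeff (restrictX k i C.b) = 0 := by
    rw [constantCoeff_restrictX, C.b_zero]
  -- as the three elements generate the maximal ideal, the restriction of `b` has a linear term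
  have hb : PowerSeries.coeff 1 (restrictX k i C.b) ≠ 0 := by
    intro hb1
    have h1 := Ideal.mem_map_of_mem (restrictX k i) (C.gen (1 - i))
    rw [Ideal.map_span, restrictX_X_other] at h1
    have hX2 : Ideal.span (restrictX k i '' {C.b, C.θ (MvPowerSeries.X 0),
        C.θ (MvPowerSeries.X 1)}) ≤ Ideal.span {(PowerSeries.X : PowerSeries k) ^ 2} := by
      rw [Ideal.span_le]
      rintro _ ⟨g, rfl | rfl | rfl, rfl⟩
      exacts [hdvd2 _ hb0 hb1, hθj 0, hθj 1]
    have h2 := hX2 h1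
    rw [Ideal.mem_span_singleton, PowerSeries.X_pow_dvd_iff] at h2
    have h3 := h2 1 (by norm_num)
    rw [PowerSeries.coeff_one_X] at h3
    exact one_ne_zero h3
  have hz : ∀ (f : Base k) (s : ℚ), 0 < s → f ∈ ordIdeal k (H.wt (.gen D)) s →
      restrictX k i f = 0 := by
    intro f s hs hf
    rw [restrictX_eq_zero_iff, X_dvd_iff_mem]
    intro n hn
    have h1 : (0 : ℚ) < _ := hs.trans_le (hf n hn)
    rw [Nat.cast_pos] at h1
    exact_mod_cast h1
  have hq' : (0 : ℚ) < (p : ℚ) ^ e := by positivity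
  -- restricted to `x_D = 0`, the comparison equation reads `Q a_q = b ^ q + A_q`
  have hsum : restrictX k i (∑ j ∈ Finset.Ioo 0 (p ^ e), C.θ (F.A j) * C.b ^ (p ^ e - j)) = 0 := by
    rw [map_sum]
    refine Finset.sum_eq_zero fun j hj => ?_
    have hj0 : (0 : ℚ) < j := by exact_mod_cast (Finset.mem_Ioo.1 hj).1
    rw [map_mul, hz _ _ (mul_pos hj0 hμ) (C.theta_coeff_mem hv hj), zero_mul]
  have hA := map_mem_pow_of_mem_ordIdeal ((restrictX k i).comp (C.θ : Base k →+* Base k))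
    (I := Ideal.span {(PowerSeries.X : PowerSeries k) ^ 2}) hθj (m := p ^ e)
    (by exact_mod_cast F.last_mem hp hT)
  rw [Ideal.span_singleton_pow, ← pow_mul, Ideal.mem_span_singleton, PowerSeries.X_pow_dvd_iff] at hA
  -- `A_q` and `a_q` vanish to order `2 q` and `q + 1`, whereas `b ^ q` vanishes exactly to order `q`
  have ha : PowerSeries.X ^ (p ^ e + 1) ∣ restrictX k i (C.Q * H.aLast) := by
    rw [map_mul]
    refine Dvd.dvd.mul_left (PowerSeries.X_pow_dvd_iff.2 fun m hm => ?_) _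
    rw [coeff_restrictX]
    refine coeff_eq_zero_of_mem (H.aLast_mem hp) ?_
    rw [weight_one, add_eq_add i, expo_same, expo_other, zero_add]
    exact_mod_cast hm
  have h1 := congrArg (fun f => PowerSeries.coeff (p ^ e) (restrictX k i f)) C.eq
  simp only [map_add, hsum, hz _ _ (mul_pos hq' hμ) (C.r_mem D hD), add_zero] at h1
  have h2 := hA (p ^ e) (by omega)
  rw [RingHom.comp_apply, RingHom.coe_coe] at h2
  rw [h2, PowerSeries.X_pow_dvd_iff.1 ha _ (Nat.lt_succ_self _), add_zero] at h1
  obtain ⟨β, hβ⟩ := PowerSeries.X_dvd_iff.2 hb0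
  have h3 := PowerSeries.coeff_X_pow_mul (β ^ p ^ e) (p ^ e) 0
  rw [map_pow, hβ, mul_pow] at h1
  rw [zero_add] at h3
  rw [h3, PowerSeries.coeff_zero_eq_constantCoeff_apply, map_pow] at h1
  have h4 := PowerSeries.coeff_succ_X_mul 0 β
  rw [zero_add, ← hβ, PowerSeries.coeff_zero_eq_constantCoeff_apply] at h4
  exact hb (h4.trans (pow_eq_zero_iff hq.ne' |>.1 h1.symm))

/-- The first term which is not a `q`-th power in the lowest row is carried over from the frame to a
clean presentation. -/
theorem rowData [IsAlgClosed k] [ExpChar k p] (hT : closedPoint (Loc k) ∈ T.R.Sing) {D : ℕ}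
    (hD : D ∈ T.bdry) (hc : H.Clean (.gen D)) {r l : ℕ}
    (hF : RowData (p ^ e) (F.A (p ^ e)) (F.slot D) r l)
    (hr : (r : ℚ) < (p : ℚ) ^ e * mu T (.gen D)) :
    RowData (p ^ e) H.aLast (H.slot D) r l ∧
      ∀ l' < l, MvPowerSeries.coeff (expo (H.slot D) r l') H.aLast = 0 := by
  classical
  have hp : 0 < p := expChar_pos k p
  have hv : IsPlace T (.gen D) := fun D' h => by cases h; exact hD
  have hμ : 0 < mu T (.gen D) := by
    have h1 : (0 : ℚ) < (p : ℚ) ^ e := by positivity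
    have h2 : (0 : ℚ) ≤ r := Nat.cast_nonneg _
    by_contra hcon
    nlinarith
  obtain ⟨u, hu0, hu⟩ := C.map_slot D hD
  have hθ := hF.map (C.θ : Base k →+* Base k) hu0 hu (by
    rw [PowerSeries.coeff_zero_eq_constantCoeff_apply, constantCoeff_restrictX]
    exact C.map_X _) (C.coeff_other_ne hT hD hμ)
  -- in the row `r`, the relation reads `Q a_q = b ^ q + θ(A_q)`
  have ha := C.mem_gen hD hc hr.le hF.mem
  have heq : ∀ l', MvPowerSeries.coeff (expo (H.slot D) r l') (C.Q * H.aLast) =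
      MvPowerSeries.coeff (expo (H.slot D) r l') (C.b ^ p ^ e) +
        MvPowerSeries.coeff (expo (H.slot D) r l') (C.θ (F.A (p ^ e))) := fun l' =>
    C.coeff_eq hv hr ha hθ.mem (by rw [H.wt_gen, weight_single, expo_same])
  have hb : ∀ l', ¬ (p ^ e ∣ r ∧ p ^ e ∣ l') →
      MvPowerSeries.coeff (expo (H.slot D) r l') (C.b ^ p ^ e) = 0 := by
    intro l' hl'
    by_contra hne
    apply hl'
    constructor
    · by_contra hd
      exact hne (coeff_pow_eq_zero (i := H.slot D) _ (by simpa using hd))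
    · by_contra hd
      exact hne (coeff_pow_eq_zero (i := 1 - H.slot D) _ (by simpa using hd))
  have hlne : MvPowerSeries.coeff (expo (H.slot D) r l) (C.Q * H.aLast) ≠ 0 := by
    rw [heq, hb l hF.not_dvd, zero_add]; exact hθ.coeff_ne
  have hex : ∃ l', MvPowerSeries.coeff (expo (H.slot D) r l') H.aLast ≠ 0 := by
    by_contra hcon
    push Not at hcon
    exact hlne ((coeff_unit_mul C.Q ha fun l' _ => hcon l').2.trans (by rw [hcon, mul_zero]))
  have hzero : ∀ l' < Nat.find hex, MvPowerSeries.coeff (expo (H.slot D) r l') H.aLast = 0 :=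
    fun l' hl' => by simpa using Nat.find_min hex hl'
  have hmin := coeff_unit_mul C.Q ha hzero
  have hw : ∀ l', Finsupp.weight (H.wt (.gen D)) (expo (H.slot D) r l') = r := fun l' => by
    rw [H.wt_gen, weight_single, expo_same]
  -- by cleanness, already the first term of the row of `a_q` is not a `q`-th power
  have hnd : ¬ (p ^ e ∣ r ∧ p ^ e ∣ Nat.find hex) := by
    have := hc _ (Nat.find_spec hex) (fun n' hn' => by rw [hw]; exact_mod_cast ha n' hn')
      (by rw [hw]; exact hr)
    rw [forall_dvd_iff (H.slot D)] at this
    simpa using this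
  have hl : Nat.find hex = l := by
    rcases lt_trichotomy (Nat.find hex) l with h | h | h
    · exfalso
      have h1 : MvPowerSeries.coeff (expo (H.slot D) r (Nat.find hex)) (C.Q * H.aLast) ≠ 0 := by
        rw [hmin.2]; exact mul_ne_zero C.Q_unit (Nat.find_spec hex)
      rw [heq, hb _ hnd, zero_add] at h1
      exact hnd (hθ.dvd _ h h1)
    · exact h
    · exact absurd (hmin.1 l h) hlne
  rw [hl] at hzero
  exact ⟨⟨ha, hl ▸ Nat.find_spec hex, hF.not_dvd, fun l' hl' hne => absurd (hzero l' hl') hne⟩, hzero⟩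

end Comparison

end Compare

section Invariance

variable {k : Type*} [Field k] [IsAlgClosed k] {p e : ℕ} [ExpChar k p] {T : Triplet k}

theorem exists_invH_eq (hT : InMonomialCase p e T) {v : Place} (hv : IsPlace T v) :
    ∃ H : Presentation p e T, H.WellAdapted v ∧ invH p e T v = H.slope v := by
  obtain ⟨H, hH⟩ := hT.2.some.exists_clean
  exact Classical.epsilon_spec
    (p := fun s => ∃ H : Presentation p e T, H.WellAdapted v ∧ s = H.slope v)
    ⟨_, H, (hH v hv).wellAdapted, rfl⟩

theorem exists_residual_eq (hT : InMonomialCase p e T) {D : ℕ} (hD : D ∈ T.bdry) :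
    ∃ H : Presentation p e T, H.WellAdapted (.gen D) ∧
      residual p e T D = resOrd (p ^ e) (initialForm (H.wt (.gen D)) H.aLast) := by
  obtain ⟨H, hH⟩ := hT.2.some.exists_clean
  exact Classical.epsilon_spec
    (p := fun s => ∃ H : Presentation p e T, H.WellAdapted (.gen D) ∧
      s = resOrd (p ^ e) (initialForm (H.wt (.gen D)) H.aLast))
    ⟨_, H, (hH _ fun D' h => by cases h; exact hD).wellAdapted, rfl⟩

/-- `H(P)` is the slope of every well-adapted presentation. -/
theorem invH_pt (hT : InMonomialCase p e T) {H : Presentation p e T} (hH : H.WellAdapted .pt) :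
    invH p e T .pt = H.slope .pt := by
  have hp : 0 < p := expChar_pos k p
  -- a well-adapted presentation has the largest slope
  have key : ∀ {H H' : Presentation p e T}, H.WellAdapted .pt → H.slope .pt < H'.slope .pt →
      False := by
    intro H H' hw hlt
    obtain ⟨C⟩ := H.nonempty_comparison (H'.toFrame hp)
    have hle : H'.slope .pt ≤ mu T .pt := by
      by_cases h : H'.aLast ∈ ordIdeal k (H'.wt .pt) ((p : ℚ) ^ e * mu T .pt)
      · exact (H'.slope_of_mem hp h).le
      · obtain ⟨N, -, -, -, -, h, -⟩ := H'.lowest hp h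
        exact h.le
    have hq : (0 : ℚ) < (p : ℚ) ^ e := by positivity
    have hA : H'.aLast ∈ ordIdeal k (fun _ => 1) ((p : ℚ) ^ e * H'.slope .pt) := by
      by_cases h : H'.aLast ∈ ordIdeal k (H'.wt .pt) ((p : ℚ) ^ e * mu T .pt)
      · rw [H'.slope_of_mem hp h]; exact h
      · obtain ⟨N, hN, -, -, hs, -, -⟩ := H'.lowest hp h
        rw [hs, mul_div_cancel₀ _ hq.ne']; exact hN
    have ha := C.mem_pt hw (mul_le_mul_of_nonneg_left hle hq.le)
      (by rw [H'.toFrame_last]; exact hA)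
    by_cases h : H.aLast ∈ ordIdeal k (H.wt .pt) ((p : ℚ) ^ e * mu T .pt)
    · rw [H.slope_of_mem hp h] at hlt
      exact absurd hle (not_le.2 hlt)
    · obtain ⟨N, -, ⟨n, hn, hnN⟩, -, hs, -, -⟩ := H.lowest hp h
      have h1 := ha n hn
      rw [H.wt_pt] at hnN
      rw [hnN] at h1
      rw [hs, div_lt_iff₀ hq] at hlt
      linarith
  obtain ⟨H₁, hw₁, hs₁⟩ := exists_invH_eq hT (v := .pt) (fun D' h => by cases h)
  rw [hs₁]
  exact le_antisymm (not_lt.1 (key hH)) (not_lt.1 (key hw₁))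

/-- A component is good if the last coefficient of some frame has order at least `q μ` along it. -/
theorem invH_gen_of_mem (hT : InMonomialCase p e T) (F : Frame p e T) {D : ℕ} (hD : D ∈ T.bdry)
    (hF : F.A (p ^ e) ∈ ordIdeal k (Pi.single (F.slot D) 1) ((p : ℚ) ^ e * mu T (.gen D))) :
    invH p e T (.gen D) = mu T (.gen D) := by
  have hp : 0 < p := expChar_pos k p
  have hv : IsPlace T (.gen D) := fun D' h => by cases h; exact hD
  obtain ⟨H₁, hw₁, hs₁⟩ := exists_invH_eq hT hv
  rw [hs₁]
  by_cases h : H₁.aLast ∈ ordIdeal k (Pi.single (H₁.slot D) 1) ((p : ℚ) ^ e * mu T (.gen D))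
  · exact H₁.slope_of_mem hp h
  · exfalso
    obtain ⟨r, l, hrow, hr, -, -⟩ := hw₁.rowData h
    obtain ⟨H, hH⟩ := hT.2.some.exists_clean
    obtain ⟨C⟩ := H.nonempty_comparison F
    obtain ⟨C₁⟩ := H.nonempty_comparison (H₁.toFrame hp)
    have h1 := C.mem_gen hD (hH _ hv) le_rfl hF
    have h2 := (C₁.rowData hT.1 hD (hH _ hv) (by rw [H₁.toFrame_last]; exact hrow) hr).1
    have h3 := h1 _ h2.coeff_ne
    rw [weight_single, expo_same] at h3
    linarith

/-- The invariants at a bad component are read off from the row data of any frame. -/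
theorem invH_gen_of_rowData (hT : InMonomialCase p e T) (F : Frame p e T) {D : ℕ}
    (hD : D ∈ T.bdry) {r l : ℕ} (hF : RowData (p ^ e) (F.A (p ^ e)) (F.slot D) r l)
    (hr : (r : ℚ) < (p : ℚ) ^ e * mu T (.gen D)) :
    invH p e T (.gen D) = r / (p : ℚ) ^ e ∧ residual p e T D = r + l := by
  have hp : 0 < p := expChar_pos k p
  have hv : IsPlace T (.gen D) := fun D' h => by cases h; exact hD
  obtain ⟨H, hH⟩ := hT.2.some.exists_clean
  -- every well-adapted presentation has the same row data as a clean one, hence as the frame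
  have key : ∀ H₁ : Presentation p e T, H₁.WellAdapted (.gen D) →
      H₁.slope (.gen D) = r / (p : ℚ) ^ e ∧
        resOrd (p ^ e) (initialForm (H₁.wt (.gen D)) H₁.aLast) = r + l := by
    intro H₁ hw₁
    obtain ⟨C⟩ := H.nonempty_comparison F
    obtain ⟨C₁⟩ := H.nonempty_comparison (H₁.toFrame hp)
    have h1 := (C.rowData hT.1 hD (hH _ hv) hF hr).1
    by_cases h : H₁.aLast ∈ ordIdeal k (Pi.single (H₁.slot D) 1) ((p : ℚ) ^ e * mu T (.gen D))
    · exfalso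
      have h2 := C₁.mem_gen hD (hH _ hv) le_rfl (by rw [H₁.toFrame_last]; exact h)
      have h3 := h2 _ h1.coeff_ne
      rw [weight_single, expo_same] at h3
      linarith
    · obtain ⟨r₁, l₁, hrow, hr₁, hs, hres⟩ := hw₁.rowData h
      have h2 := (C₁.rowData hT.1 hD (hH _ hv) (by rw [H₁.toFrame_last]; exact hrow) hr₁).1
      obtain ⟨rfl, rfl⟩ := h1.unique h2
      exact ⟨hs, hres⟩
  obtain ⟨H₁, hw₁, hs₁⟩ := exists_invH_eq hT hv
  obtain ⟨H₂, hw₂, hs₂⟩ := exists_residual_eq hT hD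
  exact ⟨hs₁.trans (key H₁ hw₁).1, hs₂.trans (key H₂ hw₂).2⟩

end Invariance

/-! ### Blow-ups: preparations -/

section Prep

variable {k : Type*} [Field k]

theorem exists_coord_slot {z x y : Loc k} (i : Fin 2)
    (h : maximalIdeal (Loc k) ≤ Ideal.span {z, x, y}) (hz : z ∈ maximalIdeal (Loc k))
    (hx : x ∈ maximalIdeal (Loc k)) (hy : y ∈ maximalIdeal (Loc k)) :
    ∃ X : Coord k, X.z = z ∧ X.xy i = x ∧ X.xy (1 - i) = y := by
  have h1 : maximalIdeal (Loc k) = Ideal.span {z, x, y} := by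
    refine le_antisymm h (Ideal.span_le.2 ?_)
    rintro _ (rfl | rfl | rfl)
    exacts [hz, hx, hy]
  fin_cases i
  · exact exists_coord h1
  · obtain ⟨X, h2, h3, h4⟩ := exists_coord (z := z) (x := y) (y := x) (by
      rw [h1]; congr 1; ext; simp; tauto)
    exact ⟨X, h2, h4, h3⟩

/-- The coordinates `x_i = z = 0` define a curve with parameter `x_(1 - i)`; this is the restriction
of functions to this curve. -/
def restrictCurve (X : Coord k) (i : Fin 2) : Loc k →+* PowerSeries k :=
  (restrictX k i).comp ((restrictZ k).comp (X.symm : Loc k →+* Loc k))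

theorem restrictCurve_z (X : Coord k) (i : Fin 2) : restrictCurve X i X.z = 0 := by
  simp [restrictCurve, Coord.z]

theorem restrictCurve_self (X : Coord k) (i : Fin 2) : restrictCurve X i (X.xy i) = 0 := by
  simp [restrictCurve, Coord.xy, restrictX_X_self]

theorem restrictCurve_other (X : Coord k) (i : Fin 2) :
    restrictCurve X i (X.xy (1 - i)) = PowerSeries.X := by
  simp [restrictCurve, Coord.xy, restrictX_X_other]

theorem span_le_ker_restrictCurve (X : Coord k) (i : Fin 2) :
    Ideal.span {X.z, X.xy i} ≤ RingHom.ker (restrictCurve X i) := by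
  rw [Ideal.span_le]
  rintro _ (rfl | rfl)
  exacts [restrictCurve_z X i, restrictCurve_self X i]

theorem xy_not_mem_span (X : Coord k) (i : Fin 2) :
    X.xy (1 - i) ∉ Ideal.span {X.z, X.xy i} := by
  intro h
  have := span_le_ker_restrictCurve X i h
  rw [RingHom.mem_ker, restrictCurve_other] at this
  exact PowerSeries.X_ne_zero this

theorem span_ne_maximalIdeal (X : Coord k) (i : Fin 2) :
    Ideal.span {X.z, X.xy i} ≠ maximalIdeal (Loc k) := by
  intro h
  exact xy_not_mem_span X i (h ▸ X.xy_mem (1 - i))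

theorem C_X_dvd_iff {i : Fin 2} {f : Loc k} :
    (PowerSeries.C (MvPowerSeries.X i : Base k) : Loc k) ∣ f ↔
      PowerSeries.map (restrictX k i) f = 0 := by
  constructor
  · rintro ⟨g, rfl⟩
    rw [map_mul, PowerSeries.map_C, restrictX_X_self, map_zero, zero_mul]
  · intro h
    have h1 : ∀ m, (MvPowerSeries.X i : Base k) ∣ PowerSeries.coeff m f := by
      intro m
      rw [← restrictX_eq_zero_iff, ← PowerSeries.coeff_map, h, map_zero]
    choose g hg using h1
    refine ⟨PowerSeries.mk g, ?_⟩
    ext1 m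
    rw [PowerSeries.coeff_C_mul, PowerSeries.coeff_mk, hg]

theorem xy_dvd_iff (X : Coord k) {i : Fin 2} {f : Loc k} :
    X.xy i ∣ f ↔ PowerSeries.map (restrictX k i) (X.symm f) = 0 := by
  rw [← C_X_dvd_iff]
  constructor
  · intro h
    have := map_dvd X.symm h
    rwa [Coord.xy, AlgEquiv.symm_apply_apply] at this
  · intro h
    have := map_dvd X h
    rwa [AlgEquiv.apply_symm_apply] at this

theorem xy_prime_dvd (X : Coord k) {i : Fin 2} {j : ℕ} {g : Loc k}
    (h : X.xy (1 - i) ∣ X.xy i ^ j * g) : X.xy (1 - i) ∣ g := by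
  rw [xy_dvd_iff, map_mul, map_mul, map_pow, map_pow] at h
  have h1 : PowerSeries.map (restrictX k (1 - i)) (X.symm (X.xy i)) ≠ 0 := by
    rw [Coord.xy, AlgEquiv.symm_apply_apply, PowerSeries.map_C]
    have := restrictX_X_other (k := k) (1 - i)
    rw [one_sub_one_sub] at this
    rw [this]
    intro h0
    have := congrArg PowerSeries.constantCoeff h0
    rw [PowerSeries.constantCoeff_C, map_zero] at this
    exact PowerSeries.X_ne_zero this
  rw [xy_dvd_iff]
  exact (mul_eq_zero.1 h).resolve_left (pow_ne_zero _ h1)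

theorem Coord.xy_ne_zero (X : Coord k) (i : Fin 2) : X.xy i ≠ 0 := by
  have := xy_not_mem_span X (1 - i)
  rw [one_sub_one_sub] at this
  exact fun h => this (h ▸ Ideal.zero_mem _)

theorem strictTransform_eq_top {φ : Loc k →ₐ[k] Loc k} {u x g : Loc k} (hx : φ x = u * g)
    (hg : IsUnit g) : strictTransform φ u (Ideal.span {x}) = ⊤ := by
  rw [Ideal.eq_top_iff_one]
  refine ⟨1, ?_⟩
  obtain ⟨g', hg'⟩ := hg.exists_right_inv
  have h1 : u ^ 1 * 1 = g' * φ x := by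
    rw [hx, mul_comm g', mul_assoc, hg', pow_one]
  rw [h1]
  exact Ideal.mul_mem_left _ _ (Ideal.mem_map_of_mem _ (Ideal.mem_span_singleton_self x))

theorem strictTransform_eq_span {φ : Loc k →ₐ[k] Loc k} {u x w y : Loc k} {m : ℕ}
    (hx : φ x = w * y) (hw : w ∣ u ^ m) (hy : ∀ j g, y ∣ u ^ j * g → y ∣ g) :
    strictTransform φ u (Ideal.span {x}) = Ideal.span {y} := by
  have hmap : (Ideal.span {x}).map φ = Ideal.span {w * y} := by
    rw [Ideal.map_span, Set.image_singleton, hx]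
  ext g
  rw [Ideal.mem_span_singleton]
  constructor
  · rintro ⟨j, hj⟩
    rw [hmap, Ideal.mem_span_singleton] at hj
    exact hy j g (dvd_trans (dvd_mul_left y w) hj)
  · intro hg
    refine ⟨m, ?_⟩
    rw [hmap, Ideal.mem_span_singleton]
    exact mul_dvd_mul hw hg

theorem exists_base_algHom (v : Fin 2 → Base k) (hv : ∀ i, MvPowerSeries.constantCoeff (v i) = 0) :
    ∃ σ : Base k →ₐ[k] Base k, ∀ i, σ (MvPowerSeries.X i) = v i := by
  have hs : MvPowerSeries.HasSubst v := MvPowerSeries.hasSubst_of_constantCoeff_zero hv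
  exact ⟨MvPowerSeries.substAlgHom hs, fun i => by simp [MvPowerSeries.subst_X hs]⟩

/-- A homomorphism `φ` of complete local rings restricts to a substitution `σ` between the subrings
`k[[x, y]]` given by coordinates, if it does so for the variables. -/
theorem map_C_eq {φ : Loc k →ₐ[k] Loc k} {X X' : Coord k} {σ : Base k →ₐ[k] Base k}
    (h : ∀ j, φ (X.xy j) = X' (PowerSeries.C (σ (MvPowerSeries.X j)))) (f : Base k) :
    φ (X (PowerSeries.C f)) = X' (PowerSeries.C (σ f)) := by
  let ι : Base k →ₐ[k] Loc k := IsScalarTower.toAlgHom k (Base k) (Loc k)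
  have hι : ∀ f, ι f = PowerSeries.C f := fun f => rfl
  have := algHom_ext_of_X (k := k) (I := maximalIdeal (Loc k)) eq_zero_of_forall_mem_pow
    (α := (φ.comp (X : Loc k →ₐ[k] Loc k)).comp ι)
    (β := ((X' : Loc k →ₐ[k] Loc k).comp ι).comp σ)
    (fun j => algHom_map_mem (α := φ.comp (X : Loc k →ₐ[k] Loc k)) (C_X_mem_maximalIdeal j))
    (fun j => h j)
  exact DFunLike.congr_fun this f

theorem exists_const (f : Loc k) :
    ∃ c : k, f - algebraMap k (Loc k) c ∈ maximalIdeal (Loc k) :=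
  ⟨MvPowerSeries.constantCoeff (restrictZ k f), by
    rw [mem_maximalIdeal_loc_iff, map_sub, map_sub, constantCoeff_algebraMap, sub_self]⟩

/-- If an ideal `J` in the maximal ideal contains the image of the maximal ideal under `φ`, then an
element of the maximal ideal which is congruent modulo `J` to an element of the image of `φ`
lies in `J`. -/
theorem mem_of_sub_mem {φ : Loc k →ₐ[k] Loc k} {J : Ideal (Loc k)}
    (hJ : J ≤ maximalIdeal (Loc k)) (hφ : ∀ f ∈ maximalIdeal (Loc k), φ f ∈ J) {f g : Loc k}
    (hg : g ∈ maximalIdeal (Loc k)) (h : g - φ f ∈ J) : g ∈ J := by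
  obtain ⟨c, hc⟩ := exists_const f
  have h1 := hφ _ hc
  rw [map_sub, AlgHom.commutes] at h1
  have h2 : g - algebraMap k _ c ∈ J := by
    have := Ideal.add_mem _ h h1
    rwa [sub_add_sub_cancel] at this
  have h3 : algebraMap k (Loc k) c ∈ maximalIdeal (Loc k) := by
    have := Ideal.sub_mem _ hg (hJ h2)
    rwa [sub_sub_cancel] at this
  rw [mem_maximalIdeal_loc_iff, constantCoeff_algebraMap] at h3
  rwa [h3, map_zero, sub_zero] at h2

variable {p e : ℕ} {T T' : Triplet k}

/-- The transform of the Weierstrass form of `h`. -/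
theorem Presentation.map_h_eq (H : Presentation p e T) (hp : 0 < p) {φ : Loc k →ₐ[k] Loc k}
    {w g : Loc k} {B : ℕ → Loc k} (hz : φ H.X.z = w * g)
    (hB : ∀ j ∈ Finset.Icc 1 (p ^ e),
      φ (H.X (PowerSeries.C (H.W.coeff (p ^ e - j)))) = w ^ j * B j) :
    φ (H.X (H.W : Loc k)) = w ^ p ^ e * (g ^ p ^ e +
      ∑ j ∈ Finset.Ioo 0 (p ^ e), B j * g ^ (p ^ e - j) + B (p ^ e)) := by
  have hq : 0 < p ^ e := Nat.pow_pos hp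
  have hz' : φ (H.X PowerSeries.X) = w * g := hz
  rw [H.coe_W_eq hp, weierstrassForm]
  simp only [map_add, map_sum, map_mul, map_pow, hz', mul_add, Finset.mul_sum]
  rw [hB (p ^ e) (Finset.mem_Icc.2 ⟨hq, le_rfl⟩), mul_pow]
  congr 2
  refine Finset.sum_congr rfl fun j hj => ?_
  have hj' := Finset.mem_Ioo.1 hj
  rw [hB j (Finset.mem_Icc.2 ⟨hj'.1, hj'.2.le⟩), mul_pow]
  have : w ^ p ^ e = w ^ j * w ^ (p ^ e - j) := by
    rw [← pow_add, Nat.add_sub_cancel' hj'.2.le]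
  rw [this]; ring

theorem IsTransform.mem_of_map_eq {φ : Loc k →ₐ[k] Loc k} {u : Loc k}
    (hR : ∀ n, T'.R.ideal n =
      ⨆ m ≥ n, Ideal.span {g | ∃ f ∈ T.R.ideal m, φ f = u ^ m * g}) {n : ℕ} {f g : Loc k}
    (hf : f ∈ T.R.ideal n) (h : φ f = u ^ n * g) : g ∈ T'.R.ideal n := by
  rw [hR]
  exact (le_iSup₂ (f := fun m (_ : m ≥ n) =>
    Ideal.span {g | ∃ f ∈ T.R.ideal m, φ f = u ^ m * g}) n le_rfl) (Ideal.subset_span ⟨f, hf, h⟩)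

/-- The transform of `z` is not a unit, because the transform of `h` lies in the maximal ideal. -/
theorem Presentation.transform_z_mem (H : Presentation p e T) (hp : 0 < p)
    (hT' : closedPoint (Loc k) ∈ T'.R.Sing) {φ : Loc k →ₐ[k] Loc k} {u g : Loc k}
    (hR : ∀ n, T'.R.ideal n =
      ⨆ m ≥ n, Ideal.span {g | ∃ f ∈ T.R.ideal m, φ f = u ^ m * g})
    {B : ℕ → Loc k} (hz : φ H.X.z = u * g)
    (hB : ∀ j ∈ Finset.Icc 1 (p ^ e),
      φ (H.X (PowerSeries.C (H.W.coeff (p ^ e - j)))) = u ^ j * B j)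
    (hBm : ∀ j ∈ Finset.Icc 1 (p ^ e), B j ∈ maximalIdeal (Loc k)) :
    g ∈ maximalIdeal (Loc k) := by
  have hq : 0 < p ^ e := Nat.pow_pos hp
  have h1 := IsTransform.mem_of_map_eq hR H.h_mem (H.map_h_eq hp hz hB)
  have h2 := Ideal.pow_le_self hq.ne' (ideal_le_pow hT' _ h1)
  rw [add_assoc] at h2
  have h3 : ∑ j ∈ Finset.Ioo 0 (p ^ e), B j * g ^ (p ^ e - j) + B (p ^ e) ∈
      maximalIdeal (Loc k) := by
    refine Ideal.add_mem _ (Ideal.sum_mem _ fun j hj => Ideal.mul_mem_right _ _ (hBm j ?_))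
      (hBm _ (Finset.mem_Icc.2 ⟨hq, le_rfl⟩))
    have hj' := Finset.mem_Ioo.1 hj
    exact Finset.mem_Icc.2 ⟨hj'.1, hj'.2.le⟩
  exact Ideal.IsPrime.mem_of_pow_mem inferInstance _ ((Ideal.add_mem_iff_left _ h3).1 h2)

theorem weierstrassForm_apply (X : Coord k) (q : ℕ) (A : ℕ → Base k) :
    X (weierstrassForm q A) = X.z ^ q +
      ∑ j ∈ Finset.Ioo 0 q, X (PowerSeries.C (A j)) * X.z ^ (q - j) + X (PowerSeries.C (A q)) := by
  rw [weierstrassForm]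
  simp only [map_add, map_sum, map_mul, map_pow]
  rfl

end Prep

/-! ### Blow-ups of points -/

section PointBlowup

variable {k : Type*} [Field k] {p e : ℕ} {T T' : Triplet k}

theorem Coord.span_eq_slot (X : Coord k) (i : Fin 2) :
    Ideal.span {X.z, X.xy i, X.xy (1 - i)} = maximalIdeal (Loc k) := by
  rw [← X.span_eq]
  fin_cases i
  · rfl
  · congr 1; ext; simp; tauto

theorem IsBlowup.map_mem_span {φ : Loc k →ₐ[k] Loc k} {c : Ideal (Loc k)} {u : Loc k}
    (h : IsBlowup φ c u) {f : Loc k} (hf : f ∈ c) : ∃ g, φ f = u * g := by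
  obtain ⟨X, X', hu, hx, hz, hc⟩ := h
  have key : c ≤ (Ideal.span {u}).comap φ := by
    rcases hc with ⟨rfl, hy⟩ | ⟨rfl, -⟩
    · rw [← X.span_eq, Ideal.span_le]
      rintro _ (rfl | rfl | rfl) <;>
      simp only [SetLike.mem_coe, Ideal.mem_comap, Ideal.mem_span_singleton]
      · rw [hz, hu]; exact dvd_mul_right _ _
      · rw [hx, hu]
      · rw [hy, hu]; exact dvd_mul_right _ _
    · rw [Ideal.span_le]
      rintro _ (rfl | rfl) <;>
      simp only [SetLike.mem_coe, Ideal.mem_comap, Ideal.mem_span_singleton]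
      · rw [hz, hu]; exact dvd_mul_right _ _
      · rw [hx, hu]
  have h1 := key hf
  rw [Ideal.mem_comap, Ideal.mem_span_singleton] at h1
  exact h1

/-- Regular systems of parameters adapted to the blow-up of a point. Here `u * G j` is the total
transform of the parameter `x_j`, and `x_i` is one of the parameters for which `G i` is a unit. -/
theorem exists_point_coord {φ : Loc k →ₐ[k] Loc k} {u : Loc k}
    (h : IsBlowup φ (maximalIdeal (Loc k)) u) (Y : Coord k) {g : Loc k} {G : Fin 2 → Loc k}
    (hz : φ Y.z = u * g) (hG : ∀ j, φ (Y.xy j) = u * G j) (hg : g ∈ maximalIdeal (Loc k)) :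
    u ∈ maximalIdeal (Loc k) ∧ (∃ i, IsUnit (G i)) ∧ ∀ i, IsUnit (G i) →
      ∃ Y' : Coord k, Y'.xy 0 = u * G i ∧ φ Y.z = Y'.xy 0 * Y'.z ∧ φ (Y.xy i) = Y'.xy 0 ∧
        φ (Y.xy (1 - i)) = Y'.xy 0 * (Y'.xy 1 + algebraMap k (Loc k)
          (MvPowerSeries.constantCoeff (restrictZ k (G (1 - i))) /
            MvPowerSeries.constantCoeff (restrictZ k (G i)))) := by
  obtain ⟨X, X', hu, hx, hzX, hc⟩ := h
  obtain ⟨-, hy⟩ := hc.resolve_right fun h =>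
    span_ne_maximalIdeal X 0 h.1.symm
  have hu0 : u ≠ 0 := hu ▸ X'.xy_ne_zero 0
  have hum : u ∈ maximalIdeal (Loc k) := hu ▸ X'.xy_mem 0
  -- the quotient by `u` of the transform of an element of the maximal ideal
  have hexp : ∀ (i : Fin 2) {f₀ g₀ : Loc k}, f₀ ∈ maximalIdeal (Loc k) → φ f₀ = u * g₀ →
      ∃ α β γ : Loc k, g₀ = φ α * g + φ β * G i + φ γ * G (1 - i) := by
    intro i f₀ g₀ hf₀ h₀
    rw [← Y.span_eq_slot i, Submodule.mem_span_triple] at hf₀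
    obtain ⟨α, β, γ, hf⟩ := hf₀
    refine ⟨α, β, γ, mul_left_cancel₀ hu0 ?_⟩
    rw [← h₀, ← hf]
    simp only [smul_eq_mul, map_add, map_mul, hz, hG]
    ring
  refine ⟨hum, ?_, fun i hi => ?_⟩
  -- if no `G i` were a unit, then the quotient `1` of `φ x` by `u` would lie in the maximal ideal
  · by_contra hcon
    push Not at hcon
    obtain ⟨α, β, γ, h1⟩ := hexp 0 (X.xy_mem 0) (show φ (X.xy 0) = u * 1 by rw [hx, mul_one, hu])
    have h2 : (1 : Loc k) ∈ maximalIdeal (Loc k) := by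
      rw [h1]
      exact Ideal.add_mem _ (Ideal.add_mem _ (Ideal.mul_mem_left _ _ hg)
        (Ideal.mul_mem_left _ _ (hcon 0))) (Ideal.mul_mem_left _ _ (hcon (1 - 0)))
    exact h2 isUnit_one
  · obtain ⟨v, hv⟩ := hi.exists_right_inv
    set c : k := MvPowerSeries.constantCoeff (restrictZ k (G (1 - i))) /
      MvPowerSeries.constantCoeff (restrictZ k (G i)) with hcdef
    have hGv : MvPowerSeries.constantCoeff (restrictZ k (G i)) *
        MvPowerSeries.constantCoeff (restrictZ k v) = 1 := by
      rw [← map_mul, ← map_mul, hv, map_one, map_one]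
    have hi0 := isUnit_loc_iff.1 hi
    set z'' := g * v with hz''
    set x'' := u * G i with hx''
    set y'' := G (1 - i) * v - algebraMap k (Loc k) c with hy''
    have hzm : z'' ∈ maximalIdeal (Loc k) := Ideal.mul_mem_right _ _ hg
    have hxm : x'' ∈ maximalIdeal (Loc k) := Ideal.mul_mem_right _ _ hum
    have hym : y'' ∈ maximalIdeal (Loc k) := by
      rw [mem_maximalIdeal_loc_iff, hy'', map_sub, map_sub, constantCoeff_algebraMap, map_mul,
        map_mul, hcdef, eq_div_of_mul_eq hi0 ((mul_comm _ _).trans hGv)]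
      ring
    have e1 : φ Y.z = x'' * z'' := by
      rw [hz]
      linear_combination (-u * g) * hv
    have e2 : φ (Y.xy i) = x'' := hG i
    have e3 : φ (Y.xy (1 - i)) = x'' * (y'' + algebraMap k (Loc k) c) := by
      rw [hG, hy'', sub_add_cancel]
      linear_combination (-u * G (1 - i)) * hv
    set J : Ideal (Loc k) := Ideal.span {z'', x'', y''} with hJ
    have hzJ : z'' ∈ J := Ideal.subset_span (by simp)
    have hxJ : x'' ∈ J := Ideal.subset_span (by simp)
    have hyJ : y'' ∈ J := Ideal.subset_span (by simp)
    have hJm : J ≤ maximalIdeal (Loc k) := by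
      rw [hJ, Ideal.span_le]
      rintro _ (rfl | rfl | rfl)
      exacts [hzm, hxm, hym]
    have hφJ : ∀ f ∈ maximalIdeal (Loc k), φ f ∈ J := by
      have : maximalIdeal (Loc k) ≤ J.comap φ := by
        rw [← Y.span_eq_slot i, Ideal.span_le]
        rintro _ (rfl | rfl | rfl)
        · exact Ideal.mem_comap.2 (e1 ▸ Ideal.mul_mem_right _ _ hxJ)
        · exact Ideal.mem_comap.2 (e2 ▸ hxJ)
        · exact Ideal.mem_comap.2 (e3 ▸ Ideal.mul_mem_right _ _ hxJ)
      exact this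
    -- `J` contains the given parameters of the new point, so it is the maximal ideal
    have key : ∀ {f₀ g₀ : Loc k}, f₀ ∈ maximalIdeal (Loc k) → φ f₀ = u * g₀ →
        g₀ ∈ maximalIdeal (Loc k) → g₀ ∈ J := by
      intro f₀ g₀ hf₀ h₀ hg₀
      obtain ⟨α, β, γ, h1⟩ := hexp i hf₀ h₀
      have h2 : v * g₀ - φ (β + γ * algebraMap k (Loc k) c) = φ α * z'' + φ γ * y'' := by
        rw [h1, map_add, map_mul, AlgHom.commutes]
        linear_combination (φ β) * hv
      have h3 : v * g₀ ∈ J := mem_of_sub_mem hJm hφJ (Ideal.mul_mem_left _ _ hg₀) (by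
        rw [h2]
        exact Ideal.add_mem _ (Ideal.mul_mem_left _ _ hzJ) (Ideal.mul_mem_left _ _ hyJ))
      have h4 : g₀ = G i * (v * g₀) := by linear_combination (-g₀) * hv
      rw [h4]
      exact Ideal.mul_mem_left _ _ h3
    obtain ⟨Y', h1, h2, h3⟩ := exists_coord_slot 0 (z := z'') (x := x'') (y := y'') (by
      rw [← X'.span_eq, Ideal.span_le]
      rintro _ (rfl | rfl | rfl)
      · exact key X.z_mem (by rw [hzX, hu]) X'.z_mem
      · rw [← hu]
        have : u = v * x'' := by linear_combination (-u) * hv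
        rw [this]
        exact Ideal.mul_mem_left _ _ hxJ
      · exact key (X.xy_mem 1) (by rw [hy, hu]) (X'.xy_mem 1)) hzm hxm hym
    refine ⟨Y', h2, ?_, ?_, ?_⟩
    · rw [h1, h2]; exact e1
    · rw [h2]; exact e2
    · rw [h2]
      have h3' : Y'.xy 1 = y'' := h3
      rw [h3']; exact e3

/-- The effect of the blow-up of the point on a presentation. The direction `dir` describes the position
of the new point on the exceptional divisor; `N` is the index of the latter. -/
theorem Presentation.exists_point_frame [ExpChar k p] (H : Presentation p e T)
    (hT' : closedPoint (Loc k) ∈ T'.R.Sing) (htr : IsTransform T T' (maximalIdeal (Loc k))) :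
    ∃ (N : ℕ) (dir : Fin 2 → k), (∀ D ∈ T.bdry, D < N) ∧ N ∈ T'.bdry ∧
      mu T' (.gen N) = mu T .pt - 1 ∧
      (∀ D ∈ T'.bdry, D ≠ N → D ∈ T.bdry ∧ mu T' (.gen D) = mu T (.gen D)) ∧
      (∀ D ∈ T.bdry, D ∈ T'.bdry ↔ dir (H.slot D) = 0) ∧ (∃ i, dir i ≠ 0) ∧
      ∀ i, dir i ≠ 0 → ∃ F : Frame p e T', F.slot N = 0 ∧
        (∀ D ∈ T'.bdry, D ≠ N → F.slot D = 1) ∧ ∃ σ : Base k →ₐ[k] Base k,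
          σ (MvPowerSeries.X i) = MvPowerSeries.X 0 ∧
          σ (MvPowerSeries.X (1 - i)) = MvPowerSeries.X 0 *
            (MvPowerSeries.X 1 + algebraMap k (Base k) (dir (1 - i) / dir i)) ∧
          MvPowerSeries.X 0 ^ p ^ e * F.A (p ^ e) = σ H.aLast := by
  classical
  have hp : 0 < p := expChar_pos k p
  have hq : 0 < p ^ e := Nat.pow_pos hp
  obtain ⟨φ, u, N, hbl, hR, hlt, hbd, hdivN, hdiv, hlev, hmult, hmultN⟩ := htr
  obtain ⟨g, hg⟩ := hbl.map_mem_span H.X.z_mem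
  have hG : ∀ j, ∃ G, φ (H.X.xy j) = u * G := fun j => hbl.map_mem_span (H.X.xy_mem j)
  choose G hG using hG
  have hum : u ∈ maximalIdeal (Loc k) := by
    obtain ⟨X, X', hu, -⟩ := hbl
    exact hu ▸ X'.xy_mem 0
  -- `a_j` has order greater than `j`, hence `φ a_j` is divisible by `u ^ j`, even by `u ^ (j + 1)`
  have hB : ∀ j ∈ Finset.Icc 1 (p ^ e), ∃ B ∈ maximalIdeal (Loc k),
      φ (H.X (PowerSeries.C (H.W.coeff (p ^ e - j)))) = u ^ j * B := by
    intro j hj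
    have h1 := map_mem_pow_of_mem_ordIdeal (((φ : Loc k →+* Loc k).comp
      (H.X : Loc k →+* Loc k)).comp PowerSeries.C) (I := Ideal.span {u}) (fun i => by
        rw [Ideal.mem_span_singleton]; exact ⟨G i, hG i⟩) (m := j + 1)
      (by exact_mod_cast H.coeff_mem_succ hj)
    rw [Ideal.span_singleton_pow, Ideal.mem_span_singleton] at h1
    obtain ⟨b, hb⟩ := h1
    exact ⟨u * b, Ideal.mul_mem_right _ _ hum, by rw [← mul_assoc, ← pow_succ]; exact hb⟩
  choose! B hBm hB using hB
  have hgm := H.transform_z_mem hp hT' hR hg hB hBm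
  obtain ⟨-, hex, hcoord⟩ := exists_point_coord hbl H.X hg hG hgm
  have hlev0 : (0 : ℚ) < T.level := by exact_mod_cast H.level_pos
  have hN : N ∉ T.bdry := fun h => lt_irrefl _ (hlt N h)
  have hN' : N ∈ T'.bdry := by rw [hbd]; exact Finset.mem_insert_self _ _
  have hold : ∀ D ∈ T'.bdry, D ≠ N → D ∈ T.bdry := by
    intro D hD hne
    rw [hbd] at hD
    exact (Finset.mem_filter.1 (Finset.mem_of_mem_insert_of_ne hD hne)).1
  have hμN : mu T' (.gen N) = mu T .pt - 1 := by
    have h1 : T.bdry.filter (fun D => T.div D ≤ maximalIdeal (Loc k)) = T.bdry := by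
      refine Finset.filter_true_of_mem fun D hD => ?_
      rw [H.div_eq D hD, Ideal.span_singleton_le_iff_mem]
      exact H.X.xy_mem _
    have h2 : ((T'.mult N : ℕ) : ℚ) + T.level = ∑ D ∈ T.bdry, (T.mult D : ℚ) := by
      rw [h1] at hmultN
      exact_mod_cast hmultN
    rw [mu, mu, hlev, ← h2]
    field_simp
    ring
  have hμ : ∀ D ∈ T'.bdry, D ≠ N → mu T' (.gen D) = mu T (.gen D) := by
    intro D hD hne
    rw [mu, mu, hlev, hmult D (hold D hD hne) hD]
  have hunit : ∀ i, MvPowerSeries.constantCoeff (restrictZ k (G i)) ≠ 0 ↔ IsUnit (G i) :=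
    fun i => isUnit_loc_iff.symm
  -- the strict transform of `x_D = 0` in the chart in which it is visible
  have hstrict : ∀ i, IsUnit (G i) → ∀ D ∈ T.bdry, ¬ IsUnit (G (H.slot D)) →
      ∀ Y' : Coord k, Y'.xy 0 = u * G i → φ (H.X.xy (1 - i)) = Y'.xy 0 * (Y'.xy 1 +
        algebraMap k (Loc k) (MvPowerSeries.constantCoeff (restrictZ k (G (1 - i))) /
            MvPowerSeries.constantCoeff (restrictZ k (G i)))) →
      strictTransform φ u (T.div D) = Ideal.span {Y'.xy 1} := by
    intro i hi D hD hnu Y' hY' hφ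
    have hs : H.slot D = 1 - i := (eq_or_eq_one_sub i _).resolve_left fun h => hnu (h ▸ hi)
    have h0 : MvPowerSeries.constantCoeff (restrictZ k (G (1 - i))) = 0 := by
      by_contra hcon
      exact hnu (hs ▸ (hunit _).1 hcon)
    rw [H.div_eq D hD, hs]
    rw [h0, zero_div, map_zero, add_zero] at hφ
    obtain ⟨v, hv⟩ := hi.exists_right_inv
    refine strictTransform_eq_span (m := 1) hφ ⟨v, ?_⟩ fun j f hjf => ?_
    · rw [hY', mul_assoc, hv, mul_one, pow_one]
    · have h1 : Y'.xy 1 ∣ Y'.xy 0 ^ j * f := by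
        rw [hY', mul_pow, mul_comm (u ^ j), mul_assoc]
        exact Dvd.dvd.mul_left hjf _
      exact xy_prime_dvd Y' (i := 0) h1
  have hdir : ∀ D ∈ T.bdry, D ∈ T'.bdry ↔
      MvPowerSeries.constantCoeff (restrictZ k (G (H.slot D))) = 0 := by
    intro D hD
    have hne : D ≠ N := fun h => hN (h ▸ hD)
    rw [hbd, Finset.mem_insert, or_iff_right hne, Finset.mem_filter, and_iff_right hD]
    constructor
    · intro h1
      by_contra h2
      refine h1 ?_
      rw [H.div_eq D hD]
      exact strictTransform_eq_top (hG _) ((hunit _).1 h2)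
    · intro h1
      have hnu : ¬ IsUnit (G (H.slot D)) := fun h => (hunit _).2 h h1
      obtain ⟨i, hi⟩ := hex
      obtain ⟨Y', hY', -, -, hφ⟩ := hcoord i hi
      rw [hstrict i hi D hD hnu Y' hY' hφ]
      intro htop
      rw [Ideal.span_singleton_eq_top] at htop
      exact (Y'.xy_mem 1) htop
  refine ⟨N, fun j => MvPowerSeries.constantCoeff (restrictZ k (G j)), hlt, hN', hμN,
    fun D hD hne => ⟨hold D hD hne, hμ D hD hne⟩, hdir, ?_, ?_⟩
  · obtain ⟨i, hi⟩ := hex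
    exact ⟨i, (hunit i).2 hi⟩
  · intro i hi0
    have hi := (hunit i).1 hi0
    obtain ⟨Y', hY', e1, e2, e3⟩ := hcoord i hi
    set c := MvPowerSeries.constantCoeff (restrictZ k (G (1 - i))) /
            MvPowerSeries.constantCoeff (restrictZ k (G i)) with hc
    -- the blow-up in the chart `i`, restricted to `k[[x, y]]`
    obtain ⟨σ, hσ⟩ := exists_base_algHom (k := k) (fun j => if j = i then MvPowerSeries.X 0 else
      MvPowerSeries.X 0 * (MvPowerSeries.X 1 + algebraMap k (Base k) c)) (fun j => by
        split_ifs <;> simp)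
    have hσi : σ (MvPowerSeries.X i) = MvPowerSeries.X 0 := by rw [hσ, if_pos rfl]
    have hσo : σ (MvPowerSeries.X (1 - i)) =
        MvPowerSeries.X 0 * (MvPowerSeries.X 1 + algebraMap k (Base k) c) := by
      rw [hσ, if_neg (one_sub_ne i)]
    have hmap := map_C_eq (φ := φ) (X := H.X) (X' := Y') (σ := σ) (fun j => by
      rcases eq_or_eq_one_sub i j with rfl | rfl
      · rw [hσi]; exact e2
      · have hc' : Y' (PowerSeries.C (algebraMap k (Base k) c)) = algebraMap k (Loc k) c := by
          rw [← PowerSeries.algebraMap_apply, AlgEquiv.commutes]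
        rw [hσo, e3, map_mul, map_add, map_mul, map_add, hc']
        rfl)
    have hσ0 : ∀ j, (MvPowerSeries.X 0 : Base k) ∣ σ (MvPowerSeries.X j) := by
      intro j
      rcases eq_or_eq_one_sub i j with rfl | rfl
      · rw [hσi]
      · rw [hσo]; exact dvd_mul_right _ _
    have hσmem : ∀ {s : ℚ} {f : Base k}, f ∈ ordIdeal k (fun _ => 1) s →
        σ f ∈ ordIdeal k (Pi.single 0 1) s := by
      intro s f hf
      have := map_mem_ordIdeal_one (θ := (σ : Base k →+* Base k)) (w := Pi.single 0 1) (c := 1)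
        (fun j => by rw [Nat.cast_one]; exact X_dvd_iff_mem.1 (hσ0 j)) hf
      rwa [Nat.cast_one, mul_one] at this
    -- the coefficients of the transform of `h`
    have hA : ∀ j ∈ Finset.Icc 1 (p ^ e), ∃ A, σ (H.W.coeff (p ^ e - j)) = MvPowerSeries.X 0 ^ j * A := by
      intro j hj
      exact exists_eq_X_pow_mul (hσmem (ordIdeal_anti (by linarith) (H.coeff_mem_succ hj)))
    choose! A hA using hA
    have hIoo : ∀ {j}, j ∈ Finset.Ioo 0 (p ^ e) → j ∈ Finset.Icc 1 (p ^ e) := fun hj =>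
      Finset.mem_Icc.2 ⟨(Finset.mem_Ioo.1 hj).1, (Finset.mem_Ioo.1 hj).2.le⟩
    refine ⟨⟨Y', A, fun D => if D = N then 0 else 1, ?_, ?_, ?_⟩, if_pos rfl,
      fun D _ hne => if_neg hne, σ, hσi, hσo, ?_⟩
    · intro D hD
      by_cases hne : D = N
      · rw [if_pos hne, hne, hdivN, Ideal.span_singleton_eq_span_singleton, hY']
        exact associated_mul_unit_right u _ hi
      · rw [if_neg hne]
        have hD' := hold D hD hne
        rw [hdiv D hD' hD]
        refine hstrict i hi D hD' (fun h => (hunit _).2 h ((hdir D hD').1 hD)) Y' hY' e3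
    · rw [weierstrassForm_apply]
      have h1 := H.map_h_eq hp (φ := φ) (w := Y'.xy 0) (g := Y'.z)
        (B := fun j => Y' (PowerSeries.C (A j))) e1 (fun j hj => by
          rw [hmap, hA j hj, map_mul, map_pow, map_mul, map_pow]; rfl)
      rw [hY', mul_pow, mul_assoc] at h1
      have h2 := IsTransform.mem_of_map_eq hR H.h_mem h1
      exact (Ideal.unit_mul_mem_iff_mem _ (hi.pow _)).1 h2
    · intro D hD j hj
      by_cases hne : D = N
      · rw [if_pos hne, hne, hμN]
        refine mem_of_X_pow_mul_mem (i := 0) (m := j) ?_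
        rw [← hA j (hIoo hj)]
        refine ordIdeal_anti (le_of_eq ?_) (hσmem (H.coeff_mem (v := .pt) (fun D h => by cases h) hj))
        simp; ring
      · rw [if_neg hne, hμ D hD hne]
        have hD' := hold D hD hne
        have hs : H.slot D = 1 - i := (eq_or_eq_one_sub i _).resolve_left fun h => by
          have := (hdir D hD').1 hD
          rw [h] at this
          exact hi0 this
        have hc0 : c = 0 := by
          have := (hdir D hD').1 hD
          rw [hs] at this
          rw [hc, this, zero_div]
        refine mem_of_X_pow_mul_mem (i := 0) (m := j) ?_
        rw [← hA j (hIoo hj)]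
        have h1 := H.coeff_mem_gen hD' hj
        rw [hs] at h1
        have h2 := map_mem_ordIdeal_single (θ := (σ : Base k →+* Base k)) (i := 1) (j := 1 - i)
          (by
            rw [RingHom.coe_coe, hσo, hc0, map_zero, add_zero]
            exact dvd_mul_left _ _) h1
        refine ordIdeal_anti (le_of_eq ?_) h2
        simp
    · have h1 := hA (p ^ e) (Finset.mem_Icc.2 ⟨hq, le_rfl⟩)
      rw [Nat.sub_self] at h1
      exact h1.symm

end PointBlowup

/-! ### Blow-ups of curves -/

section CurveBlowup

variable {k : Type*} [Field k] {p e : ℕ} {T T' : Triplet k}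

theorem ker_restrictCurve (X : Coord k) (i : Fin 2) :
    RingHom.ker (restrictCurve X i) = Ideal.span {X.z, X.xy i} := by
  refine le_antisymm (fun f hf => ?_) (span_le_ker_restrictCurve X i)
  rw [RingHom.mem_ker, restrictCurve, RingHom.comp_apply, RingHom.comp_apply,
    restrictX_eq_zero_iff] at hf
  obtain ⟨c, hc⟩ := hf
  obtain ⟨g, hg, -⟩ := exists_loc_eq (X.symm f)
  have h1 : f = X.xy i * X (PowerSeries.C c) + X.z * X g := by
    rw [← X.apply_symm_apply f, hg]
    have hc' : restrictZ k (X.symm f) = MvPowerSeries.X i * c := hc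
    rw [hc', map_add, map_mul, map_mul, map_mul]
    rfl
  rw [h1]
  exact Ideal.add_mem _ (Ideal.mul_mem_right _ _ (Ideal.subset_span (by simp)))
    (Ideal.mul_mem_right _ _ (Ideal.subset_span (by simp)))

theorem base_X_prime (i : Fin 2) : Prime (MvPowerSeries.X i : Base k) := by
  refine ⟨?_, ?_, fun a b h => ?_⟩
  · intro h
    have h1 := restrictX_X_other (k := k) (1 - i)
    rw [one_sub_one_sub, h, map_zero] at h1
    exact PowerSeries.X_ne_zero h1.symm
  · intro h
    have := h.map (MvPowerSeries.constantCoeff (σ := Fin 2) (R := k))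
    simp at this
  · rw [← restrictX_eq_zero_iff, map_mul, mul_eq_zero] at h
    exact h.imp restrictX_eq_zero_iff.1 restrictX_eq_zero_iff.1

/-- If the curve `z = x_i = 0` lies in the singular locus, then the elements of level `n` restricted to
`z = 0` are divisible by `x_i ^ n`. -/
theorem restrictZ_mem_of_sing {X : Coord k} {i : Fin 2} {𝔮 : PrimeSpectrum (Loc k)}
    (h : 𝔮 ∈ T.R.Sing) (h𝔮 : 𝔮.asIdeal = Ideal.span {X.z, X.xy i}) {n : ℕ} {f : Loc k}
    (hf : f ∈ T.R.ideal n) : restrictZ k (X.symm f) ∈ ordIdeal k (Pi.single i 1) n := by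
  have h1 := h n (Ideal.mem_map_of_mem _ hf)
  rw [← Localization.AtPrime.map_eq_maximalIdeal, ← Ideal.map_pow] at h1
  obtain ⟨⟨⟨a, ha⟩, s⟩, hs⟩ :=
    (IsLocalization.mem_map_algebraMap_iff 𝔮.asIdeal.primeCompl _).1 h1
  simp only at hs
  rw [← map_mul] at hs
  have hinj : Function.Injective (algebraMap (Loc k) (Localization.AtPrime 𝔮.asIdeal)) :=
    IsLocalization.injective _ 𝔮.asIdeal.primeCompl_le_nonZeroDivisors
  have h2 : f * s = a := hinj hs
  let ψ : Loc k →+* Base k := (restrictZ k).comp (X.symm : Loc k →+* Loc k)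
  have hψ : 𝔮.asIdeal.map ψ ≤ Ideal.span {MvPowerSeries.X i} := by
    rw [h𝔮, Ideal.map_span, Ideal.span_le]
    rintro _ ⟨g, rfl | rfl, rfl⟩
    · simp [ψ, Coord.z]
    · simp [ψ, Coord.xy]
  have h3 : ψ a ∈ Ideal.span {(MvPowerSeries.X i : Base k)} ^ n := by
    have := Ideal.mem_map_of_mem ψ ha
    rw [Ideal.map_pow] at this
    exact Ideal.pow_right_mono hψ n this
  rw [Ideal.span_singleton_pow, Ideal.mem_span_singleton, ← h2, map_mul] at h3
  rw [← X_pow_dvd_iff_mem]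
  refine (base_X_prime i).pow_dvd_of_dvd_mul_right n (fun hd => s.2 ?_) h3
  have h4 : (s : Loc k) ∈ RingHom.ker (restrictCurve X i) := restrictX_eq_zero_iff.2 hd
  rwa [ker_restrictCurve, ← h𝔮] at h4

/-- Regular systems of parameters adapted to the blow-up of the curve `z = x_i = 0`. -/
theorem exists_curve_coord {φ : Loc k →ₐ[k] Loc k} {u : Loc k} {Y : Coord k} {i : Fin 2}
    (h : IsBlowup φ (Ideal.span {Y.z, Y.xy i}) u) {g G : Loc k}
    (hz : φ Y.z = u * g) (hG : φ (Y.xy i) = u * G) :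
    u ∈ maximalIdeal (Loc k) ∧ (g ∈ maximalIdeal (Loc k) → IsUnit G ∧
      ∃ Y' : Coord k, Y'.xy i = u * G ∧ φ Y.z = Y'.xy i * Y'.z ∧ φ (Y.xy i) = Y'.xy i ∧
        φ (Y.xy (1 - i)) = Y'.xy (1 - i)) := by
  obtain ⟨X, X', hu, hx, hzX, hc⟩ := h
  obtain ⟨hc, hy⟩ := hc.resolve_left fun h => span_ne_maximalIdeal Y i h.1
  have hu0 : u ≠ 0 := hu ▸ X'.xy_ne_zero 0
  have hum : u ∈ maximalIdeal (Loc k) := hu ▸ X'.xy_mem 0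
  -- the quotient by `u` of the transform of an element of the ideal of the curve
  have hexp : ∀ {f₀ g₀ : Loc k}, f₀ ∈ Ideal.span {Y.z, Y.xy i} → φ f₀ = u * g₀ →
      ∃ α β : Loc k, g₀ = φ α * g + φ β * G := by
    intro f₀ g₀ hf₀ h₀
    rw [Ideal.mem_span_pair] at hf₀
    obtain ⟨α, β, hf⟩ := hf₀
    refine ⟨α, β, mul_left_cancel₀ hu0 ?_⟩
    rw [← h₀, ← hf]
    simp only [map_add, map_mul, hz, hG]
    ring
  refine ⟨hum, fun hg => ?_⟩
  have hGu : IsUnit G := by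
    by_contra hcon
    obtain ⟨α, β, h1⟩ := hexp (f₀ := X.xy 0) (g₀ := 1)
      (by rw [hc]; exact Ideal.subset_span (by simp)) (by rw [hx, mul_one, hu])
    have h2 : (1 : Loc k) ∈ maximalIdeal (Loc k) := by
      rw [h1]
      exact Ideal.add_mem _ (Ideal.mul_mem_left _ _ hg) (Ideal.mul_mem_left _ _ hcon)
    exact h2 isUnit_one
  refine ⟨hGu, ?_⟩
  obtain ⟨v, hv⟩ := hGu.exists_right_inv
  set z'' := g * v with hz''
  set x'' := u * G with hx''
  set y'' := φ (Y.xy (1 - i)) with hy''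
  have hzm : z'' ∈ maximalIdeal (Loc k) := Ideal.mul_mem_right _ _ hg
  have hxm : x'' ∈ maximalIdeal (Loc k) := Ideal.mul_mem_right _ _ hum
  have hym : y'' ∈ maximalIdeal (Loc k) := algHom_map_mem (Y.xy_mem _)
  have e1 : φ Y.z = x'' * z'' := by
    rw [hz]
    linear_combination (-u * g) * hv
  -- `J` contains the given parameters of the new point, so it is the maximal ideal
  set J : Ideal (Loc k) := Ideal.span {z'', x'', y''} with hJ
  have hzJ : z'' ∈ J := Ideal.subset_span (by simp)
  have hxJ : x'' ∈ J := Ideal.subset_span (by simp)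
  have hyJ : y'' ∈ J := Ideal.subset_span (by simp)
  have hJm : J ≤ maximalIdeal (Loc k) := by
    rw [hJ, Ideal.span_le]
    rintro _ (rfl | rfl | rfl)
    exacts [hzm, hxm, hym]
  have hφJ : ∀ f ∈ maximalIdeal (Loc k), φ f ∈ J := by
    have : maximalIdeal (Loc k) ≤ J.comap φ := by
      rw [← Y.span_eq_slot i, Ideal.span_le]
      rintro _ (rfl | rfl | rfl)
      · exact Ideal.mem_comap.2 (e1 ▸ Ideal.mul_mem_right _ _ hxJ)
      · exact Ideal.mem_comap.2 (hG ▸ hxJ)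
      · exact Ideal.mem_comap.2 hyJ
    exact this
  have huJ : u ∈ J := by
    have : u = v * x'' := by linear_combination (-u) * hv
    rw [this]
    exact Ideal.mul_mem_left _ _ hxJ
  obtain ⟨Y', h1, h2, h3⟩ := exists_coord_slot i (z := z'') (x := x'') (y := y'') (by
    rw [← X'.span_eq, Ideal.span_le]
    rintro _ (rfl | rfl | rfl)
    · obtain ⟨α, β, h1⟩ := hexp (f₀ := X.z) (g₀ := X'.z)
        (by rw [hc]; exact Ideal.subset_span (by simp)) (by rw [hzX, hu])
      have h3 : v * X'.z ∈ J := mem_of_sub_mem hJm hφJ (f := β)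
        (Ideal.mul_mem_left _ _ X'.z_mem) (by
          have h2 : v * X'.z - φ β = φ α * z'' := by
            rw [h1]; linear_combination (φ β) * hv
          rw [h2]
          exact Ideal.mul_mem_left _ _ hzJ)
      have h4 : X'.z = G * (v * X'.z) := by linear_combination (-X'.z) * hv
      rw [h4]
      exact Ideal.mul_mem_left _ _ h3
    · rw [← hu]; exact huJ
    · rw [← hy]; exact hφJ _ (X.xy_mem 1)) hzm hxm hym
  exact ⟨Y', h2, by rw [h1, h2]; exact e1, by rw [h2]; exact hG, by rw [h3]⟩

/-- The effect on a presentation of the blow-up of a curve `z = x_D = 0` in the singular locus. The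
exceptional divisor takes the place of `D`. -/
theorem Presentation.exists_curve_frame [ExpChar k p] (H : Presentation p e T)
    (hT' : closedPoint (Loc k) ∈ T'.R.Sing) {D : ℕ} (hD : D ∈ T.bdry)
    (hsing : ∃ 𝔮 ∈ T.R.Sing, 𝔮.asIdeal = Ideal.span {H.X.z, H.X.xy (H.slot D)})
    (htr : IsTransform T T' (Ideal.span {H.X.z, H.X.xy (H.slot D)})) :
    ∃ N, (∀ E ∈ T.bdry, E < N) ∧ T'.bdry = insert N (T.bdry.erase D) ∧
      mu T' (.gen N) = mu T (.gen D) - 1 ∧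
      (∀ E ∈ T.bdry, E ≠ D → mu T' (.gen E) = mu T (.gen E)) ∧
      ∃ F : Frame p e T', F.slot N = H.slot D ∧ (∀ E ∈ T.bdry, F.slot E = H.slot E) ∧
        MvPowerSeries.X (H.slot D) ^ p ^ e * F.A (p ^ e) = H.aLast := by
  classical
  have hp : 0 < p := expChar_pos k p
  have hq : 0 < p ^ e := Nat.pow_pos hp
  obtain ⟨𝔮, h𝔮, h𝔮eq⟩ := hsing
  obtain ⟨φ, u, N, hbl, hR, hlt, hbd, hdivN, hdiv, hlev, hmult, hmultN⟩ := htr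
  set i := H.slot D with hi
  obtain ⟨g, hg⟩ := hbl.map_mem_span (f := H.X.z) (Ideal.subset_span (by simp))
  obtain ⟨G, hG⟩ := hbl.map_mem_span (f := H.X.xy i) (Ideal.subset_span (by simp))
  obtain ⟨hum, hcoord⟩ := exists_curve_coord hbl hg hG
  have hlev0 : (0 : ℚ) < T.level := by exact_mod_cast H.level_pos
  -- `M` has level `a`, so that its order along the curve is at least `a`
  have hμ1 : 1 ≤ mu T (.gen D) := by
    have h1 := restrictZ_mem_of_sing h𝔮 h𝔮eq H.monomial_mem
    have h2 : restrictZ k (H.X.symm (∏ E ∈ T.bdry, H.X.xy (H.slot E) ^ T.mult E)) =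
        MvPowerSeries.X i ^ T.mult D *
          ∏ E ∈ T.bdry.erase D, MvPowerSeries.X (H.slot E) ^ T.mult E := by
      rw [map_prod, map_prod, ← Finset.mul_prod_erase _ _ hD]
      simp [Coord.xy, hi]
    rw [h2, ← X_pow_dvd_iff_mem] at h1
    have h3 : ¬ (MvPowerSeries.X i : Base k) ∣
        ∏ E ∈ T.bdry.erase D, MvPowerSeries.X (H.slot E) ^ T.mult E := by
      intro hd
      obtain ⟨E, hE, hdE⟩ := (base_X_prime i).exists_mem_finset_dvd hd
      have hE' := Finset.mem_erase.1 hE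
      have h4 := (base_X_prime i).dvd_of_dvd_pow hdE
      have h5 : H.slot E = 1 - i := (eq_or_eq_one_sub i _).resolve_left fun h =>
        hE'.1 (H.slot_injOn hE'.2 hD h)
      rw [h5, ← restrictX_eq_zero_iff, restrictX_X_other] at h4
      exact PowerSeries.X_ne_zero h4
    have h4 := (base_X_prime i).pow_dvd_of_dvd_mul_right _ h3 h1
    have h5 := (pow_dvd_pow_iff (base_X_prime (k := k) i).ne_zero (base_X_prime i).not_isUnit).1 h4
    rw [mu, one_le_div hlev0]
    exact_mod_cast h5
  -- `x_D ^ j` divides `a_j`: for `j < q` as `μ(ξ_D) ≥ 1`, for `j = q` as the curve lies in `Sing`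
  have hA : ∀ j ∈ Finset.Icc 1 (p ^ e), ∃ A, H.W.coeff (p ^ e - j) = MvPowerSeries.X i ^ j * A := by
    intro j hj
    apply exists_eq_X_pow_mul
    rcases (Finset.mem_Icc.1 hj).2.lt_or_eq with h | rfl
    · refine ordIdeal_anti ?_ (H.coeff_mem_gen hD (Finset.mem_Ioo.2 ⟨(Finset.mem_Icc.1 hj).1, h⟩))
      exact le_mul_of_one_le_right (Nat.cast_nonneg _) hμ1
    · have h1 := restrictZ_mem_of_sing h𝔮 h𝔮eq H.h_mem
      rwa [AlgEquiv.symm_apply_apply, ← PowerSeries.coeff_zero_eq_constantCoeff_apply,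
        Polynomial.coeff_coe, ← Nat.sub_self (p ^ e)] at h1
  choose! A hA using hA
  have hAm : ∀ j ∈ Finset.Icc 1 (p ^ e), MvPowerSeries.constantCoeff (A j) = 0 := by
    intro j hj
    rw [constantCoeff_eq_zero_iff_mem]
    refine mem_of_X_pow_mul_mem (i := i) (m := j) ?_
    rw [← hA j hj]
    refine ordIdeal_anti (le_of_eq ?_) (H.coeff_mem_succ hj)
    push_cast; ring
  have hB : ∀ j ∈ Finset.Icc 1 (p ^ e), φ (H.X (PowerSeries.C (H.W.coeff (p ^ e - j)))) =
      u ^ j * (G ^ j * φ (H.X (PowerSeries.C (A j)))) := by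
    intro j hj
    have hG' : φ (H.X (PowerSeries.C (MvPowerSeries.X i : Base k))) = u * G := hG
    rw [hA j hj]
    simp only [map_mul, map_pow, hG', mul_pow, mul_assoc]
  -- the new point lies on the strict transform of `z = 0`, so `x_D` is an exceptional equation
  have hgm := H.transform_z_mem hp hT' hR hg hB (fun j hj => by
    refine Ideal.mul_mem_left _ _ (algHom_map_mem ((coord_mem_iff H.X).2 ?_))
    rw [mem_maximalIdeal_loc_iff, PowerSeries.constantCoeff_C, hAm j hj])
  obtain ⟨hGu, Y', hY', e1, e2, e3⟩ := hcoord hgm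
  have hN : N ∉ T.bdry := fun h => lt_irrefl _ (hlt N h)
  have hslot : ∀ E ∈ T.bdry, E ≠ D → H.slot E = 1 - i := fun E hE hne =>
    (eq_or_eq_one_sub i _).resolve_left fun h => hne (H.slot_injOn hE hD h)
  have hstrict : ∀ E ∈ T.bdry, E ≠ D →
      strictTransform φ u (T.div E) = Ideal.span {Y'.xy (1 - i)} := by
    intro E hE hne
    rw [H.div_eq E hE, hslot E hE hne]
    refine strictTransform_eq_span (w := 1) (m := 0) (by rw [e3, one_mul]) (by simp)
      fun j f hjf => ?_
    have h1 : Y'.xy (1 - i) ∣ Y'.xy i ^ j * f := by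
      rw [hY', mul_pow, mul_comm (u ^ j), mul_assoc]
      exact Dvd.dvd.mul_left hjf _
    exact xy_prime_dvd Y' h1
  have hbd' : T'.bdry = insert N (T.bdry.erase D) := by
    rw [hbd]
    congr 1
    ext E
    rw [Finset.mem_filter, Finset.mem_erase, and_comm]
    refine and_congr_left fun hE => ⟨?_, fun hne => ?_⟩
    · rintro h1 rfl
      refine h1 ?_
      rw [H.div_eq E hE]
      exact strictTransform_eq_top hG hGu
    · rw [hstrict E hE hne, Ne, Ideal.span_singleton_eq_top]
      exact Y'.xy_mem _
  have hμN : mu T' (.gen N) = mu T (.gen D) - 1 := by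
    have h1 : T.bdry.filter (fun E => T.div E ≤ Ideal.span {H.X.z, H.X.xy i}) = {D} := by
      ext E
      rw [Finset.mem_filter, Finset.mem_singleton]
      constructor
      · rintro ⟨hE, hle⟩
        by_contra hne
        rw [H.div_eq E hE, Ideal.span_singleton_le_iff_mem, hslot E hE hne] at hle
        exact xy_not_mem_span _ _ hle
      · rintro rfl
        refine ⟨hD, ?_⟩
        rw [H.div_eq E hD, Ideal.span_singleton_le_iff_mem]
        exact Ideal.subset_span (by simp [hi])
    rw [h1, Finset.sum_singleton] at hmultN
    have h2 : ((T'.mult N : ℕ) : ℚ) + T.level = T.mult D := by exact_mod_cast hmultN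
    rw [mu, mu, hlev, ← h2]
    field_simp
    ring
  have hμ : ∀ E ∈ T.bdry, E ≠ D → mu T' (.gen E) = mu T (.gen E) := by
    intro E hE hne
    rw [mu, mu, hlev, hmult E hE]
    rw [hbd']
    exact Finset.mem_insert_of_mem (Finset.mem_erase.2 ⟨hne, hE⟩)
  have hIoo : ∀ {j}, j ∈ Finset.Ioo 0 (p ^ e) → j ∈ Finset.Icc 1 (p ^ e) := fun hj =>
    Finset.mem_Icc.2 ⟨(Finset.mem_Ioo.1 hj).1, (Finset.mem_Ioo.1 hj).2.le⟩
  have hmap := map_C_eq (φ := φ) (X := H.X) (X' := Y') (σ := AlgHom.id k (Base k)) (fun j => by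
    rcases eq_or_eq_one_sub i j with rfl | rfl
    · exact e2
    · exact e3)
  refine ⟨N, hlt, hbd', hμN, hμ, ⟨Y', A, fun E => if E = N then i else H.slot E, ?_, ?_, ?_⟩,
    if_pos rfl, fun E hE => if_neg (ne_of_mem_of_not_mem hE hN), ?_⟩
  · intro E hE
    by_cases hne : E = N
    · rw [if_pos hne, hne, hdivN, Ideal.span_singleton_eq_span_singleton, hY']
      exact associated_mul_unit_right u _ hGu
    · rw [if_neg hne]
      have hE' := hE
      rw [hbd'] at hE'
      have h1 := Finset.mem_erase.1 (Finset.mem_of_mem_insert_of_ne hE' hne)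
      rw [hdiv E h1.2 hE, hstrict E h1.2 h1.1, hslot E h1.2 h1.1]
  · rw [weierstrassForm_apply]
    have h1 := H.map_h_eq hp (φ := φ) (w := Y'.xy i) (g := Y'.z)
      (B := fun j => Y' (PowerSeries.C (A j))) e1 (fun j hj => by
        rw [hmap, AlgHom.id_apply, hA j hj, map_mul, map_pow, map_mul, map_pow]; rfl)
    rw [hY', mul_pow, mul_assoc] at h1
    have h2 := IsTransform.mem_of_map_eq hR H.h_mem h1
    exact (Ideal.unit_mul_mem_iff_mem _ (hGu.pow _)).1 h2
  · intro E hE j hj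
    by_cases hne : E = N
    · rw [if_pos hne, hne, hμN]
      refine mem_of_X_pow_mul_mem (i := i) (m := j) ?_
      rw [← hA j (hIoo hj)]
      refine ordIdeal_anti (le_of_eq ?_) (H.coeff_mem_gen hD hj)
      rw [Pi.single_eq_same]; push_cast; ring
    · rw [if_neg hne]
      have hE' := hE
      rw [hbd'] at hE'
      have h1 := Finset.mem_erase.1 (Finset.mem_of_mem_insert_of_ne hE' hne)
      rw [hμ E h1.2 h1.1]
      refine mem_of_X_pow_mul_mem (i := i) (m := j) ?_
      rw [← hA j (hIoo hj)]
      refine ordIdeal_anti (le_of_eq ?_) (H.coeff_mem_gen h1.2 hj)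
      rw [hslot E h1.2 h1.1, Pi.single_eq_of_ne (one_sub_ne i).symm]; simp
  · have h1 := hA (p ^ e) (Finset.mem_Icc.2 ⟨hq, le_rfl⟩)
    rw [Nat.sub_self] at h1
    exact h1.symm

end CurveBlowup

/-! ### Translates of binary forms -/

section Taylor

variable {k : Type*} [Field k]

open Polynomial in
/-- The multiplicity of a non-zero root is at most the difference of the largest and the smallest
exponent. -/
theorem exists_taylor_coeff_ne {g : k[X]} (hg : g ≠ 0) {c : k} (hc : c ≠ 0) {m M : ℕ}
    (hm : ∀ t, g.coeff t ≠ 0 → m ≤ t) (hM : ∀ t, g.coeff t ≠ 0 → t ≤ M) :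
    ∃ j, j + m ≤ M ∧ (taylor c g).coeff j ≠ 0 := by
  by_contra hcon
  push Not at hcon
  have hmM : m ≤ M := (hm _ (leadingCoeff_ne_zero.2 hg)).trans (hM _ (leadingCoeff_ne_zero.2 hg))
  have h1 : X ^ (M - m + 1) ∣ taylor c g := by
    rw [X_pow_dvd_iff]
    intro j hj
    exact hcon j (by omega)
  have h2 : (X - C c) ^ (M - m + 1) ∣ g := by
    have := map_dvd (taylorAlgHom (-c)) h1
    simpa [taylor_taylor, ← sub_eq_add_neg] using this
  have h3 : X ^ m ∣ g := by
    rw [X_pow_dvd_iff]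
    intro j hj
    by_contra hne
    exact absurd (hm j hne) (not_le.2 hj)
  have hcop : IsCoprime (X - C c) (X : k[X]) := by
    have := isCoprime_X_sub_C_of_isUnit_sub (a := c) (b := 0) (by simpa using hc.isUnit)
    simpa using this
  have h4 := (hcop.pow (m := M - m + 1) (n := m)).mul_dvd h2 h3
  have h5 := natDegree_le_of_dvd h4 hg
  rw [natDegree_mul (pow_ne_zero _ (X_sub_C_ne_zero c)) (pow_ne_zero _ X_ne_zero), natDegree_pow,
    natDegree_X_sub_C, natDegree_X_pow] at h5
  have h6 := hM _ (leadingCoeff_ne_zero.2 hg)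
  omega

open Polynomial in
theorem taylor_expand {p : ℕ} [ExpChar k p] (t : ℕ) (c : k) (g : k[X]) :
    taylor c (expand k (p ^ t) g) = expand k (p ^ t) (taylor (c ^ p ^ t) g) := by
  rw [taylor_apply, taylor_apply, expand_eq_comp_X_pow, expand_eq_comp_X_pow, comp_assoc,
    comp_assoc]
  congr 1
  simp [add_pow_expChar_pow]

open Polynomial in
/-- A polynomial with an exponent prime to `p` has a translate with the same property, and the exponent
is bounded by the range of such exponents. -/
theorem exists_taylor_coeff_ne_of_prime {p : ℕ} [CharP k p] {g : k[X]} {c : k}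
    (hc : c ≠ 0) {s m : ℕ} (hs : g.coeff s ≠ 0) (hps : ¬ p ∣ s)
    (hmin : ∀ t, g.coeff t ≠ 0 → ¬ p ∣ t → s ≤ t) (hmax : ∀ t, g.coeff t ≠ 0 → ¬ p ∣ t → t ≤ m) :
    ∃ j, j + s ≤ m + 1 ∧ ¬ p ∣ j ∧ (taylor c g).coeff j ≠ 0 := by
  have hs0 : 0 < s := Nat.pos_of_ne_zero fun h => hps (h ▸ dvd_zero p)
  have hcoeff : ∀ (f : k[X]) t, (derivative f).coeff t ≠ 0 ↔
      f.coeff (t + 1) ≠ 0 ∧ ¬ p ∣ t + 1 := by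
    intro f t
    rw [coeff_derivative, mul_ne_zero_iff, ← Nat.cast_succ, Ne, Ne, CharP.cast_eq_zero_iff k p]
  have hne : derivative g ≠ 0 := by
    intro h0
    have := (hcoeff g (s - 1)).2 (by rw [Nat.sub_add_cancel hs0]; exact ⟨hs, hps⟩)
    rw [h0] at this
    simp at this
  obtain ⟨j, hj, hjne⟩ := exists_taylor_coeff_ne hne hc (m := s - 1) (M := m - 1)
    (fun t ht => by
      have h1 := (hcoeff g t).1 ht
      have := hmin _ h1.1 h1.2
      omega)
    (fun t ht => by
      have h1 := (hcoeff g t).1 ht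
      have := hmax _ h1.1 h1.2
      omega)
  have hd : taylor c (derivative g) = derivative (taylor c g) := by
    have := hasseDeriv_taylor 1 c g
    rw [hasseDeriv_one] at this
    exact this.symm
  rw [hd] at hjne
  have h1 := (hcoeff _ j).1 hjne
  have h2 := hmax s hs hps
  exact ⟨j + 1, by omega, h1.2, h1.1⟩

open Polynomial in
/-- The estimate which limits the jump of the invariant. The polynomial `g` is a dehomogenized form of
degree `d`; it has a translate with an exponent `l` which does not belong to a `q`-th power and which is
less than twice `d - R - S`, if all exponents are between `S` and `d - R`. -/
theorem exists_taylor_coeff_lt {p e d : ℕ} [ExpChar k p] {g : k[X]} (hg : g ≠ 0) {c : k}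
    (hc : c ≠ 0) {R S : ℚ} (hR : R ≤ (p : ℚ) ^ e) (hS : S ≤ (p : ℚ) ^ e) (hRS : 0 < d - R - S)
    (hd : p ^ e < d) (hg1 : ∀ t, g.coeff t ≠ 0 → S ≤ t)
    (hg2 : ∀ t, g.coeff t ≠ 0 → (t : ℚ) ≤ d - R)
    (hg3 : ∀ t, g.coeff t ≠ 0 → ¬ (p ^ e ∣ d ∧ p ^ e ∣ t)) :
    ∃ l, (taylor c g).coeff l ≠ 0 ∧ ¬ (p ^ e ∣ d ∧ p ^ e ∣ l) ∧ (l : ℚ) < 2 * (d - R - S) := by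
  classical
  -- if `q` does not divide `d`, every exponent counts, and the bound holds without the factor two
  by_cases hqd : p ^ e ∣ d
  swap
  · obtain ⟨j, hj, hne⟩ := exists_taylor_coeff_ne hg hc (m := g.natTrailingDegree)
      (M := g.natDegree) (fun t ht => natTrailingDegree_le_of_ne_zero ht)
      (fun t ht => le_natDegree_of_ne_zero ht)
    refine ⟨j, hne, fun h => hqd h.1, ?_⟩
    have h1 := hg1 _ (trailingCoeff_nonzero_iff_nonzero.2 hg)
    have h2 := hg2 _ (leadingCoeff_ne_zero.2 hg)
    have h3 : (j : ℚ) + g.natTrailingDegree ≤ g.natDegree := by exact_mod_cast hj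
    linarith
  have hnq : ∀ t, g.coeff t ≠ 0 → ¬ p ^ e ∣ t := fun t ht h => hg3 t ht ⟨hqd, h⟩
  have hpr : p.Prime := by
    rcases expChar_is_prime_or_one k p with h | h
    · exact h
    · exact absurd (by simp [h]) (hnq _ (leadingCoeff_ne_zero.2 hg))
  have : CharP k p := by
    cases ‹ExpChar k p› with
    | zero => exact absurd hpr Nat.not_prime_one
    | prime _ => assumption
  -- `g` is a polynomial in `X ^ P`, where `P = p ^ t₀` is maximal with this property
  have hex : ∃ t, ¬ ∀ n, g.coeff n ≠ 0 → p ^ t ∣ n :=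
    ⟨e, fun h => hnq _ (leadingCoeff_ne_zero.2 hg) (h _ (leadingCoeff_ne_zero.2 hg))⟩
  obtain ⟨t₀, ht₀⟩ : ∃ t₀, Nat.find hex = t₀ + 1 :=
    Nat.exists_eq_succ_of_ne_zero fun h0 => by
      have := Nat.find_spec hex
      rw [h0] at this
      simp at this
  have hdvd : ∀ n, g.coeff n ≠ 0 → p ^ t₀ ∣ n := by
    have := Nat.find_min hex (m := t₀) (by omega)
    rwa [not_not] at this
  have hndvd : ∃ n, g.coeff n ≠ 0 ∧ ¬ p ^ (t₀ + 1) ∣ n := by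
    have := Nat.find_spec hex
    rw [ht₀] at this
    push Not at this
    exact this
  have hte : t₀ + 1 ≤ e := by
    rw [← ht₀]
    exact Nat.find_min' hex fun h =>
      hnq _ (leadingCoeff_ne_zero.2 hg) (h _ (leadingCoeff_ne_zero.2 hg))
  obtain ⟨κ', hκ'⟩ : ∃ κ', p ^ e = p ^ t₀ * (p * κ') :=
    ⟨p ^ (e - t₀ - 1), by rw [← pow_succ', ← pow_add]; congr 1; omega⟩
  set P := p ^ t₀ with hP
  have hP0 : 0 < P := Nat.pow_pos hpr.pos
  obtain ⟨g₂, rfl⟩ : ∃ g₂, g = expand k P g₂ := by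
    refine ⟨contract P g, ?_⟩
    ext n
    rw [coeff_expand hP0, coeff_contract hP0.ne']
    split_ifs with h
    · rw [Nat.div_mul_cancel h]
    · by_contra hne
      exact h (hdvd n hne)
  have hg₂ : ∀ t, (expand k P g₂).coeff (P * t) = g₂.coeff t := fun t => by
    rw [mul_comm, coeff_expand_mul hP0]
  have hex₁ : ∃ s, g₂.coeff s ≠ 0 ∧ ¬ p ∣ s := by
    obtain ⟨n, hn, hnd⟩ := hndvd
    obtain ⟨s, rfl⟩ := hdvd n hn
    rw [hg₂] at hn
    exact ⟨s, hn, fun ⟨a, ha⟩ => hnd ⟨a, by rw [ha, pow_succ, mul_assoc]⟩⟩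
  let E := g₂.support.filter fun s => ¬ p ∣ s
  have hE : ∀ s, s ∈ E ↔ g₂.coeff s ≠ 0 ∧ ¬ p ∣ s := fun s => by
    rw [Finset.mem_filter, mem_support_iff]
  have hEne : E.Nonempty := hex₁.imp fun s hs => (hE s).2 hs
  obtain ⟨s, hsE, hsmin⟩ := E.exists_minimal hEne
  obtain ⟨m, hmE, hmmax⟩ := E.exists_maximal hEne
  have hmin : ∀ t, g₂.coeff t ≠ 0 → ¬ p ∣ t → s ≤ t := fun t h1 h2 => by
    rcases le_total s t with h | h
    · exact h
    · exact hsmin ((hE t).2 ⟨h1, h2⟩) h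
  have hmax : ∀ t, g₂.coeff t ≠ 0 → ¬ p ∣ t → t ≤ m := fun t h1 h2 => by
    rcases le_total t m with h | h
    · exact h
    · exact hmmax ((hE t).2 ⟨h1, h2⟩) h
  have hs := (hE s).1 hsE
  have hm := (hE m).1 hmE
  obtain ⟨j, hj, hpj, hjne⟩ := exists_taylor_coeff_ne_of_prime (p := p) (pow_ne_zero P hc) hs.1 hs.2
    hmin hmax
  refine ⟨P * j, ?_, ?_, ?_⟩
  · rw [taylor_expand, mul_comm, coeff_expand_mul hP0]
    exact hjne
  · rintro ⟨-, h⟩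
    rw [hκ'] at h
    exact hpj ((dvd_mul_right p κ').trans (Nat.dvd_of_mul_dvd_mul_left hP0 h))
  · -- after division by `P`, no exponent prime to `p` is equal to `κ = q / P`
    obtain ⟨δ, hδ⟩ := hqd
    set κ := p * κ' with hκ
    have hκ0 : 0 < κ := Nat.pos_of_ne_zero fun h0 => by
      rw [h0, mul_zero] at hκ'
      exact (Nat.pow_pos hpr.pos).ne' hκ'
    have hδ2 : 2 ≤ δ := by
      by_contra hcon
      have h2 : δ = 0 ∨ δ = 1 := by omega
      rcases h2 with rfl | rfl <;> omega
    have hsκ : s ≠ κ := fun h => hs.2 (h ▸ dvd_mul_right p κ')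
    have hmκ : m ≠ κ := fun h => hm.2 (h ▸ dvd_mul_right p κ')
    have hsm : s ≤ m := hmax s hs.1 hs.2
    have hPQ : (0 : ℚ) < P := by exact_mod_cast hP0
    have hqQ : (p : ℚ) ^ e = P * κ := by exact_mod_cast hκ'
    have hdQ : (d : ℚ) = P * (κ * δ) := by rw [hδ, hκ']; push_cast; ring
    have hSs : S ≤ P * s := by
      have := hg1 (P * s) (by rw [hg₂]; exact hs.1)
      exact_mod_cast this
    have hmR : (P : ℚ) * m ≤ d - R := by
      have := hg2 (P * m) (by rw [hg₂]; exact hm.1)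
      exact_mod_cast this
    have hX : (P : ℚ) * κ ≤ d - R := by
      have h1 : (κ : ℚ) * 2 ≤ κ * δ := by
        exact_mod_cast Nat.mul_le_mul_left κ hδ2
      have h2 : (P : ℚ) * (κ * 2) ≤ P * (κ * δ) := mul_le_mul_of_nonneg_left h1 hPQ.le
      rw [hdQ]; linarith
    have hSκ : S ≤ P * κ := by linarith
    have hjQ : (P : ℚ) * j + P * s ≤ P * m + P := by
      have : (j : ℚ) + s ≤ m + 1 := by exact_mod_cast hj
      nlinarith
    have hbig : ∀ {a b : ℕ}, a < b → (P : ℚ) * a + P ≤ P * b := by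
      intro a b hab
      have : (a : ℚ) + 1 ≤ b := by exact_mod_cast hab
      nlinarith
    have hsmQ : (P : ℚ) * s ≤ P * m := mul_le_mul_of_nonneg_left (by exact_mod_cast hsm) hPQ.le
    push_cast
    rcases lt_or_gt_of_ne hmκ with h1 | h1
    · have := hbig h1
      linarith
    · have h1' := hbig h1
      rcases lt_or_gt_of_ne hsκ with h2 | h2
      · have := hbig h2
        linarith
      · have := hbig h2
        linarith

end Taylor

/-! ### The invariants in terms of a clean presentation -/

section Numeric

variable {k : Type*} [Field k] {p e : ℕ} {T : Triplet k}

theorem isPlace_gen {D : ℕ} (hD : D ∈ T.bdry) : IsPlace T (.gen D) := fun D' h => by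
  cases h; exact hD

theorem isPlace_pt : IsPlace T .pt := fun D h => by cases h

theorem mem_badDivisors {D : ℕ} :
    D ∈ badDivisors p e T ↔ D ∈ T.bdry ∧ IsBad p e T (.gen D) := by
  classical
  exact Finset.mem_filter

theorem mu_pt : mu T .pt = ∑ D ∈ T.bdry, mu T (.gen D) := by
  simp only [mu, Finset.sum_div]

namespace Presentation

theorem sum_slot_le (H : Presentation p e T) (n : Fin 2 →₀ ℕ) :
    ∑ D ∈ T.bdry, n (H.slot D) ≤ n 0 + n 1 := by
  rw [← Fin.sum_univ_two (fun i => n i), ← Finset.sum_image (f := fun i => n i) H.slot_injOn]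
  exact Finset.sum_le_univ_sum_of_nonneg fun i => Nat.zero_le _

theorem card_le (H : Presentation p e T) : T.bdry.card ≤ 2 := by
  rw [← Finset.card_image_of_injOn H.slot_injOn]
  exact (Finset.card_le_univ _).trans (by simp)

end Presentation

variable [IsAlgClosed k] [ExpChar k p]

namespace Presentation

variable {H : Presentation p e T}

/-- For a good component, `a_q` is divisible by the power of `x_D` prescribed by `μ`. -/
theorem mem_of_not_isBad (hT : InMonomialCase p e T) (hH : ∀ v, IsPlace T v → H.Clean v) {D : ℕ}
    (hD : D ∈ T.bdry) (hb : ¬ IsBad p e T (.gen D)) :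
    H.aLast ∈ ordIdeal k (Pi.single (H.slot D) 1) ((p : ℚ) ^ e * mu T (.gen D)) := by
  have hp : 0 < p := expChar_pos k p
  by_contra hcon
  obtain ⟨r, l, hrow, hr, -, -⟩ := (hH _ (isPlace_gen hD)).wellAdapted.rowData hcon
  have h1 := invH_gen_of_rowData hT (H.toFrame hp) hD (by rw [H.toFrame_last]; exact hrow) hr
  apply hb
  have hq : (0 : ℚ) < (p : ℚ) ^ e := by positivity
  rw [IsBad, h1.1, div_lt_iff₀ hq]
  linarith

theorem invH_of_mem (hT : InMonomialCase p e T) {D : ℕ} (hD : D ∈ T.bdry)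
    (h : H.aLast ∈ ordIdeal k (Pi.single (H.slot D) 1) ((p : ℚ) ^ e * mu T (.gen D))) :
    invH p e T (.gen D) = mu T (.gen D) := by
  have hp : 0 < p := expChar_pos k p
  exact invH_gen_of_mem hT (H.toFrame hp) hD (by rw [H.toFrame_last]; exact h)

/-- For a bad component, the invariants are read off from the lowest monomial in the lowest row. -/
theorem exists_row (hT : InMonomialCase p e T) (hH : ∀ v, IsPlace T v → H.Clean v) {D : ℕ}
    (hD : D ∈ T.bdry) (hb : IsBad p e T (.gen D)) :
    ∃ r l, RowData (p ^ e) H.aLast (H.slot D) r l ∧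
      (∀ l' < l, MvPowerSeries.coeff (expo (H.slot D) r l') H.aLast = 0) ∧
      (r : ℚ) < (p : ℚ) ^ e * mu T (.gen D) ∧ invH p e T (.gen D) = r / (p : ℚ) ^ e ∧
      residual p e T D = r + l := by
  have hp : 0 < p := expChar_pos k p
  have hc := hH _ (isPlace_gen hD)
  by_cases h : H.aLast ∈ ordIdeal k (Pi.single (H.slot D) 1) ((p : ℚ) ^ e * mu T (.gen D))
  · exact absurd (invH_of_mem hT hD h) hb.ne
  · obtain ⟨r, l, hrow, hr, -, -⟩ := hc.wellAdapted.rowData h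
    have hrow' : RowData (p ^ e) ((H.toFrame hp).A (p ^ e)) ((H.toFrame hp).slot D) r l := by
      rw [H.toFrame_last]; exact hrow
    obtain ⟨C⟩ := H.nonempty_comparison (H.toFrame hp)
    have h1 := invH_gen_of_rowData hT (H.toFrame hp) hD hrow' hr
    exact ⟨r, l, hrow, (C.rowData hT.1 hD hc hrow' hr).2, hr, h1.1, h1.2⟩

theorem aLast_mem_gen (hT : InMonomialCase p e T) (hH : ∀ v, IsPlace T v → H.Clean v) {D : ℕ}
    (hD : D ∈ T.bdry) :
    H.aLast ∈ ordIdeal k (Pi.single (H.slot D) 1) ((p : ℚ) ^ e * invH p e T (.gen D)) := by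
  have hq : (0 : ℚ) < (p : ℚ) ^ e := by have := expChar_pos k p; positivity
  by_cases hb : IsBad p e T (.gen D)
  · obtain ⟨r, l, hrow, -, -, h, -⟩ := exists_row hT hH hD hb
    rw [h, mul_div_cancel₀ _ hq.ne']
    exact hrow.mem
  · have h := mem_of_not_isBad hT hH hD hb
    rwa [← invH_of_mem hT hD h] at h

theorem mem_of_not_isBad_pt (hT : InMonomialCase p e T) (hH : ∀ v, IsPlace T v → H.Clean v)
    (hb : ¬ IsBad p e T .pt) : H.aLast ∈ ordIdeal k (fun _ => 1) ((p : ℚ) ^ e * mu T .pt) := by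
  by_contra hcon
  obtain ⟨N, -, -, -, -, h, -⟩ := H.lowest (v := .pt) (expChar_pos k p) hcon
  apply hb
  rw [IsBad, invH_pt hT (hH _ isPlace_pt).wellAdapted]
  exact h

/-- At a bad point, `H(P)` is the degree of the lowest terms of `a_q`, none of which is a `q`-th power. -/
theorem exists_degree (hT : InMonomialCase p e T) (hH : ∀ v, IsPlace T v → H.Clean v)
    (hb : IsBad p e T .pt) :
    ∃ d : ℕ, H.aLast ∈ ordIdeal k (fun _ => 1) d ∧
      (∃ n, MvPowerSeries.coeff n H.aLast ≠ 0 ∧ n 0 + n 1 = d) ∧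
      (d : ℚ) < (p : ℚ) ^ e * mu T .pt ∧ invH p e T .pt = d / (p : ℚ) ^ e ∧ p ^ e < d ∧
      ∀ n, MvPowerSeries.coeff n H.aLast ≠ 0 → n 0 + n 1 = d → ¬ ∀ i, p ^ e ∣ n i := by
  have hp : 0 < p := expChar_pos k p
  have hI := invH_pt hT (hH _ isPlace_pt).wellAdapted
  by_cases h : H.aLast ∈ ordIdeal k (H.wt .pt) ((p : ℚ) ^ e * mu T .pt)
  · rw [IsBad, hI, H.slope_of_mem hp h] at hb
    exact absurd hb (lt_irrefl _)
  · obtain ⟨d, hd, hd', hlt, hs, -, -⟩ := H.lowest hp h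
    rw [H.wt_pt] at hd hd'
    simp only [weight_one] at hd'
    refine ⟨d, hd, hd', hlt, hI.trans hs, ?_, fun n hn hnd => ?_⟩
    · obtain ⟨n, hn, hnd⟩ := hd'
      have h1 := H.aLast_mem hp n hn
      rw [weight_one, hnd] at h1
      have h2 : ((p ^ e + 1 : ℕ) : ℚ) ≤ d := by push_cast; exact h1
      exact_mod_cast h2
    · have hw : Finsupp.weight (H.wt .pt) n = d := by rw [H.wt_pt, weight_one, hnd]
      refine hH _ isPlace_pt n hn (fun n' hn' => ?_) (by rw [hw]; exact hlt)
      rw [hw]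
      exact_mod_cast hd n' hn'

theorem tight_le_degree (hT : InMonomialCase p e T) (hH : ∀ v, IsPlace T v → H.Clean v)
    {n : Fin 2 →₀ ℕ} (hn : MvPowerSeries.coeff n H.aLast ≠ 0) :
    (p : ℚ) ^ e * ordTight p e T ≤ (n 0 + n 1 : ℕ) := by
  rw [ordTight, Finset.mul_sum]
  calc ∑ D ∈ T.bdry, (p : ℚ) ^ e * invH p e T (.gen D)
      ≤ ∑ D ∈ T.bdry, (n (H.slot D) : ℚ) := Finset.sum_le_sum fun D hD => by
        have := aLast_mem_gen hT hH hD n hn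
        rwa [weight_single] at this
    _ ≤ _ := by exact_mod_cast H.sum_slot_le n

end Presentation

theorem invH_gen_le (hT : InMonomialCase p e T) {D : ℕ} (hD : D ∈ T.bdry) :
    invH p e T (.gen D) ≤ mu T (.gen D) := by
  obtain ⟨H, hH⟩ := hT.2.some.exists_clean
  by_cases hb : IsBad p e T (.gen D)
  · exact hb.le
  · exact (Presentation.invH_of_mem hT hD (Presentation.mem_of_not_isBad hT hH hD hb)).le

theorem invH_gen_eq (hT : InMonomialCase p e T) {D : ℕ} (hD : D ∈ T.bdry)
    (hb : ¬ IsBad p e T (.gen D)) : invH p e T (.gen D) = mu T (.gen D) :=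
  le_antisymm (invH_gen_le hT hD) (not_lt.1 hb)

theorem invH_pt_le (hT : InMonomialCase p e T) : invH p e T .pt ≤ mu T .pt := by
  obtain ⟨H, hH⟩ := hT.2.some.exists_clean
  have hp : 0 < p := expChar_pos k p
  rw [invH_pt hT (hH _ isPlace_pt).wellAdapted]
  by_cases h : H.aLast ∈ ordIdeal k (H.wt .pt) ((p : ℚ) ^ e * mu T .pt)
  · exact (H.slope_of_mem hp h).le
  · obtain ⟨N, -, -, -, -, h, -⟩ := H.lowest hp h
    exact h.le

theorem invH_pt_eq (hT : InMonomialCase p e T) (hb : ¬ IsBad p e T .pt) :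
    invH p e T .pt = mu T .pt := le_antisymm (invH_pt_le hT) (not_lt.1 hb)

theorem tight_le_mu (hT : InMonomialCase p e T) : ordTight p e T ≤ mu T .pt := by
  rw [mu_pt, ordTight]
  exact Finset.sum_le_sum fun D hD => invH_gen_le hT hD

theorem invHeart_nonneg (hT : InMonomialCase p e T) : 0 ≤ invHeart p e T := by
  have hq : (0 : ℚ) < (p : ℚ) ^ e := by have := expChar_pos k p; positivity
  obtain ⟨H, hH⟩ := hT.2.some.exists_clean
  rw [invHeart, sub_nonneg]
  by_cases hb : IsBad p e T .pt
  · obtain ⟨d, -, ⟨n, hn, hd⟩, -, h, -, -⟩ := Presentation.exists_degree hT hH hb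
    rw [h, le_div_iff₀ hq, mul_comm, ← hd]
    exact Presentation.tight_le_degree hT hH hn
  · rw [invH_pt_eq hT hb]
    exact tight_le_mu hT

theorem invHeart_le_wRho (hT : InMonomialCase p e T) {D : ℕ} (hD : D ∈ badDivisors p e T) :
    invHeart p e T ≤ wRho p e T D := by
  have hq : (0 : ℚ) < (p : ℚ) ^ e := by have := expChar_pos k p; positivity
  obtain ⟨H, hH⟩ := hT.2.some.exists_clean
  obtain ⟨hD, hb⟩ := mem_badDivisors.1 hD
  obtain ⟨r, l, hrow, -, -, -, hres⟩ := Presentation.exists_row hT hH hD hb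
  rw [invHeart, wRho, sub_le_sub_iff_right, le_div_iff₀ hq, hres]
  have hdeg : expo (H.slot D) r l 0 + expo (H.slot D) r l 1 = r + l := by
    rw [add_eq_add (H.slot D)]; simp
  by_cases hbP : IsBad p e T .pt
  · obtain ⟨d, hd, -, -, h, -, -⟩ := Presentation.exists_degree hT hH hbP
    have h1 := hd _ hrow.coeff_ne
    rw [weight_one, hdeg] at h1
    rw [h, div_mul_cancel₀ _ hq.ne']
    exact h1
  · have h1 := Presentation.mem_of_not_isBad_pt hT hH hbP _ hrow.coeff_ne
    rw [weight_one, hdeg] at h1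
    rw [invH_pt_eq hT hbP, mul_comm]
    exact h1

/-- If the exponents of the lowest form of `a_q` are forced by the components, then the numbers `w-ρ`
vanish. -/
theorem wRho_eq_zero (hT : InMonomialCase p e T) (hbP : IsBad p e T .pt)
    (h0 : invHeart p e T = 0) {D : ℕ} (hD : D ∈ badDivisors p e T) : wRho p e T D = 0 := by
  have hq : (0 : ℚ) < (p : ℚ) ^ e := by have := expChar_pos k p; positivity
  obtain ⟨H, hH⟩ := hT.2.some.exists_clean
  refine le_antisymm ?_ (h0 ▸ invHeart_le_wRho hT hD)
  obtain ⟨hD, hb⟩ := mem_badDivisors.1 hD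
  obtain ⟨r, l, hrow, hzero, -, hr, hres⟩ := Presentation.exists_row hT hH hD hb
  obtain ⟨d, hd, ⟨n, hn, hnd⟩, -, h, -, -⟩ := Presentation.exists_degree hT hH hbP
  rw [invHeart, sub_eq_zero, h] at h0
  have hsum : (∑ E ∈ T.bdry, ((n (H.slot E) : ℚ) - (p : ℚ) ^ e * invH p e T (.gen E))) ≤ 0 := by
    rw [Finset.sum_sub_distrib, ← Finset.mul_sum]
    have h1 : (∑ E ∈ T.bdry, (n (H.slot E) : ℚ)) ≤ d := by
      rw [← hnd]; exact_mod_cast H.sum_slot_le n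
    have h2 : (p : ℚ) ^ e * ordTight p e T = d := by rw [← h0]; field_simp
    rw [ordTight] at h2
    linarith
  have hnonneg : ∀ E ∈ T.bdry, 0 ≤ (n (H.slot E) : ℚ) - (p : ℚ) ^ e * invH p e T (.gen E) := by
    intro E hE
    have := Presentation.aLast_mem_gen hT hH hE n hn
    rw [weight_single] at this
    linarith
  have hnr : n (H.slot D) = r := by
    have h1 := (Finset.single_le_sum hnonneg hD).trans hsum
    have h2 := hnonneg D hD
    rw [hr, mul_div_cancel₀ _ hq.ne'] at h1 h2
    have h3 : (n (H.slot D) : ℚ) = r := by linarith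
    exact_mod_cast h3
  have hl : l ≤ n (1 - H.slot D) := by
    by_contra hcon
    rw [not_le] at hcon
    apply hn
    rw [eq_expo (H.slot D) n, hnr]
    exact hzero _ hcon
  rw [wRho, hres, sub_nonpos, div_le_iff₀ hq, ← h0, div_mul_cancel₀ _ hq.ne', ← hnd,
    add_eq_add (H.slot D), hnr]
  exact_mod_cast Nat.add_le_add_left hl r

/-- As long as the algorithm goes on, `inv_♡` is positive. -/
theorem invHeart_pos (hT : InMonomialCase p e T) (h : invSpade p e T ≠ zeroPair) :
    0 < invHeart p e T ∧ (badDivisors p e T).Nonempty ∧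
      (∀ D ∈ badDivisors p e T, wRho p e T D ≠ 0) ∧ ordTight p e T < mu T .pt := by
  have h1 : wordA p e T ≠ [0] ∧ wordB p e T ≠ [0] := by
    by_contra hcon
    apply h
    rw [invSpade, if_pos]
    by_contra hcon'
    push Not at hcon'
    exact hcon hcon'
  obtain ⟨hA, hB⟩ := h1
  have hA' : ¬ (badDivisors p e T = ∅ ∨ ∃ D ∈ badDivisors p e T, wRho p e T D = 0) := by
    intro hcon
    exact hA (by rw [wordA, if_pos hcon])
  push Not at hA'
  have hne : (badDivisors p e T).Nonempty := hA'.1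
  have hB' : ordTight p e T < mu T .pt := by
    refine lt_of_le_of_ne (tight_le_mu hT) fun hcon => hB ?_
    rw [wordB, hcon, sub_self]
  refine ⟨lt_of_le_of_ne (invHeart_nonneg hT) fun h0 => ?_, hne, hA'.2, hB'⟩
  by_cases hbP : IsBad p e T .pt
  · obtain ⟨D, hD⟩ := hne
    exact hA'.2 D hD (wRho_eq_zero hT hbP h0.symm hD)
  · rw [invHeart, invH_pt_eq hT hbP] at h0
    linarith

end Numeric

/-! ### Curves in the singular locus -/

section SingularCurve

variable {k : Type*} [Field k]

theorem mem_span_pow_of_mem_locIdeal {i : Fin 2} {n : ℕ} {f : Loc k}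
    (h : f ∈ locIdeal k (Pi.single i 1) n) :
    f ∈ Ideal.span {PowerSeries.X, PowerSeries.C (MvPowerSeries.X i : Base k)} ^ n := by
  induction n generalizing f with
  | zero => simp
  | succ n ih =>
    obtain ⟨g, hg, hgc⟩ := exists_loc_eq f
    have h0 := h 0
    rw [Nat.cast_zero, sub_zero] at h0
    obtain ⟨c, hc⟩ := exists_eq_X_pow_mul h0
    rw [PowerSeries.coeff_zero_eq_constantCoeff_apply] at hc
    rw [hg, hc, map_mul, map_pow]
    refine Ideal.add_mem _ (Ideal.mul_mem_right _ _ (Ideal.pow_mem_pow (Ideal.subset_span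
      (by simp)) _)) ?_
    rw [pow_succ']
    refine Ideal.mul_mem_mul (Ideal.subset_span (by simp)) (ih fun m => ?_)
    rw [hgc]
    refine ordIdeal_anti ?_ (h (m + 1))
    push_cast; linarith

variable {p e : ℕ} {T : Triplet k}

theorem Presentation.W_mem_locIdeal (H : Presentation p e T) (hp : 0 < p) {D : ℕ}
    (hD : D ∈ T.bdry) (hμ : 1 < mu T (.gen D))
    (ha : H.aLast ∈ ordIdeal k (Pi.single (H.slot D) 1) ((p : ℚ) ^ e + 1)) :
    (H.W : Loc k) - PowerSeries.X ^ p ^ e ∈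
      locIdeal k (Pi.single (H.slot D) 1) ((p : ℚ) ^ e + 1) := by
  have hq : 0 < p ^ e := Nat.pow_pos hp
  have hqQ : ((p ^ e : ℕ) : ℚ) = (p : ℚ) ^ e := by push_cast; rfl
  intro m
  rw [map_sub, Polynomial.coeff_coe, PowerSeries.coeff_X_pow]
  rcases lt_trichotomy m (p ^ e) with h | h | h
  · rw [if_neg h.ne, sub_zero]
    rcases Nat.eq_zero_or_pos m with rfl | hm
    · rw [Nat.cast_zero, sub_zero]; exact ha
    · have h1 := H.coeff_mem_gen hD (j := p ^ e - m) (Finset.mem_Ioo.2 ⟨by omega, by omega⟩)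
      rw [Nat.sub_sub_self h.le] at h1
      intro n hn
      have h2 := h1 n hn
      have h3 : (0 : ℚ) < (p ^ e - m : ℕ) := by exact_mod_cast Nat.sub_pos_of_lt h
      have h4 : ((p ^ e - m : ℕ) : ℚ) < (Finsupp.weight (Pi.single (H.slot D) 1) n : ℕ) := by
        nlinarith
      have h5 : ((p ^ e - m + 1 : ℕ) : ℚ) ≤ (Finsupp.weight (Pi.single (H.slot D) 1) n : ℕ) := by
        exact_mod_cast Nat.succ_le_of_lt (by exact_mod_cast h4)
      refine le_trans (le_of_eq ?_) h5
      rw [Nat.cast_add, Nat.cast_sub h.le, hqQ]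
      push_cast; ring
  · rw [if_pos h, h, H.coeff_natDegree, sub_self]; exact Ideal.zero_mem _
  · rw [if_neg h.ne', sub_zero, Polynomial.coeff_eq_zero_of_natDegree_lt (by rwa [H.natDegree_eq])]
    exact Ideal.zero_mem _

theorem mem_locIdeal_of_X_pow_mul {i : Fin 2} {q : ℕ} {s : ℚ} {f : Loc k}
    (h : PowerSeries.X ^ q * f ∈ locIdeal k (Pi.single i 1) (s + q)) :
    f ∈ locIdeal k (Pi.single i 1) s := by
  intro m
  have := h (m + q)
  rw [PowerSeries.coeff_X_pow_mul] at this
  refine ordIdeal_anti (le_of_eq ?_) this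
  push_cast; ring

/-- The quotient by a Weierstrass polynomial with initial form `z ^ q` has the expected order. -/
theorem mem_locIdeal_of_mul_mem {i : Fin 2} {q : ℕ} {s : ℚ} {W Q : Loc k}
    (hW : W - PowerSeries.X ^ q ∈ locIdeal k (Pi.single i 1) ((q : ℚ) + 1))
    (h : Q * W ∈ locIdeal k (Pi.single i 1) (s + q)) : Q ∈ locIdeal k (Pi.single i 1) s := by
  have hanti : ∀ {a b : ℚ}, a ≤ b →
      locIdeal k (Pi.single i 1) b ≤ locIdeal k (Pi.single i 1) a :=
    fun hab f hf m => ordIdeal_anti (by linarith) (hf m)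
  have key : ∀ t : ℕ, Q ∈ locIdeal k (Pi.single i 1) (min t s) := by
    intro t
    induction t with
    | zero =>
      intro m
      refine mem_ordIdeal_of_nonpos ?_ _
      have : min ((0 : ℕ) : ℚ) s ≤ 0 := by simp
      have hm : (0 : ℚ) ≤ m := Nat.cast_nonneg m
      linarith
    | succ t ih =>
      refine mem_locIdeal_of_X_pow_mul (q := q) ?_
      have h1 : PowerSeries.X ^ q * Q = Q * W - Q * (W - PowerSeries.X ^ q) := by ring
      rw [h1]
      refine Ideal.sub_mem _ (hanti ?_ h) (hanti ?_ (mul_mem_locIdeal ih hW))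
      · linarith [min_le_right ((t + 1 : ℕ) : ℚ) s]
      · have : min ((t + 1 : ℕ) : ℚ) s ≤ min (t : ℚ) s + 1 := by
          rw [← min_add_add_right]
          exact min_le_min (by push_cast; exact le_rfl) (by linarith)
        linarith
  obtain ⟨t, ht⟩ := exists_nat_ge s
  have := key t
  rwa [min_eq_right ht] at this

/-- If the slope along a component is larger than `1`, then the elements of level `n` have order at least
`n` along the curve `z = x_D = 0`. -/
theorem Presentation.mem_locIdeal_of_mem (H : Presentation p e T) (hp : 0 < p) {D : ℕ}
    (hD : D ∈ T.bdry) (hμ : 1 < mu T (.gen D))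
    (ha : H.aLast ∈ ordIdeal k (Pi.single (H.slot D) 1) ((p : ℚ) ^ e + 1)) {n : ℕ} {f : Loc k}
    (hf : H.X f ∈ T.R.ideal n) : f ∈ locIdeal k (Pi.single (H.slot D) 1) n := by
  have hW := H.W_mem_locIdeal hp hD hμ ha
  have hqQ : ((p ^ e : ℕ) : ℚ) = (p : ℚ) ^ e := by push_cast; rfl
  -- it suffices to bound the order of the restriction to `z = 0`
  have main : ∀ (N n : ℕ) (f : Loc k), N < n → H.X f ∈ T.R.ideal n →
      f ∈ locIdeal k (Pi.single (H.slot D) 1) N →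
      PowerSeries.coeff 0 f ∈ ordIdeal k (Pi.single (H.slot D) 1) (N + 1) := by
    intro N n f hNn hf hfN
    obtain ⟨Q, r, hr, hdiv⟩ := H.exists_division f
    have h1 := H.rem_dvd n f Q r hf hr hdiv D hD
    have hrn : ∀ m, PowerSeries.coeff m (r : Loc k) ∈
        ordIdeal k (Pi.single (H.slot D) 1) (N + 1) := by
      intro m
      refine ordIdeal_anti ?_ (coeff_mem_ordIdeal_of_C_dvd h1 m)
      refine le_trans ?_ (Nat.le_ceil _)
      have h2 : (T.mult D : ℚ) * n / T.level = n * mu T (.gen D) := by rw [mu]; ring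
      have h3 : ((N + 1 : ℕ) : ℚ) ≤ n := by exact_mod_cast hNn
      push_cast at h3
      have h4 : (0 : ℚ) ≤ n := Nat.cast_nonneg n
      rw [h2]
      nlinarith
    have hQW : Q * (H.W : Loc k) ∈ locIdeal k (Pi.single (H.slot D) 1)
        (((N : ℚ) - (p ^ e : ℕ)) + (p ^ e : ℕ)) := by
      have h2 : Q * (H.W : Loc k) = f - (r : Loc k) := by rw [hdiv]; ring
      rw [h2, sub_add_cancel]
      refine Ideal.sub_mem _ hfN fun m => ordIdeal_anti ?_ (hrn m)
      have : (0 : ℚ) ≤ m := Nat.cast_nonneg m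
      linarith
    have hQ := mem_locIdeal_of_mul_mem (by rw [hqQ]; exact hW) hQW 0
    have h3 : PowerSeries.coeff 0 f = PowerSeries.coeff 0 Q * H.aLast +
        PowerSeries.coeff 0 (r : Loc k) := by
      have h4 : PowerSeries.coeff 0 (H.W : Loc k) = H.aLast := by rw [Polynomial.coeff_coe]; rfl
      rw [← h4]
      conv_lhs => rw [hdiv]
      simp only [PowerSeries.coeff_zero_eq_constantCoeff_apply, map_add, map_mul]
    rw [h3]
    refine Ideal.add_mem _ (ordIdeal_anti (le_of_eq ?_) (mul_mem_ordIdeal hQ ha)) (hrn 0)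
    rw [hqQ]; push_cast; ring
  have key : ∀ N : ℕ, N ≤ n → f ∈ locIdeal k (Pi.single (H.slot D) 1) N := by
    intro N
    induction N with
    | zero =>
      intro _ m
      refine mem_ordIdeal_of_nonpos ?_ _
      have hm : (0 : ℚ) ≤ m := Nat.cast_nonneg m
      push_cast; linarith
    | succ N ih =>
      intro hN m
      rcases le_or_gt m N with hm | hm
      · have h1 : hasseZ m f ∈ locIdeal k (Pi.single (H.slot D) 1) (N - m : ℕ) := by
          intro j
          rw [hasseZ, PowerSeries.coeff_mk]
          refine Ideal.mul_mem_left _ _ (ordIdeal_anti (le_of_eq ?_) (ih (by omega) (j + m)))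
          rw [Nat.cast_sub hm]; push_cast; ring
        have h2 := main (N - m) (n - m) _ (by omega) (H.hasse_mem n m f hf) h1
        rw [hasseZ, PowerSeries.coeff_mk, zero_add, Nat.choose_self, Nat.cast_one, one_mul] at h2
        refine ordIdeal_anti (le_of_eq ?_) h2
        rw [Nat.cast_sub hm]; push_cast; ring
      · refine mem_ordIdeal_of_nonpos ?_ _
        have : ((N + 1 : ℕ) : ℚ) ≤ m := by exact_mod_cast hm
        linarith
  exact key n le_rfl

theorem span_xy_isPrime (X : Coord k) (i : Fin 2) : (Ideal.span {X.xy i}).IsPrime := by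
  have : Ideal.span {X.xy i} = RingHom.ker ((PowerSeries.map (restrictX k i)).comp
      (X.symm : Loc k →+* Loc k)) := by
    ext f
    rw [Ideal.mem_span_singleton, xy_dvd_iff]
    rfl
  rw [this]
  exact RingHom.ker_isPrime _

theorem mem_asIdeal_of_mem_sing {𝔮 : PrimeSpectrum (Loc k)} (h : 𝔮 ∈ T.R.Sing) {n : ℕ}
    (hn : 0 < n) {f : Loc k} (hf : f ∈ T.R.ideal n) : f ∈ 𝔮.asIdeal := by
  have h1 := Ideal.pow_le_self hn.ne' (h n (Ideal.mem_map_of_mem _ hf))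
  rw [← Localization.AtPrime.under_maximalIdeal (I := 𝔮.asIdeal)]
  exact h1

theorem height_maximalIdeal_le : (maximalIdeal (Loc k)).height ≤ 3 := by
  classical
  have h1 : maximalIdeal (Loc k) ∈ (Ideal.span
      ((({PowerSeries.X, PowerSeries.C (MvPowerSeries.X 0 : Base k),
        PowerSeries.C (MvPowerSeries.X 1 : Base k)} : Finset (Loc k)) : Set (Loc k)))).minimalPrimes := by
    push_cast
    rw [← maximalIdeal_loc_eq, Ideal.minimalPrimes_eq_subsingleton_self]
    rfl
  refine (Ideal.height_le_card_of_mem_minimalPrimes_span_finset h1).trans ?_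
  exact_mod_cast Finset.card_le_three

theorem W_not_mem_span_xy (H : Presentation p e T) (i : Fin 2) :
    H.X (H.W : Loc k) ∉ Ideal.span {H.X.xy i} := by
  intro h
  rw [Ideal.mem_span_singleton, xy_dvd_iff, AlgEquiv.symm_apply_apply] at h
  have h1 := congrArg (PowerSeries.coeff (p ^ e)) h
  rw [PowerSeries.coeff_map, Polynomial.coeff_coe, H.coeff_natDegree] at h1
  simp at h1

/-- If the slope along a component is larger than `1`, then the singular locus contains a curve. -/
theorem singDim_eq_one [IsAlgClosed k] [ExpChar k p] (hT : InMonomialCase p e T) {D : ℕ}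
    (hD : D ∈ T.bdry) (h : 1 < invH p e T (.gen D)) : singDim T = 1 := by
  have hp : 0 < p := expChar_pos k p
  have hq : 0 < p ^ e := Nat.pow_pos hp
  have hqQ : (0 : ℚ) < (p : ℚ) ^ e := by positivity
  obtain ⟨H, hH⟩ := hT.2.some.exists_clean
  have ha : H.aLast ∈ ordIdeal k (Pi.single (H.slot D) 1) ((p : ℚ) ^ e + 1) := by
    intro n hn
    have h1 := Presentation.aLast_mem_gen hT hH hD n hn
    have h2 : ((p ^ e : ℕ) : ℚ) < (Finsupp.weight (Pi.single (H.slot D) 1) n : ℕ) := by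
      push_cast; nlinarith
    rw [Nat.cast_lt] at h2
    have h3 : ((p ^ e + 1 : ℕ) : ℚ) ≤ (Finsupp.weight (Pi.single (H.slot D) 1) n : ℕ) := by
      exact_mod_cast h2
    push_cast at h3
    exact h3
  obtain ⟨𝔮, h𝔮eq⟩ : ∃ 𝔮 : PrimeSpectrum (Loc k),
      𝔮.asIdeal = Ideal.span {H.X.z, H.X.xy (H.slot D)} :=
    ⟨⟨RingHom.ker (restrictCurve H.X (H.slot D)), RingHom.ker_isPrime _⟩, ker_restrictCurve _ _⟩
  have h𝔮 : 𝔮 ∈ T.R.Sing := by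
    intro n
    rw [← Localization.AtPrime.map_eq_maximalIdeal, ← Ideal.map_pow]
    refine Ideal.map_mono fun f hf => ?_
    have h1 := mem_span_pow_of_mem_locIdeal (H.mem_locIdeal_of_mem hp hD
      (h.trans_le (invH_gen_le hT hD)) ha (f := H.X.symm f) (by simpa using hf))
    have h2 := Ideal.mem_map_of_mem (H.X : Loc k →+* Loc k) h1
    rw [Ideal.map_pow, Ideal.map_span] at h2
    rw [h𝔮eq]
    simpa [Set.image_insert_eq, Coord.z, Coord.xy] using h2
  have hlt : 𝔮 < closedPoint (Loc k) := by
    refine lt_of_le_of_ne (IsLocalRing.le_maximalIdeal 𝔮.isPrime.ne_top) fun heq => ?_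
    exact span_ne_maximalIdeal H.X (H.slot D) (h𝔮eq.symm.trans (congrArg PrimeSpectrum.asIdeal heq))
  rw [singDim]
  apply le_antisymm
  · rw [Order.krullDim_le_one_iff]
    intro x
    by_contra hcon
    push Not at hcon
    rw [not_isMin_iff, not_isMax_iff] at hcon
    obtain ⟨⟨y₀, h0⟩, ⟨y₂, h2⟩⟩ := hcon
    -- the prime ideals `0 < (x_E) < y₀ < x < y₂` would give dimension at least four
    have hM := mem_asIdeal_of_mem_sing y₀.2 H.level_pos H.monomial_mem
    obtain ⟨E, hE, hE'⟩ := (Ideal.IsPrime.prod_mem_iff (p := y₀.1.asIdeal)).1 hM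
    have hEx := Ideal.IsPrime.mem_of_pow_mem inferInstance _ hE'
    have : (Ideal.span {H.X.xy (H.slot E)}).IsPrime := span_xy_isPrime _ _
    have l1 : (⊥ : Ideal (Loc k)) < Ideal.span {H.X.xy (H.slot E)} := by
      rw [bot_lt_iff_ne_bot, Ne, Ideal.span_singleton_eq_bot]
      exact H.X.xy_ne_zero _
    have l2 : Ideal.span {H.X.xy (H.slot E)} < y₀.1.asIdeal := by
      refine lt_of_le_of_ne ((Ideal.span_singleton_le_iff_mem _).2 hEx) fun heq => ?_
      exact W_not_mem_span_xy H (H.slot E) (heq ▸ mem_asIdeal_of_mem_sing y₀.2 hq H.h_mem)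
    have l3 : y₀.1.asIdeal < x.1.asIdeal := h0
    have l4 : x.1.asIdeal < y₂.1.asIdeal := h2
    have : (⊥ : Ideal (Loc k)).IsPrime := Ideal.isPrime_bot
    have i1 := Ideal.height_add_one_le_of_lt_of_isPrime l1
    have i2 := Ideal.height_add_one_le_of_lt_of_isPrime l2
    have i3 := Ideal.height_add_one_le_of_lt_of_isPrime l3
    have i4 := Ideal.height_add_one_le_of_lt_of_isPrime l4
    have i5 : y₂.1.asIdeal.height ≤ 3 :=
      (Ideal.height_mono (IsLocalRing.le_maximalIdeal y₂.1.isPrime.ne_top)).trans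
        height_maximalIdeal_le
    have i6 : (0 : ℕ∞) + 1 + 1 + 1 + 1 ≤ 3 := by
      calc (0 : ℕ∞) + 1 + 1 + 1 + 1 ≤ (⊥ : Ideal (Loc k)).height + 1 + 1 + 1 + 1 := by
            gcongr; exact zero_le
        _ ≤ (Ideal.span {H.X.xy (H.slot E)}).height + 1 + 1 + 1 := by gcongr
        _ ≤ y₀.1.asIdeal.height + 1 + 1 := by gcongr
        _ ≤ x.1.asIdeal.height + 1 := by gcongr
        _ ≤ y₂.1.asIdeal.height := i4
        _ ≤ 3 := i5
    exact absurd i6 (by decide)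
  · rw [Order.one_le_krullDim_iff]
    exact ⟨⟨𝔮, h𝔮⟩, ⟨closedPoint (Loc k), hT.1⟩, hlt⟩

end SingularCurve

/-! ### The invariants after the blow-up of a point -/

section Substitution

variable {k : Type*} [Field k]

/-- The dehomogenization of the part of degree `d` of `a`: the polynomial in `x_(1 - i)` obtained by
setting `x_i = 1`. -/
def dehomogenize (a : Base k) (i : Fin 2) (d : ℕ) : Polynomial k :=
  ∑ t ∈ Finset.range (d + 1), Polynomial.monomial t (MvPowerSeries.coeff (expo i (d - t) t) a)

theorem coeff_dehomogenize (a : Base k) (i : Fin 2) (d t : ℕ) :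
    (dehomogenize a i d).coeff t =
      if t ≤ d then MvPowerSeries.coeff (expo i (d - t) t) a else 0 := by
  simp only [dehomogenize, Polynomial.finsetSum_coeff, Polynomial.coeff_monomial,
    Finset.sum_ite_eq', Finset.mem_range, Nat.lt_succ_iff]

theorem monomial_expo (i : Fin 2) (r l : ℕ) (c : k) :
    (MvPowerSeries.monomial (expo i r l) c : Base k) =
      algebraMap k (Base k) c * (MvPowerSeries.X i ^ r * MvPowerSeries.X (1 - i) ^ l) := by
  have h : algebraMap k (Base k) c = MvPowerSeries.monomial 0 c := rfl
  rw [h, MvPowerSeries.X_pow_eq, MvPowerSeries.X_pow_eq, MvPowerSeries.monomial_mul_monomial,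
    MvPowerSeries.monomial_mul_monomial, expo]
  simp

theorem restrictX_algebraMap (i : Fin 2) (c : k) :
    restrictX k i (algebraMap k (Base k) c) = PowerSeries.C c := by
  classical
  have h : algebraMap k (Base k) c = MvPowerSeries.monomial 0 c := rfl
  ext l
  rw [coeff_restrictX, h, MvPowerSeries.coeff_monomial, PowerSeries.coeff_C]
  congr 1
  apply propext
  constructor
  · intro h
    have := DFunLike.congr_fun h (1 - i)
    simpa using this
  · rintro rfl
    simp [expo]

/-- The lowest form in terms of its dehomogenization, in the chart of the blow-up of the point. -/
theorem exists_eq_of_chart {σ : Base k →ₐ[k] Base k} {i : Fin 2} {c : k}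
    (hi : σ (MvPowerSeries.X i) = MvPowerSeries.X 0)
    (ho : σ (MvPowerSeries.X (1 - i)) =
      MvPowerSeries.X 0 * (MvPowerSeries.X 1 + algebraMap k (Base k) c))
    {a : Base k} {d : ℕ} (ha : a ∈ ordIdeal k (fun _ => 1) d) :
    ∃ B, σ a = MvPowerSeries.X 0 ^ d * B ∧
      restrictX k 0 B = (Polynomial.taylor c (dehomogenize a i d) : Polynomial k) := by
  classical
  -- `a'` is the part of degree greater than `d`
  let a' : Base k := fun n => if n 0 + n 1 = d then 0 else MvPowerSeries.coeff n a
  have ha'c : ∀ n, MvPowerSeries.coeff n a' = if n 0 + n 1 = d then 0 else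
    MvPowerSeries.coeff n a := fun n => rfl
  have ha' : a' ∈ ordIdeal k (fun _ => 1) (d + 1 : ℕ) := by
    intro n hn
    rw [ha'c] at hn
    split_ifs at hn with h
    · exact absurd rfl hn
    · have := ha n hn
      rw [weight_one, Nat.cast_le] at this ⊢
      omega
  have hsum : a = ∑ t ∈ Finset.range (d + 1),
      MvPowerSeries.monomial (expo i (d - t) t) (MvPowerSeries.coeff (expo i (d - t) t) a) + a' := by
    ext n
    rw [map_add, map_sum, ha'c]
    simp only [MvPowerSeries.coeff_monomial]
    by_cases hn : n 0 + n 1 = d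
    · rw [if_pos hn, add_zero, Finset.sum_eq_single (n (1 - i))]
      · have : n = expo i (d - n (1 - i)) (n (1 - i)) := by
          rw [add_eq_add i] at hn
          conv_lhs => rw [eq_expo i n]
          congr 1; omega
        rw [← this, if_pos rfl]
      · intro t _ ht
        rw [if_neg]
        rintro rfl
        simp at ht
      · intro h
        exfalso
        apply h
        rw [add_eq_add i] at hn
        rw [Finset.mem_range]; omega
    · rw [if_neg hn, Finset.sum_eq_zero, zero_add]
      intro t ht
      rw [if_neg]
      rintro rfl
      apply hn
      rw [add_eq_add i, expo_same, expo_other]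
      have := Finset.mem_range.1 ht
      omega
  have hσ0 : ∀ j, (MvPowerSeries.X 0 : Base k) ∣ σ (MvPowerSeries.X j) := by
    intro j
    rcases eq_or_eq_one_sub i j with rfl | rfl
    · rw [hi]
    · rw [ho]; exact dvd_mul_right _ _
  have h1 := map_mem_pow_of_mem_ordIdeal (σ : Base k →+* Base k)
    (I := Ideal.span {MvPowerSeries.X 0})
    (fun j => Ideal.mem_span_singleton.2 (hσ0 j)) ha'
  rw [Ideal.span_singleton_pow, Ideal.mem_span_singleton] at h1
  obtain ⟨b, hb⟩ := h1
  rw [RingHom.coe_coe] at hb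
  refine ⟨∑ t ∈ Finset.range (d + 1), algebraMap k (Base k)
    (MvPowerSeries.coeff (expo i (d - t) t) a) * (MvPowerSeries.X 1 + algebraMap k _ c) ^ t +
      MvPowerSeries.X 0 * b, ?_, ?_⟩
  · conv_lhs => rw [hsum]
    rw [map_add, hb, map_sum, mul_add, Finset.mul_sum, pow_succ, mul_assoc]
    congr 1
    refine Finset.sum_congr rfl fun t ht => ?_
    have htd : t ≤ d := by have := Finset.mem_range.1 ht; omega
    rw [monomial_expo, map_mul, AlgHom.commutes, map_mul, map_pow, map_pow, hi, ho, mul_pow]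
    conv_rhs => rw [← Nat.sub_add_cancel htd, pow_add, Nat.sub_add_cancel htd]
    ring
  · rw [map_add, map_mul, restrictX_X_self, zero_mul, add_zero, map_sum, dehomogenize, map_sum,
      ← Polynomial.coeToPowerSeries.ringHom_apply, map_sum]
    refine Finset.sum_congr rfl fun t _ => ?_
    have h1 : restrictX k 0 (MvPowerSeries.X 1) = PowerSeries.X := restrictX_X_other 0
    rw [map_mul, map_pow, map_add, h1, restrictX_algebraMap, restrictX_algebraMap,
      Polynomial.taylor_monomial]
    simp

theorem restrictX_chart {σ : Base k →ₐ[k] Base k} {i : Fin 2}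
    (hi : σ (MvPowerSeries.X i) = MvPowerSeries.X 0)
    (ho : σ (MvPowerSeries.X (1 - i)) = MvPowerSeries.X 0 * MvPowerSeries.X 1) (f : Base k) :
    restrictX k 1 (σ f) = restrictX k (1 - i) f := by
  let ρ : ∀ j, Base k →ₐ[k] PowerSeries k := fun j =>
    { restrictX k j with commutes' := fun c => restrictX_algebraMap j c }
  have hX : restrictX k 1 (MvPowerSeries.X 0) = PowerSeries.X := restrictX_X_other 1
  have hX' : restrictX k (1 - i) (MvPowerSeries.X i) = PowerSeries.X := by
    have := restrictX_X_other (k := k) (1 - i)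
    rwa [one_sub_one_sub] at this
  have e1 : (ρ 1).comp σ (MvPowerSeries.X i) = PowerSeries.X := by
    change restrictX k 1 (σ (MvPowerSeries.X i)) = _
    rw [hi, hX]
  have e2 : (ρ 1).comp σ (MvPowerSeries.X (1 - i)) = 0 := by
    change restrictX k 1 (σ (MvPowerSeries.X (1 - i))) = _
    rw [ho, map_mul, restrictX_X_self, mul_zero]
  have h : (ρ 1).comp σ = ρ (1 - i) := by
    refine algHom_ext_of_X (I := Ideal.span {(PowerSeries.X : PowerSeries k)}) ?_ ?_ ?_
    · intro r hr
      ext m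
      have := hr (m + 1)
      rw [Ideal.span_singleton_pow, Ideal.mem_span_singleton, PowerSeries.X_pow_dvd_iff] at this
      rw [this m (Nat.lt_succ_self m), map_zero]
    · intro j
      rcases eq_or_eq_one_sub i j with rfl | rfl
      · rw [e1]; exact Ideal.mem_span_singleton_self _
      · rw [e2]; exact Ideal.zero_mem _
    · intro j
      rcases eq_or_eq_one_sub i j with rfl | rfl
      · rw [e1]; exact hX'.symm
      · rw [e2]; exact (restrictX_X_self _).symm
  exact DFunLike.congr_fun h f

/-- The lowest row along a component whose strict transform passes through the new point. -/
theorem RowData.strict {q : ℕ} {a A : Base k} {i : Fin 2} {r l : ℕ} (h : RowData q a (1 - i) r l)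
    {σ : Base k →ₐ[k] Base k} (hi : σ (MvPowerSeries.X i) = MvPowerSeries.X 0)
    (ho : σ (MvPowerSeries.X (1 - i)) = MvPowerSeries.X 0 * MvPowerSeries.X 1)
    (hA : MvPowerSeries.X 0 ^ q * A = σ a) (hq : q ≤ r + l) : RowData q A 1 r (r + l - q) := by
  obtain ⟨hmem, hne, hnd, hd⟩ := h
  have hAm : A ∈ ordIdeal k (Pi.single 1 1) r := by
    refine mem_of_X_pow_mul_mem (i := 0) (m := q) ?_
    rw [hA]
    have := map_mem_ordIdeal_single (θ := (σ : Base k →+* Base k)) (i := 1) (by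
      rw [RingHom.coe_coe, ho]; exact dvd_mul_left _ _) hmem
    simpa using this
  obtain ⟨g, rfl⟩ := exists_eq_X_pow_mul hmem
  obtain ⟨A', rfl⟩ := exists_eq_X_pow_mul hAm
  -- dividing by the power of the strict transform leaves `x ^ q A' = x ^ r σ(g)`
  have h1 : MvPowerSeries.X 0 ^ q * A' = MvPowerSeries.X 0 ^ r * σ g := by
    have h2 : (MvPowerSeries.X 1 : Base k) ^ r * (MvPowerSeries.X 0 ^ q * A') =
        MvPowerSeries.X 1 ^ r * (MvPowerSeries.X 0 ^ r * σ g) := by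
      rw [map_mul, map_pow, ho] at hA
      linear_combination hA
    exact mul_left_cancel₀ (pow_ne_zero _ (base_X_prime 1).ne_zero) h2
  have hX : restrictX k 1 (MvPowerSeries.X 0) = PowerSeries.X := restrictX_X_other 1
  have h2 := congrArg (restrictX k 1) h1
  rw [map_mul, map_mul, map_pow, map_pow, hX, restrictX_chart hi ho] at h2
  simp only [coeff_expo_X_pow_mul] at hne hd
  have hcoeff : ∀ m, PowerSeries.coeff m (restrictX k 1 A') =
      PowerSeries.coeff (m + q) (PowerSeries.X ^ r * restrictX k (1 - i) g) := by
    intro m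
    rw [← h2, PowerSeries.coeff_X_pow_mul]
  refine ⟨X_pow_mul_mem _ _ _, ?_, fun hcon => hnd ⟨hcon.1, ?_⟩, fun m hm hm' => ?_⟩
  · rw [coeff_expo_X_pow_mul, hcoeff, Nat.sub_add_cancel hq, add_comm r l,
      PowerSeries.coeff_X_pow_mul]
    exact hne
  · have h3 : q ∣ r + l := by
      have := Nat.dvd_add hcon.2 (dvd_refl q)
      rwa [Nat.sub_add_cancel hq] at this
    exact (Nat.dvd_add_right hcon.1).1 h3
  · rw [coeff_expo_X_pow_mul, hcoeff, PowerSeries.coeff_X_pow_mul'] at hm'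
    split_ifs at hm' with hr
    · obtain ⟨h3, h4⟩ := hd (m + q - r) (by omega) hm'
      refine ⟨h3, ?_⟩
      have h5 : q ∣ m + q := by
        have := Nat.dvd_add h4 h3
        rwa [Nat.sub_add_cancel hr] at this
      exact (Nat.dvd_add_left (dvd_refl q)).1 h5
    · exact absurd rfl hm'

end Substitution

section PointStep

variable {k : Type*} [Field k] [IsAlgClosed k] {p e : ℕ} [ExpChar k p] {T T' : Triplet k}

/-- The invariants at the exceptional divisor of the blow-up of a bad point, in one of the charts. -/
theorem exists_exceptional_row (hT' : InMonomialCase p e T') {F : Frame p e T'}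
    {N : ℕ} (hN : N ∈ T'.bdry) (hμ : mu T' (.gen N) = mu T .pt - 1) (hs : F.slot N = 0)
    {σ : Base k →ₐ[k] Base k} {i : Fin 2} {c : k}
    (hi : σ (MvPowerSeries.X i) = MvPowerSeries.X 0)
    (ho : σ (MvPowerSeries.X (1 - i)) =
      MvPowerSeries.X 0 * (MvPowerSeries.X 1 + algebraMap k (Base k) c))
    {a : Base k} (hA : MvPowerSeries.X 0 ^ p ^ e * F.A (p ^ e) = σ a) {d : ℕ}
    (ha : a ∈ ordIdeal k (fun _ => 1) d) (hex : ∃ n, MvPowerSeries.coeff n a ≠ 0 ∧ n 0 + n 1 = d)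
    (hdμ : (d : ℚ) < (p : ℚ) ^ e * mu T .pt) (hqd : p ^ e < d)
    (hnd : ∀ n, MvPowerSeries.coeff n a ≠ 0 → n 0 + n 1 = d → ¬ ∀ i, p ^ e ∣ n i) :
    invH p e T' (.gen N) = d / (p : ℚ) ^ e - 1 ∧ IsBad p e T' (.gen N) ∧
    ∃ l : ℕ, residual p e T' N + p ^ e = d + l ∧
      (Polynomial.taylor c (dehomogenize a i d)).coeff l ≠ 0 ∧
      ∀ l', (Polynomial.taylor c (dehomogenize a i d)).coeff l' ≠ 0 →
        ¬ (p ^ e ∣ d ∧ p ^ e ∣ l') → l ≤ l' := by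
  classical
  have hp : 0 < p := expChar_pos k p
  have hq : (0 : ℚ) < (p : ℚ) ^ e := by positivity
  set g := dehomogenize a i d with hg
  have hsupp : ∀ t, g.coeff t ≠ 0 → ¬ (p ^ e ∣ d ∧ p ^ e ∣ t) := by
    rintro t ht ⟨h1, h2⟩
    rw [hg, coeff_dehomogenize] at ht
    split_ifs at ht with htd
    · refine hnd _ ht (by rw [add_eq_add i]; simp [htd]) ((forall_dvd_iff i _ _).2 ⟨?_, ?_⟩)
      · rw [expo_same]; exact Nat.dvd_sub h1 h2
      · rwa [expo_other]
    · exact ht rfl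
  have hg0 : g ≠ 0 := by
    obtain ⟨n, hn, hnd'⟩ := hex
    intro h0
    have h1 := coeff_dehomogenize a i d (n (1 - i))
    rw [add_eq_add i] at hnd'
    rw [← hg, h0, Polynomial.coeff_zero, if_pos (by omega),
      show d - n (1 - i) = n i by omega, ← eq_expo] at h1
    exact hn h1.symm
  -- translation keeps the leading exponent
  have hexl : ∃ l, (Polynomial.taylor c g).coeff l ≠ 0 ∧ ¬ (p ^ e ∣ d ∧ p ^ e ∣ l) := by
    refine ⟨g.natDegree, ?_, hsupp _ (Polynomial.leadingCoeff_ne_zero.2 hg0)⟩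
    have h1 : (Polynomial.taylor c g).coeff (Polynomial.taylor c g).natDegree ≠ 0 := by
      refine Polynomial.leadingCoeff_ne_zero.2 fun h0 => hg0 ?_
      exact Polynomial.taylor_injective c (by rw [h0, map_zero])
    rwa [Polynomial.natDegree_taylor] at h1
  obtain ⟨B, hB, hBg⟩ := exists_eq_of_chart hi ho ha
  have hA' : F.A (p ^ e) = MvPowerSeries.X 0 ^ (d - p ^ e) * B := by
    refine mul_left_cancel₀ (pow_ne_zero (p ^ e) (base_X_prime (k := k) 0).ne_zero) ?_
    rw [hA, hB, ← mul_assoc, ← pow_add, Nat.add_sub_cancel' hqd.le]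
  have hdiv : ∀ l, (p ^ e ∣ d - p ^ e ∧ p ^ e ∣ l) ↔ (p ^ e ∣ d ∧ p ^ e ∣ l) := by
    intro l
    refine and_congr_left fun _ => ?_
    conv_rhs => rw [← Nat.sub_add_cancel hqd.le]
    exact (Nat.dvd_add_left (dvd_refl _)).symm
  have hrow : RowData (p ^ e) (F.A (p ^ e)) (F.slot N) (d - p ^ e) (Nat.find hexl) := by
    rw [hs, hA']
    refine ⟨X_pow_mul_mem _ _ _, ?_, ?_, fun l' hl' hne => ?_⟩
    · rw [coeff_expo_X_pow_mul, hBg, Polynomial.coeff_coe]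
      exact (Nat.find_spec hexl).1
    · rw [hdiv]; exact (Nat.find_spec hexl).2
    · rw [coeff_expo_X_pow_mul, hBg, Polynomial.coeff_coe] at hne
      rw [hdiv]
      by_contra hcon
      exact Nat.find_min hexl hl' ⟨hne, hcon⟩
  have hcast : ((d - p ^ e : ℕ) : ℚ) = d - (p : ℚ) ^ e := by
    rw [Nat.cast_sub hqd.le]; push_cast; rfl
  have hlt : ((d - p ^ e : ℕ) : ℚ) < (p : ℚ) ^ e * mu T' (.gen N) := by
    rw [hcast, hμ]; linarith
  obtain ⟨h1, h2⟩ := invH_gen_of_rowData hT' F hN hrow hlt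
  have h3 : invH p e T' (.gen N) = d / (p : ℚ) ^ e - 1 := by
    rw [h1, hcast]; field_simp
  refine ⟨h3, ?_, Nat.find hexl, ?_, (Nat.find_spec hexl).1, fun l' h4 h5 => Nat.find_min' hexl ⟨h4, h5⟩⟩
  · rw [IsBad, h3, hμ]
    have : (d : ℚ) / (p : ℚ) ^ e < mu T .pt := by rw [div_lt_iff₀ hq]; linarith
    linarith
  · rw [h2]; omega

/-- The invariants after the blow-up of the point. The number `l` is the exponent of the first term which
is not a `q`-th power in the lowest row along the exceptional divisor. -/
theorem point_step (hT : InMonomialCase p e T) (hT' : InMonomialCase p e T')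
    (htr : IsTransform T T' (maximalIdeal (Loc k))) :
    ∃ N, (∀ D ∈ T.bdry, D < N) ∧ N ∈ T'.bdry ∧ mu T' (.gen N) = mu T .pt - 1 ∧
      invH p e T' (.gen N) = invH p e T .pt - 1 ∧
      (∀ D ∈ T'.bdry, D ≠ N → D ∈ T.bdry ∧ mu T' (.gen D) = mu T (.gen D) ∧
        invH p e T' (.gen D) = invH p e T (.gen D) ∧ (IsBad p e T (.gen D) →
          (residual p e T' D : ℚ) + (p : ℚ) ^ e =
            residual p e T D + (p : ℚ) ^ e * invH p e T (.gen D))) ∧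
      (∀ D ∈ T'.bdry, D ≠ N → ∀ E ∈ T'.bdry, E ≠ N → D = E) ∧
      (IsBad p e T .pt → ∃ l : ℕ,
        (residual p e T' N : ℚ) + (p : ℚ) ^ e = (p : ℚ) ^ e * invH p e T .pt + l ∧
        (∀ D ∈ T'.bdry, D ≠ N →
          (l : ℚ) ≤ (p : ℚ) ^ e * (invHeart p e T + invH p e T (.gen D)) ∧
          ((l : ℚ) = (p : ℚ) ^ e * (invHeart p e T + invH p e T (.gen D)) →
            ∀ E ∈ T.bdry, E ≠ D → IsBad p e T (.gen E) →
              (residual p e T E : ℚ) = (p : ℚ) ^ e * invH p e T .pt)) ∧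
        (∀ D, T.bdry = {D} → D ∉ T'.bdry → (l : ℚ) ≤ (p : ℚ) ^ e * invHeart p e T) ∧
        (∀ D E, D ≠ E → T.bdry = {D, E} → D ∉ T'.bdry → E ∉ T'.bdry → 0 < invHeart p e T →
          invH p e T (.gen D) ≤ 1 → invH p e T (.gen E) ≤ 1 →
            (l : ℚ) < 2 * ((p : ℚ) ^ e * invHeart p e T))) := by
  classical
  have hp : 0 < p := expChar_pos k p
  have hq : (0 : ℚ) < (p : ℚ) ^ e := by positivity
  obtain ⟨H, hH⟩ := hT.2.some.exists_clean
  -- `dir` gives the new point as a point of the exceptional line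
  obtain ⟨N, dir, hlt, hN, hμN, hold, hdir, hdir0, hF⟩ := H.exists_point_frame hT'.1 htr
  -- the chart in which a component with visible strict transform is given by `x_(1 - i)`
  have hchart : ∀ D ∈ T'.bdry, D ≠ N → ∃ i, dir i ≠ 0 ∧ H.slot D = 1 - i ∧
      dir (1 - i) / dir i = 0 := by
    intro D hD hne
    have h0 := (hdir D (hold D hD hne).1).1 hD
    obtain ⟨i, hi⟩ := hdir0
    have hs : H.slot D = 1 - i := (eq_or_eq_one_sub i _).resolve_left fun h => hi (h ▸ h0)
    exact ⟨i, hi, hs, by rw [← hs, h0, zero_div]⟩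
  have hinvN : invH p e T' (.gen N) = invH p e T .pt - 1 := by
    obtain ⟨i, hi⟩ := hdir0
    obtain ⟨F, hs, -, σ, hσi, hσo, hA⟩ := hF i hi
    by_cases hb : IsBad p e T .pt
    · obtain ⟨d, ha, hex, hdμ, hd, hqd, hnd⟩ := Presentation.exists_degree hT hH hb
      rw [hd]
      exact (exists_exceptional_row hT' hN hμN hs hσi hσo hA ha hex hdμ hqd hnd).1
    · rw [invH_pt_eq hT hb, ← hμN]
      refine invH_gen_of_mem hT' F hN ?_
      have ha := Presentation.mem_of_not_isBad_pt hT hH hb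
      have h1 := map_mem_ordIdeal_one (θ := (σ : Base k →+* Base k)) (w := Pi.single 0 1) (c := 1)
        (fun j => by
          rw [Nat.cast_one, ← X_dvd_iff_mem]
          rcases eq_or_eq_one_sub i j with rfl | rfl
          · rw [RingHom.coe_coe, hσi]
          · rw [RingHom.coe_coe, hσo]; exact dvd_mul_right _ _) ha
      rw [hs]
      refine mem_of_X_pow_mul_mem (i := 0) (m := p ^ e) ?_
      rw [hA, hμN]
      refine ordIdeal_anti (le_of_eq ?_) h1
      simp; ring
  refine ⟨N, hlt, hN, hμN, hinvN, fun D hD hne => ?_, fun D hD hDN E hE hEN => ?_, fun hb => ?_⟩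
  · obtain ⟨hD', hμ⟩ := hold D hD hne
    obtain ⟨i, hi, hsD, hc⟩ := hchart D hD hne
    obtain ⟨F, -, hs, σ, hσi, hσo, hA⟩ := hF i hi
    rw [hc, map_zero, add_zero] at hσo
    refine ⟨hD', hμ, ?_⟩
    by_cases hbD : IsBad p e T (.gen D)
    · obtain ⟨r, l, hrow, -, hr, hinv, hres⟩ := Presentation.exists_row hT hH hD' hbD
      have hql : p ^ e ≤ r + l := by
        have h1 := H.aLast_mem hp _ hrow.coeff_ne
        rw [weight_one, add_eq_add (H.slot D), expo_same, expo_other] at h1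
        have h2 : ((p ^ e : ℕ) : ℚ) ≤ (r + l : ℕ) := by push_cast at h1 ⊢; linarith
        exact_mod_cast h2
      rw [hsD] at hrow
      have h1 := hrow.strict hσi hσo hA hql
      rw [← hs D hD hne] at h1
      obtain ⟨h2, h3⟩ := invH_gen_of_rowData hT' F hD h1 (by rw [hμ]; exact hr)
      refine ⟨h2.trans hinv.symm, fun _ => ?_⟩
      rw [h3, hres, hinv, mul_div_cancel₀ _ hq.ne', Nat.cast_add, Nat.cast_sub hql]
      push_cast; ring
    · refine ⟨?_, fun h => absurd h hbD⟩
      rw [invH_gen_eq hT hD' hbD, ← hμ]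
      refine invH_gen_of_mem hT' F hD ?_
      have h1 := Presentation.mem_of_not_isBad hT hH hD' hbD
      rw [hsD] at h1
      have h2 := map_mem_ordIdeal_single (θ := (σ : Base k →+* Base k)) (i := 1) (by
        rw [RingHom.coe_coe, hσo]; exact dvd_mul_left _ _) h1
      rw [hs D hD hne]
      refine mem_of_X_pow_mul_mem (i := 0) (m := p ^ e) ?_
      rw [hA, hμ]
      simpa using h2
  · obtain ⟨i, hi, hsD, -⟩ := hchart D hD hDN
    refine H.slot_injOn (hold D hD hDN).1 (hold E hE hEN).1 ?_
    rw [hsD]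
    exact ((eq_or_eq_one_sub i _).resolve_left fun h =>
      hi (h ▸ (hdir E (hold E hE hEN).1).1 hE)).symm
  · obtain ⟨d, ha, hex, hdμ, hd, hqd, hnd⟩ := Presentation.exists_degree hT hH hb
    have hqhP : (p : ℚ) ^ e * invH p e T .pt = d := by rw [hd]; field_simp
    have hδ : (p : ℚ) ^ e * invHeart p e T = d - (p : ℚ) ^ e * ordTight p e T := by
      rw [invHeart, mul_sub, hqhP]
    have hrow : ∀ i, dir i ≠ 0 → ∃ l : ℕ, residual p e T' N + p ^ e = d + l ∧
        (Polynomial.taylor (dir (1 - i) / dir i) (dehomogenize H.aLast i d)).coeff l ≠ 0 ∧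
        ∀ l', (Polynomial.taylor (dir (1 - i) / dir i) (dehomogenize H.aLast i d)).coeff l' ≠ 0 →
          ¬ (p ^ e ∣ d ∧ p ^ e ∣ l') → l ≤ l' := by
      intro i hi
      obtain ⟨F, hs, -, σ, hσi, hσo, hA⟩ := hF i hi
      exact (exists_exceptional_row hT' hN hμN hs hσi hσo hA ha hex hdμ hqd hnd).2.2
    -- the exponents of the lowest form
    have hterm : ∀ i t, (dehomogenize H.aLast i d).coeff t ≠ 0 →
        t ≤ d ∧ MvPowerSeries.coeff (expo i (d - t) t) H.aLast ≠ 0 ∧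
          ¬ (p ^ e ∣ d ∧ p ^ e ∣ t) := by
      intro i t ht
      rw [coeff_dehomogenize] at ht
      split_ifs at ht with htd
      · refine ⟨htd, ht, fun h => hnd _ ht (by rw [add_eq_add i]; simp [htd])
          ((forall_dvd_iff i _ _).2 ⟨?_, ?_⟩)⟩
        · rw [expo_same]; exact Nat.dvd_sub h.1 h.2
        · rw [expo_other]; exact h.2
      · exact absurd rfl ht
    have hslot : ∀ D ∈ T.bdry, ∀ n, MvPowerSeries.coeff n H.aLast ≠ 0 →
        (p : ℚ) ^ e * invH p e T (.gen D) ≤ n (H.slot D) := by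
      intro D hD n hn
      have := Presentation.aLast_mem_gen hT hH hD n hn
      rwa [weight_single] at this
    have hg0 : ∀ i, dehomogenize H.aLast i d ≠ 0 := by
      intro i h0
      obtain ⟨n, hn, hnd'⟩ := hex
      have h1 := coeff_dehomogenize H.aLast i d (n (1 - i))
      rw [add_eq_add i] at hnd'
      rw [h0, Polynomial.coeff_zero, if_pos (by omega),
        show d - n (1 - i) = n i by omega, ← eq_expo] at h1
      exact hn h1.symm
    obtain ⟨l, hl⟩ : ∃ l : ℕ, residual p e T' N + p ^ e = d + l := by
      obtain ⟨i, hi⟩ := hdir0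
      obtain ⟨l, hl, -⟩ := hrow i hi
      exact ⟨l, hl⟩
    refine ⟨l, by rw [hqhP]; exact_mod_cast hl, fun D hD hne => ?_, fun D hbd hD => ?_,
      fun D E hDE hbd hD hE hpos hDle hEle => ?_⟩
    · obtain ⟨hD', -⟩ := hold D hD hne
      obtain ⟨i, hi, hsD, hc⟩ := hchart D hD hne
      obtain ⟨l', hl', hlne, -⟩ := hrow i hi
      obtain rfl : l = l' := by omega
      rw [hc, Polynomial.taylor_zero] at hlne
      obtain ⟨hld, hcoef, -⟩ := hterm i l hlne
      -- all other components contain the exponent `d - l`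
      have hother : ∀ E ∈ T.bdry, E ≠ D → H.slot E = i := fun E hE hED =>
        (eq_or_eq_one_sub i _).resolve_right fun h => hED (H.slot_injOn hE hD' (h.trans hsD.symm))
      have hexp : ∀ E ∈ T.bdry, E ≠ D → (p : ℚ) ^ e * invH p e T (.gen E) ≤ (d - l : ℕ) := by
        intro E hE hED
        have := hslot E hE _ hcoef
        rwa [hother E hE hED, expo_same] at this
      have hcard : (T.bdry.erase D).card ≤ 1 := by
        rw [Finset.card_erase_of_mem hD']
        have := H.card_le
        omega
      have htight : ordTight p e T = invH p e T (.gen D) +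
          ∑ E ∈ T.bdry.erase D, invH p e T (.gen E) :=
        (Finset.add_sum_erase _ _ hD').symm
      have hcastdl : ((d - l : ℕ) : ℚ) = d - l := Nat.cast_sub hld
      rcases Nat.le_one_iff_eq_zero_or_eq_one.1 hcard with h0 | h1
      · rw [Finset.card_eq_zero] at h0
        rw [h0, Finset.sum_empty, add_zero] at htight
        refine ⟨?_, fun _ E hE hED => ?_⟩
        · rw [mul_add, hδ, htight, sub_add_cancel]
          exact_mod_cast hld
        · have : E ∈ T.bdry.erase D := Finset.mem_erase.2 ⟨hED, hE⟩
          rw [h0] at this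
          simp at this
      · obtain ⟨E, hE⟩ := Finset.card_eq_one.1 h1
        rw [hE, Finset.sum_singleton] at htight
        have hEm := Finset.mem_erase.1 (hE ▸ Finset.mem_singleton_self E)
        have h2 := hexp E hEm.2 hEm.1
        rw [hcastdl] at h2
        have h3 : (p : ℚ) ^ e * (invHeart p e T + invH p e T (.gen D)) =
            d - (p : ℚ) ^ e * invH p e T (.gen E) := by
          rw [mul_add, hδ, htight]; ring
        refine ⟨by rw [h3]; linarith, fun heq E' hE' hE'D hbE => ?_⟩
        have h4 : E' = E := by
          have : E' ∈ T.bdry.erase D := Finset.mem_erase.2 ⟨hE'D, hE'⟩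
          rwa [hE, Finset.mem_singleton] at this
        subst h4
        obtain ⟨r', l'', hrow', hzero, -, hinv, hres⟩ := Presentation.exists_row hT hH hE' hbE
        rw [h3, hinv, mul_div_cancel₀ _ hq.ne'] at heq
        have h5 : d = r' + l := by
          have : (d : ℚ) = r' + l := by linarith
          exact_mod_cast this
        have h6 : l'' ≤ l := by
          by_contra hcon
          refine hcoef ?_
          have := hzero l (not_le.1 hcon)
          rwa [hother E' hE' hE'D, show r' = d - l by omega] at this
        have h7 := ha _ hrow'.coeff_ne
        rw [weight_one, add_eq_add (H.slot E'), expo_same, expo_other, Nat.cast_le] at h7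
        rw [hres, hqhP]
        exact_mod_cast (by omega : r' + l'' = d)
    -- for a single component, the leading exponent of the lowest form bounds `l`
    · have hD' : D ∈ T.bdry := by rw [hbd]; exact Finset.mem_singleton_self _
      have hi : dir (H.slot D) ≠ 0 := fun h => hD ((hdir D hD').2 h)
      obtain ⟨l', hl', -, hmin⟩ := hrow _ hi
      obtain rfl : l = l' := by omega
      set g := dehomogenize H.aLast (H.slot D) d with hg
      have hlead := hterm (H.slot D) _ (Polynomial.leadingCoeff_ne_zero.2 (hg0 (H.slot D)))
      have h1 := hmin g.natDegree (by
        have h2 : (Polynomial.taylor (dir (1 - H.slot D) / dir (H.slot D)) g).leadingCoeff ≠ 0 := by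
          rw [Polynomial.leadingCoeff_taylor]
          exact Polynomial.leadingCoeff_ne_zero.2 (hg0 _)
        rwa [Polynomial.leadingCoeff, Polynomial.natDegree_taylor] at h2) hlead.2.2
      have h2 := hslot D hD' _ hlead.2.1
      rw [expo_same, Nat.cast_sub hlead.1] at h2
      have h3 : (l : ℚ) ≤ g.natDegree := by exact_mod_cast h1
      have h4 : ordTight p e T = invH p e T (.gen D) := by
        rw [ordTight, hbd, Finset.sum_singleton]
      rw [hδ, h4]
      linarith
    · have hD' : D ∈ T.bdry := by rw [hbd]; simp
      have hE' : E ∈ T.bdry := by rw [hbd]; simp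
      have hi : dir (H.slot D) ≠ 0 := fun h => hD ((hdir D hD').2 h)
      have hsE : H.slot E = 1 - H.slot D := (eq_or_eq_one_sub _ _).resolve_left fun h =>
        hDE (H.slot_injOn hE' hD' h).symm
      have hiE : dir (1 - H.slot D) ≠ 0 := fun h => hE ((hdir E hE').2 (hsE ▸ h))
      obtain ⟨l', hl', -, hmin⟩ := hrow _ hi
      obtain rfl : l = l' := by omega
      have htight : ordTight p e T = invH p e T (.gen D) + invH p e T (.gen E) := by
        rw [ordTight, hbd, Finset.sum_pair hDE]
      have hδ' : (p : ℚ) ^ e * invHeart p e T =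
          d - (p : ℚ) ^ e * invH p e T (.gen D) - (p : ℚ) ^ e * invH p e T (.gen E) := by
        rw [hδ, htight]; ring
      obtain ⟨l₁, h1, h2, h3⟩ := exists_taylor_coeff_lt (p := p) (e := e) (d := d) (hg0 (H.slot D))
        (div_ne_zero hiE hi) (R := (p : ℚ) ^ e * invH p e T (.gen D))
        (S := (p : ℚ) ^ e * invH p e T (.gen E)) (mul_le_of_le_one_right hq.le hDle)
        (mul_le_of_le_one_right hq.le hEle) (by rw [← hδ']; positivity) hqd
        (fun t ht => by
          have h4 := hterm _ t ht
          have := hslot E hE' _ h4.2.1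
          rwa [hsE, expo_other] at this)
        (fun t ht => by
          have h4 := hterm _ t ht
          have := hslot D hD' _ h4.2.1
          rw [expo_same, Nat.cast_sub h4.1] at this
          linarith)
        (fun t ht => (hterm _ t ht).2.2)
      have h4 : (l : ℚ) ≤ l₁ := by exact_mod_cast hmin l₁ h1 h2
      rw [hδ']
      linarith

end PointStep

/-! ### The invariants after the blow-up of a curve -/

section DivideRow

variable {k : Type*} [Field k] {q r l : ℕ} {A : Base k} {i : Fin 2}

theorem le_of_coeff_X_pow_mul_ne {j : Fin 2} {n : Fin 2 →₀ ℕ}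
    (h : MvPowerSeries.coeff n (MvPowerSeries.X j ^ q * A) ≠ 0) : q ≤ n j := by
  have := X_pow_mul_mem j q A n h
  rwa [weight_single, Nat.cast_le] at this

theorem coeff_add_left_X_pow_mul (i : Fin 2) (q r l : ℕ) (A : Base k) :
    MvPowerSeries.coeff (expo i (q + r) l) (MvPowerSeries.X i ^ q * A) =
      MvPowerSeries.coeff (expo i r l) A := by
  rw [← coeff_X_pow_mul i q A (expo i r l), expo, expo, Finsupp.single_add, add_assoc]

theorem coeff_add_right_X_pow_mul (i : Fin 2) (q r l : ℕ) (A : Base k) :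
    MvPowerSeries.coeff (expo i r (q + l)) (MvPowerSeries.X (1 - i) ^ q * A) =
      MvPowerSeries.coeff (expo i r l) A := by
  rw [← expo_swap, ← expo_swap i r l, coeff_add_left_X_pow_mul]

theorem RowData.of_X_pow_mul_same (h : RowData q (MvPowerSeries.X i ^ q * A) i r l) :
    q ≤ r ∧ RowData q A i (r - q) l := by
  have hr : q ≤ r := by simpa using le_of_coeff_X_pow_mul_ne h.coeff_ne
  obtain ⟨r, rfl⟩ := Nat.exists_eq_add_of_le hr
  obtain ⟨hmem, hne, hnd, hd⟩ := h
  rw [Nat.add_sub_cancel_left]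
  simp only [coeff_add_left_X_pow_mul, Nat.dvd_add_right dvd_rfl] at hne hnd hd
  refine ⟨hr, fun n hn => ?_, hne, hnd, hd⟩
  have h1 := hmem (Finsupp.single i q + n) (by rwa [coeff_X_pow_mul])
  rw [weight_single, Nat.cast_le] at h1 ⊢
  simpa using h1

theorem RowData.of_X_pow_mul_other (h : RowData q (MvPowerSeries.X (1 - i) ^ q * A) i r l) :
    q ≤ l ∧ RowData q A i r (l - q) := by
  have hl : q ≤ l := by simpa using le_of_coeff_X_pow_mul_ne h.coeff_ne
  obtain ⟨l, rfl⟩ := Nat.exists_eq_add_of_le hl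
  obtain ⟨hmem, hne, hnd, hd⟩ := h
  rw [Nat.add_sub_cancel_left]
  rw [coeff_add_right_X_pow_mul] at hne
  rw [Nat.dvd_add_right dvd_rfl] at hnd
  refine ⟨hl, fun n hn => ?_, hne, hnd, fun l' hl' hne' => ?_⟩
  · have h1 := hmem (Finsupp.single (1 - i) q + n) (by rwa [coeff_X_pow_mul])
    rw [weight_single, Nat.cast_le] at h1 ⊢
    simpa [(one_sub_ne i)] using h1
  · have h1 := hd (q + l') (by omega) (by rwa [coeff_add_right_X_pow_mul])
    rwa [Nat.dvd_add_right dvd_rfl] at h1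

theorem mem_ordIdeal_of_X_pow_mul_same {s : ℚ}
    (h : MvPowerSeries.X i ^ q * A ∈ ordIdeal k (Pi.single i 1) s) :
    A ∈ ordIdeal k (Pi.single i 1) (s - q) := by
  intro n hn
  have h1 := h (Finsupp.single i q + n) (by rwa [coeff_X_pow_mul])
  rw [weight_single] at h1 ⊢
  simp only [Finsupp.add_apply, Finsupp.single_eq_same] at h1
  push_cast at h1
  linarith

theorem mem_ordIdeal_of_X_pow_mul_other {s : ℚ}
    (h : MvPowerSeries.X (1 - i) ^ q * A ∈ ordIdeal k (Pi.single i 1) s) :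
    A ∈ ordIdeal k (Pi.single i 1) s := by
  intro n hn
  have h1 := h (Finsupp.single (1 - i) q + n) (by rwa [coeff_X_pow_mul])
  rw [weight_single] at h1 ⊢
  simpa [one_sub_ne i] using h1

end DivideRow

section Congr

variable {k : Type*} [Field k] {p e : ℕ} {T T' : Triplet k}

theorem invSpade_congr {f : ℕ → ℕ} (hf : Set.InjOn f (T.bdry : Set ℕ))
    (himg : T'.bdry = T.bdry.image f)
    (hbad : ∀ D ∈ T.bdry, IsBad p e T' (.gen (f D)) ↔ IsBad p e T (.gen D))
    (hrho : ∀ D ∈ badDivisors p e T, wRho p e T' (f D) = wRho p e T D)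
    (hB : wordB p e T' = wordB p e T) : invSpade p e T' = invSpade p e T := by
  classical
  have hmem : ∀ D, D ∈ badDivisors p e T' ↔ ∃ E ∈ badDivisors p e T, f E = D := by
    intro D
    rw [mem_badDivisors, himg, Finset.mem_image]
    constructor
    · rintro ⟨⟨E, hE, rfl⟩, hb⟩
      exact ⟨E, mem_badDivisors.2 ⟨hE, (hbad E hE).1 hb⟩, rfl⟩
    · rintro ⟨E, hE, rfl⟩
      rw [mem_badDivisors] at hE
      exact ⟨⟨E, hE.1, rfl⟩, (hbad E hE.1).2 hE.2⟩
  have himg' : badDivisors p e T' = (badDivisors p e T).image f := by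
    ext D; rw [hmem, Finset.mem_image]
  have hinj : Set.InjOn f (badDivisors p e T : Set ℕ) :=
    hf.mono fun D hD => (mem_badDivisors.1 hD).1
  have hA : wordA p e T' = wordA p e T := by
    rw [wordA, wordA]
    refine if_congr (or_congr (by rw [himg', Finset.image_eq_empty]) ⟨?_, ?_⟩) rfl ?_
    · rintro ⟨D, hD, h0⟩
      obtain ⟨E, hE, rfl⟩ := (hmem D).1 hD
      exact ⟨E, hE, by rw [← hrho E hE]; exact h0⟩
    · rintro ⟨E, hE, h0⟩
      exact ⟨f E, (hmem _).2 ⟨E, hE, rfl⟩, by rw [hrho E hE]; exact h0⟩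
    · congr 1
      rw [himg', Finset.image_val_of_injOn hinj, Multiset.map_map]
      exact Multiset.map_congr rfl fun D hD => hrho D hD
  rw [invSpade, invSpade, hA, hB]

end Congr

section CurveStep

variable {k : Type*} [Field k] [IsAlgClosed k] {p e : ℕ} [ExpChar k p] {T T' : Triplet k}

/-- For a well-adapted presentation, either the component is good and `a_q` is divisible by the power of
`x_D` prescribed by `μ`, or the component is bad and the invariants are read off from its lowest row. -/
theorem Presentation.WellAdapted.mem_or_rowData {H : Presentation p e T}
    (hT : InMonomialCase p e T) {D : ℕ} (hD : D ∈ T.bdry) (hw : H.WellAdapted (.gen D)) :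
    (invH p e T (.gen D) = mu T (.gen D) ∧
        H.aLast ∈ ordIdeal k (Pi.single (H.slot D) 1) ((p : ℚ) ^ e * mu T (.gen D))) ∨
      ∃ r l : ℕ, RowData (p ^ e) H.aLast (H.slot D) r l ∧ (r : ℚ) < (p : ℚ) ^ e * mu T (.gen D) ∧
        invH p e T (.gen D) = r / (p : ℚ) ^ e ∧ residual p e T D = r + l := by
  have hp : 0 < p := expChar_pos k p
  by_cases h : H.aLast ∈ ordIdeal k (Pi.single (H.slot D) 1) ((p : ℚ) ^ e * mu T (.gen D))
  · exact Or.inl ⟨Presentation.invH_of_mem hT hD h, h⟩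
  · obtain ⟨r, l, hrow, hr, -, -⟩ := hw.rowData h
    have h1 := invH_gen_of_rowData hT (H.toFrame hp) hD (by rw [H.toFrame_last]; exact hrow) hr
    exact Or.inr ⟨r, l, hrow, hr, h1⟩

/-- The blow-up of the curve `z = x_D = 0`, with exceptional divisor `N`. -/
theorem curve_step (hT : InMonomialCase p e T) (hT' : InMonomialCase p e T') {c : Ideal (Loc k)}
    (hc : IsCurveCenter p e T c) (htr : IsTransform T T' c) :
    ∃ D ∈ T.bdry, ∃ N, N ∉ T.bdry ∧ T'.bdry = insert N (T.bdry.erase D) ∧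
      mu T' (.gen N) = mu T (.gen D) - 1 ∧ invH p e T' (.gen N) = invH p e T (.gen D) - 1 ∧
      (IsBad p e T (.gen D) → (residual p e T' N : ℚ) + (p : ℚ) ^ e = residual p e T D) ∧
      ∀ E ∈ T.bdry, E ≠ D → mu T' (.gen E) = mu T (.gen E) ∧
        invH p e T' (.gen E) = invH p e T (.gen E) ∧
        (IsBad p e T (.gen E) → (residual p e T' E : ℚ) + (p : ℚ) ^ e = residual p e T E) := by
  have hp : 0 < p := expChar_pos k p
  have hq : (0 : ℚ) < (p : ℚ) ^ e := by positivity
  obtain ⟨H, hw, D, hD, rfl, hsing, -⟩ := hc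
  obtain ⟨N, hN, hbdry, hμN, hμE, F, hFN, hFE, hA⟩ := H.exists_curve_frame hT'.1 hD hsing htr
  have hNT : N ∉ T.bdry := fun h => lt_irrefl _ (hN N h)
  refine ⟨D, hD, N, hNT, hbdry, hμN, ?_⟩
  have hNT' : N ∈ T'.bdry := by rw [hbdry]; exact Finset.mem_insert_self _ _
  -- both `a_q` and the new last coefficient are described by the same rows, shifted by `q`
  refine and_assoc.1 ⟨?_, fun E hE hED => ⟨hμE E hE hED, ?_⟩⟩
  · rcases (hw.2 D hD).mem_or_rowData hT hD with ⟨hI, hmem⟩ | ⟨r, l, hrow, hr, hI, hres⟩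
    · rw [← hA] at hmem
      have h1 := mem_ordIdeal_of_X_pow_mul_same hmem
      have h2 := invH_gen_of_mem hT' F hNT' (by
        rw [hFN, hμN]; refine ordIdeal_anti (le_of_eq ?_) h1; push_cast; ring)
      exact ⟨by rw [h2, hI, hμN], fun hb => absurd hI hb.ne⟩
    · rw [← hA] at hrow
      obtain ⟨hqr, hrow'⟩ := hrow.of_X_pow_mul_same
      have hcast : ((r - p ^ e : ℕ) : ℚ) = r - (p : ℚ) ^ e := by
        rw [Nat.cast_sub hqr]; push_cast; rfl
      obtain ⟨h1, h2⟩ := invH_gen_of_rowData hT' F hNT' (by rw [hFN]; exact hrow') (by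
        rw [hcast, hμN]; linarith)
      refine ⟨?_, fun _ => ?_⟩
      · rw [h1, hI, hcast]; field_simp
      · rw [h2, hres]; push_cast; rw [hcast]; ring
  · have hET' : E ∈ T'.bdry := by
      rw [hbdry]; exact Finset.mem_insert_of_mem (Finset.mem_erase.2 ⟨hED, hE⟩)
    have hslot : H.slot D = 1 - H.slot E := by
      rcases eq_or_eq_one_sub (H.slot E) (H.slot D) with h | h
      · exact absurd (H.slot_injOn hE hD h.symm) hED
      · exact h
    rw [hslot] at hA
    rcases (hw.2 E hE).mem_or_rowData hT hE with ⟨hI, hmem⟩ | ⟨r, l, hrow, hr, hI, hres⟩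
    · rw [← hA] at hmem
      have h2 := invH_gen_of_mem hT' F hET' (by
        rw [hFE E hE, hμE E hE hED]; exact mem_ordIdeal_of_X_pow_mul_other hmem)
      exact ⟨by rw [h2, hI, hμE E hE hED], fun hb => absurd hI hb.ne⟩
    · rw [← hA] at hrow
      obtain ⟨hql, hrow'⟩ := hrow.of_X_pow_mul_other
      obtain ⟨h1, h2⟩ := invH_gen_of_rowData hT' F hET' (by rw [hFE E hE]; exact hrow') (by
        rw [hμE E hE hED]; exact hr)
      refine ⟨by rw [h1, hI], fun _ => ?_⟩
      rw [h2, hres]; push_cast; rw [Nat.cast_sub hql]; push_cast; ring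

/-- The blow-up of a curve changes neither `inv_♠` nor the number of components. -/
theorem curve_step_invariants (hT : InMonomialCase p e T) (hT' : InMonomialCase p e T')
    {c : Ideal (Loc k)} (hc : IsCurveCenter p e T c) (htr : IsTransform T T' c) :
    invSpade p e T' = invSpade p e T ∧ ∃ f : ℕ → ℕ, Set.InjOn f (T.bdry : Set ℕ) ∧
      T'.bdry = T.bdry.image f ∧
      ∀ D ∈ T.bdry, (IsBad p e T' (.gen (f D)) ↔ IsBad p e T (.gen D)) ∧
        (IsBad p e T (.gen D) → wRho p e T' (f D) = wRho p e T D) := by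
  classical
  have hq : (0 : ℚ) < (p : ℚ) ^ e := by have := expChar_pos k p; positivity
  obtain ⟨D, hD, N, hN, hbdry, hμN, hIN, hresN, hE⟩ := curve_step hT hT' hc htr
  have hNe : N ∉ T.bdry.erase D := fun h => hN (Finset.mem_of_mem_erase h)
  have htight : ordTight p e T' = ordTight p e T - 1 := by
    rw [ordTight, ordTight, hbdry, Finset.sum_insert hNe, ← Finset.add_sum_erase _ _ hD, hIN,
      Finset.sum_congr rfl fun E hE' => (hE E (Finset.mem_of_mem_erase hE')
        (Finset.ne_of_mem_erase hE')).2.1]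
    ring
  have hμ : mu T' .pt = mu T .pt - 1 := by
    rw [mu_pt, mu_pt, hbdry, Finset.sum_insert hNe, ← Finset.add_sum_erase _ _ hD, hμN,
      Finset.sum_congr rfl fun E hE' => (hE E (Finset.mem_of_mem_erase hE')
        (Finset.ne_of_mem_erase hE')).1]
    ring
  -- the residual orders drop by `q` and `M_tight` drops by one, which cancels
  have hrho : ∀ E E', (residual p e T' E' : ℚ) + (p : ℚ) ^ e = residual p e T E →
      wRho p e T' E' = wRho p e T E := by
    intro E E' h
    rw [wRho, wRho, ← h, htight, add_div, div_self hq.ne']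
    ring
  let f : ℕ → ℕ := fun E => if E = D then N else E
  have hfD : f D = N := if_pos rfl
  have hfE : ∀ {E}, E ≠ D → f E = E := fun h => if_neg h
  have hf : Set.InjOn f (T.bdry : Set ℕ) := by
    intro E hE E' hE' h
    by_cases h1 : E = D <;> by_cases h2 : E' = D
    · rw [h1, h2]
    · rw [h1, hfD, hfE h2] at h
      exact absurd hE' (h ▸ hN)
    · rw [h2, hfD, hfE h1] at h
      exact absurd hE (h ▸ hN)
    · rwa [hfE h1, hfE h2] at h
  have himg : T'.bdry = T.bdry.image f := by
    rw [hbdry]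
    ext E
    simp only [Finset.mem_insert, Finset.mem_erase, Finset.mem_image]
    constructor
    · rintro (rfl | ⟨h1, h2⟩)
      · exact ⟨D, hD, hfD⟩
      · exact ⟨E, h2, hfE h1⟩
    · rintro ⟨E', hE', rfl⟩
      by_cases h1 : E' = D
      · left; rw [h1, hfD]
      · right; rw [hfE h1]; exact ⟨h1, hE'⟩
  have hall : ∀ E ∈ T.bdry, (IsBad p e T' (.gen (f E)) ↔ IsBad p e T (.gen E)) ∧
      (IsBad p e T (.gen E) → wRho p e T' (f E) = wRho p e T E) := by
    intro E hE'
    by_cases h1 : E = D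
    · subst h1
      rw [hfD, IsBad, IsBad, hIN, hμN, sub_lt_sub_iff_right]
      exact ⟨Iff.rfl, fun hb => hrho _ _ (hresN hb)⟩
    · obtain ⟨h2, h3, h4⟩ := hE E hE' h1
      rw [hfE h1, IsBad, IsBad, h2, h3]
      exact ⟨Iff.rfl, fun hb => hrho _ _ (h4 hb)⟩
  refine ⟨invSpade_congr hf himg (fun E hE' => (hall E hE').1) (fun E hE' => ?_) ?_,
    f, hf, himg, hall⟩
  · rw [mem_badDivisors] at hE'
    exact (hall E hE'.1).2 hE'.2
  · rw [wordB, wordB, htight, hμ, sub_sub_sub_cancel_right]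

end CurveStep

/-! ### The words before and after the blow-up of a point -/

section PointStep

variable {k : Type*} [Field k] [IsAlgClosed k] {p e : ℕ} [ExpChar k p] {T T' : Triplet k}

/-- The blow-up of a point, with exceptional divisor `N`, when no old component passes through the new
point and when one of them, `D`, does. -/
theorem point_step_cases (hT : InMonomialCase p e T) (hT' : InMonomialCase p e T')
    (htr : IsTransform T T' (maximalIdeal (Loc k))) :
    ∃ N, (IsBad p e T' (.gen N) ↔ IsBad p e T .pt) ∧
      ((T'.bdry = {N} ∧ (IsBad p e T .pt →
          (∀ D, T.bdry = {D} → wRho p e T' N ≤ invHeart p e T) ∧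
          (singDim T ≠ 1 → 0 < invHeart p e T → T.bdry.card = 2 →
            wRho p e T' N < 2 * invHeart p e T))) ∨
        ∃ D ∈ T.bdry, D ≠ N ∧ T'.bdry = {N, D} ∧
          (IsBad p e T' (.gen D) ↔ IsBad p e T (.gen D)) ∧
          (IsBad p e T (.gen D) → wRho p e T' D = wRho p e T D - invHeart p e T) ∧
          mu T' .pt - ordTight p e T' =
            (mu T .pt - invH p e T .pt) + (mu T (.gen D) - invH p e T (.gen D)) ∧
          (IsBad p e T .pt → wRho p e T' N ≤ invHeart p e T ∧
            (wRho p e T' N = invHeart p e T → ∀ E ∈ T.bdry, E ≠ D → IsBad p e T (.gen E) →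
              wRho p e T E = invHeart p e T))) := by
  have hq : (0 : ℚ) < (p : ℚ) ^ e := by have := expChar_pos k p; positivity
  obtain ⟨N, hlt, hN, hμN, hIN, hold, huniq, hbad⟩ := point_step hT hT' htr
  have hrhoN : ∀ l : ℕ, (residual p e T' N : ℚ) + (p : ℚ) ^ e =
      (p : ℚ) ^ e * invH p e T .pt + l →
      wRho p e T' N = invH p e T .pt - 1 + l / (p : ℚ) ^ e - ordTight p e T' := by
    intro l hl
    rw [wRho, eq_sub_of_add_eq hl]
    field_simp
    ring
  refine ⟨N, by rw [IsBad, IsBad, hIN, hμN, sub_lt_sub_iff_right], ?_⟩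
  -- at most one old component passes through the new point
  by_cases hD : ∃ D ∈ T'.bdry, D ≠ N
  · right
    obtain ⟨D, hD, hDN⟩ := hD
    obtain ⟨hDT, hμD, hID, hresD⟩ := hold D hD hDN
    have hbdry : T'.bdry = {N, D} := by
      ext E
      rw [Finset.mem_insert, Finset.mem_singleton]
      constructor
      · intro hE
        by_cases hEN : E = N
        · exact Or.inl hEN
        · exact Or.inr (huniq E hE hEN D hD hDN)
      · rintro (rfl | rfl) <;> assumption
    have htight : ordTight p e T' = invH p e T .pt - 1 + invH p e T (.gen D) := by
      rw [ordTight, hbdry, Finset.sum_pair hDN.symm, hIN, hID]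
    refine ⟨D, hDT, hDN, hbdry, by rw [IsBad, IsBad, hμD, hID], fun hb => ?_, ?_, fun hb => ?_⟩
    · rw [wRho, eq_sub_of_add_eq (hresD hb), htight, wRho, invHeart]
      field_simp
      ring
    · rw [htight, mu_pt, hbdry, Finset.sum_pair hDN.symm, hμN, hμD]
      ring
    · obtain ⟨l, hl, hlD, -⟩ := hbad hb
      obtain ⟨hle, heq⟩ := hlD D hD hDN
      rw [hrhoN l hl, htight]
      have hform : invH p e T .pt - 1 + (l : ℚ) / (p : ℚ) ^ e -
          (invH p e T .pt - 1 + invH p e T (.gen D)) =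
          (l : ℚ) / (p : ℚ) ^ e - invH p e T (.gen D) := by ring
      rw [hform, sub_le_iff_le_add, div_le_iff₀ hq, sub_eq_iff_eq_add, div_eq_iff hq.ne', mul_comm]
      refine ⟨hle, fun h E hE hED hbE => ?_⟩
      rw [wRho, heq h E hE hED hbE, invHeart, mul_div_cancel_left₀ _ hq.ne']
  · left
    push Not at hD
    have hbdry : T'.bdry = {N} := Finset.eq_singleton_iff_unique_mem.2 ⟨hN, hD⟩
    have hnot : ∀ D ∈ T.bdry, D ∉ T'.bdry := fun D hD' h => (hlt D hD').ne (hD D h)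
    have htight : ordTight p e T' = invH p e T .pt - 1 := by
      rw [ordTight, hbdry, Finset.sum_singleton, hIN]
    refine ⟨hbdry, fun hb => ?_⟩
    obtain ⟨l, hl, -, h1, h2⟩ := hbad hb
    rw [hrhoN l hl, htight, add_sub_cancel_left]
    refine ⟨fun D hD' => ?_, fun hs hpos hcard => ?_⟩
    · rw [div_le_iff₀ hq, mul_comm]
      exact h1 D hD' (hnot D (by rw [hD']; exact Finset.mem_singleton_self _))
    · obtain ⟨D, E, hDE, hD'⟩ := Finset.card_eq_two.1 hcard
      have hDT : D ∈ T.bdry := by rw [hD']; simp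
      have hET : E ∈ T.bdry := by rw [hD']; simp
      rw [div_lt_iff₀ hq]
      have := h2 D E hDE hD' (hnot D hDT) (hnot E hET) hpos
        (not_lt.1 fun h => hs (singDim_eq_one hT hDT h))
        (not_lt.1 fun h => hs (singDim_eq_one hT hET h))
      linarith

end PointStep

section Words

variable {k : Type*} [Field k] {p e : ℕ} {T : Triplet k}

theorem ne_zero_words (h : invSpade p e T ≠ zeroPair) :
    wordA p e T ≠ [0] ∧ wordB p e T ≠ [0] := by
  rw [← not_or]
  exact fun hcon => h (by rw [invSpade, if_pos hcon])

theorem invSpade_eq (h : invSpade p e T ≠ zeroPair) :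
    invSpade p e T = toLex (min (wordA p e T) (wordB p e T), max (wordA p e T) (wordB p e T)) := by
  obtain ⟨h1, h2⟩ := ne_zero_words h
  rw [invSpade, if_neg (not_or.2 ⟨h1, h2⟩)]

theorem wordA_eq (h : wordA p e T ≠ [0]) :
    wordA p e T = ((badDivisors p e T).val.map (wRho p e T)).sort := by
  by_cases hc : badDivisors p e T = ∅ ∨ ∃ D ∈ badDivisors p e T, wRho p e T D = 0
  · exact absurd (by rw [wordA, if_pos hc]) h
  · rw [wordA, if_neg hc]

theorem wordA_singleton {D : ℕ} (hD : badDivisors p e T = {D}) (h : wordA p e T ≠ [0]) :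
    wordA p e T = [wRho p e T D] := by
  rw [wordA_eq h, hD]
  simp

theorem wordA_pair {D E : ℕ} (hDE : D ≠ E) (hD : badDivisors p e T = {D, E})
    (h : wordA p e T ≠ [0]) (hle : wRho p e T D ≤ wRho p e T E) :
    wordA p e T = [wRho p e T D, wRho p e T E] := by
  rw [wordA_eq h, hD, Finset.insert_val_of_notMem (by simpa using hDE), Multiset.map_cons,
    Multiset.sort_cons]
  · simp
  · simpa using hle

theorem wordA_lt {D : ℕ} (hD : D ∈ badDivisors p e T) (h : wordA p e T ≠ [0]) {δ : ℚ}
    (hδ : wRho p e T D < δ) : wordA p e T < [δ] := by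
  rw [wordA_eq h]
  have hmem : wRho p e T D ∈ ((badDivisors p e T).val.map (wRho p e T)).sort := by
    rw [Multiset.mem_sort]
    exact Multiset.mem_map_of_mem _ hD
  have hs := Multiset.pairwise_sort ((badDivisors p e T).val.map (wRho p e T)) (· ≤ ·)
  cases hl : ((badDivisors p e T).val.map (wRho p e T)).sort with
  | nil => rw [hl] at hmem; simp at hmem
  | cons a t =>
    rw [hl] at hmem hs
    rw [List.cons_lt_cons_iff]
    left
    rcases List.mem_cons.1 hmem with h1 | h1
    · rwa [← h1]
    · exact (List.rel_of_pairwise_cons hs h1).trans_lt hδ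

theorem singleton_le_wordA (hne : (badDivisors p e T).Nonempty) (h : wordA p e T ≠ [0]) {δ : ℚ}
    (hδ : ∀ D ∈ badDivisors p e T, δ ≤ wRho p e T D) : [δ] ≤ wordA p e T := by
  rw [wordA_eq h]
  cases hl : ((badDivisors p e T).val.map (wRho p e T)).sort with
  | nil =>
    obtain ⟨D, hD⟩ := hne
    have hmem : wRho p e T D ∈ ((badDivisors p e T).val.map (wRho p e T)).sort := by
      rw [Multiset.mem_sort]
      exact Multiset.mem_map_of_mem _ hD
    rw [hl] at hmem
    simp at hmem
  | cons a t =>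
    have hmem : a ∈ ((badDivisors p e T).val.map (wRho p e T)).sort := by rw [hl]; simp
    rw [Multiset.mem_sort] at hmem
    obtain ⟨D, hD, rfl⟩ := Multiset.mem_map.1 hmem
    rw [← not_lt, List.cons_lt_cons_iff]
    rintro (h1 | ⟨-, h1⟩)
    · exact absurd h1 (not_lt.2 (hδ D hD))
    · exact List.not_lt_nil _ h1

theorem singleton_lt_singleton {a b : ℚ} : [a] < [b] ↔ a < b := by
  rw [List.cons_lt_cons_iff]
  simp

theorem singleton_le_singleton {a b : ℚ} : [a] ≤ [b] ↔ a ≤ b := by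
  rw [← not_lt, singleton_lt_singleton, not_lt]

/-- A letter smaller than `δ` makes `inv_♠` smaller than `δ`. -/
theorem pairLtWord_of_lt {δ : ℚ} (hδ : 0 < δ)
    (h : (∃ D ∈ badDivisors p e T, wRho p e T D < δ) ∨ mu T .pt - ordTight p e T < δ) :
    PairLtWord (invSpade p e T) [δ] := by
  rw [PairLtWord]
  by_cases h0 : invSpade p e T = zeroPair
  · rw [h0]
    exact singleton_lt_singleton.2 hδ
  · rw [invSpade_eq h0]
    obtain ⟨hA, -⟩ := ne_zero_words h0
    refine min_lt_iff.2 (h.imp ?_ fun h => singleton_lt_singleton.2 h)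
    rintro ⟨D, hD, h⟩
    exact wordA_lt hD hA h

theorem lt_of_fst_lt {S S' : WordPair} (h : (ofLex S).1 < (ofLex S').1) : S < S' :=
  (Prod.Lex.lt_iff).2 (Or.inl h)

variable [IsAlgClosed k] [ExpChar k p]

/-- Both words are bounded below by `inv_♡`. -/
theorem invHeart_le_words (hT : InMonomialCase p e T) (h : invSpade p e T ≠ zeroPair) :
    [invHeart p e T] ≤ wordA p e T ∧ [invHeart p e T] ≤ wordB p e T := by
  obtain ⟨-, hne, -, -⟩ := invHeart_pos hT h
  obtain ⟨hA, -⟩ := ne_zero_words h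
  refine ⟨singleton_le_wordA hne hA fun D hD => invHeart_le_wRho hT hD, ?_⟩
  rw [wordB, singleton_le_singleton, invHeart]
  linarith [invH_pt_le hT]

theorem invHeart_le_fst (hT : InMonomialCase p e T) (h : invSpade p e T ≠ zeroPair) :
    [invHeart p e T] ≤ (ofLex (invSpade p e T)).1 := by
  obtain ⟨h1, h2⟩ := invHeart_le_words hT h
  rw [invSpade_eq h]
  exact le_min h1 h2

end Words

/-! ### Jumps -/

section Jump

variable {k : Type*} [Field k] {p e : ℕ} {T T' : Triplet k}

theorem invSpade_le_of_words_le (h : invSpade p e T ≠ zeroPair) (h' : invSpade p e T' ≠ zeroPair)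
    (hA : wordA p e T' ≤ wordA p e T) (hB : wordB p e T' ≤ wordB p e T) :
    invSpade p e T' ≤ invSpade p e T := by
  rw [invSpade_eq h, invSpade_eq h']
  exact Prod.Lex.toLex_mono ⟨min_le_min hA hB, max_le_max hA hB⟩

theorem invSpade_lt_of_wordA_lt (h : invSpade p e T ≠ zeroPair) (h' : invSpade p e T' ≠ zeroPair)
    (hA : wordA p e T' < wordA p e T) (hB : wordA p e T' < wordB p e T) :
    invSpade p e T' < invSpade p e T := by
  apply lt_of_fst_lt
  rw [invSpade_eq h, invSpade_eq h']
  exact (min_le_left _ _).trans_lt (lt_min hA hB)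

theorem bdry_eq_of_mem (hT : InMonomialCase p e T) {D : ℕ} (hD : D ∈ T.bdry) :
    T.bdry = {D} ∨ ∃ E, E ≠ D ∧ T.bdry = {D, E} := by
  by_cases h : ∃ E ∈ T.bdry, E ≠ D
  · obtain ⟨E, hE, hED⟩ := h
    right
    refine ⟨E, hED, (Finset.eq_of_subset_of_card_le ?_ ?_).symm⟩
    · intro F hF
      rw [Finset.mem_insert, Finset.mem_singleton] at hF
      rcases hF with rfl | rfl <;> assumption
    · rw [Finset.card_pair hED.symm]
      exact hT.2.some.card_le
  · left
    push Not at h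
    exact Finset.eq_singleton_iff_unique_mem.2 ⟨hD, h⟩

variable [IsAlgClosed k] [ExpChar k p]

theorem lt_invSpade_of_pairLtWord (hT : InMonomialCase p e T) (h : invSpade p e T ≠ zeroPair)
    {S : WordPair} (hS : PairLtWord S [invHeart p e T]) : S < invSpade p e T :=
  lt_of_fst_lt (lt_of_lt_of_le hS (invHeart_le_fst hT h))

theorem zeroPair_lt (hT : InMonomialCase p e T) (h : invSpade p e T ≠ zeroPair) :
    zeroPair < invSpade p e T :=
  lt_invSpade_of_pairLtWord hT h (singleton_lt_singleton.2 (invHeart_pos hT h).1)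

/-- The invariant `inv_♠` can only jump up if no old component passes through the new point. -/
theorem bdry_eq_singleton_of_jump (hT : InMonomialCase p e T) (hT' : InMonomialCase p e T')
    (h0 : invSpade p e T ≠ zeroPair) (htr : IsTransform T T' (maximalIdeal (Loc k)))
    (hjump : invSpade p e T < invSpade p e T') :
    ∃ N, T'.bdry = {N} ∧ IsBad p e T' (.gen N) ∧
      (singDim T ≠ 1 → wRho p e T' N < 2 * invHeart p e T) := by
  classical
  obtain ⟨hpos, hne, -, -⟩ := invHeart_pos hT h0
  -- the word `A` or `B` being zero at the new point is excluded by the jump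
  have hz : invSpade p e T' ≠ zeroPair := fun h =>
    lt_asymm (zeroPair_lt hT h0) (h ▸ hjump)
  obtain ⟨-, hne', -, -⟩ := invHeart_pos hT' hz
  obtain ⟨hA0, -⟩ := ne_zero_words h0
  obtain ⟨hA0', -⟩ := ne_zero_words hz
  -- no letter of the new words is smaller than `inv_♡(P)`
  have hge : ¬ ((∃ D ∈ badDivisors p e T', wRho p e T' D < invHeart p e T) ∨
      mu T' .pt - ordTight p e T' < invHeart p e T) := fun h =>
    lt_asymm hjump (lt_invSpade_of_pairLtWord hT h0 (pairLtWord_of_lt hpos h))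
  push Not at hge
  obtain ⟨hgeA, hgeB⟩ := hge
  obtain ⟨N, hbN, hcase⟩ := point_step_cases hT hT' htr
  rcases hcase with ⟨hbdry, hcase⟩ | ⟨D, hD, hDN, hbdry, hbD, hrhoD, hB, hrhoN⟩
  · have hbad : IsBad p e T' (.gen N) := by
      obtain ⟨D, hD⟩ := hne'
      obtain ⟨hD, hb⟩ := mem_badDivisors.1 hD
      rw [hbdry, Finset.mem_singleton] at hD
      rwa [hD] at hb
    refine ⟨N, hbdry, hbad, fun hs => ?_⟩
    obtain ⟨h1, h2⟩ := hcase (hbN.1 hbad)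
    obtain ⟨D, hD⟩ := hne
    rcases bdry_eq_of_mem hT (mem_badDivisors.1 hD).1 with h | ⟨E, hED, h⟩
    · linarith [h1 D h]
    · exact h2 hs hpos (by rw [h, Finset.card_pair hED.symm])
  · exfalso
    have hN' : N ∈ T'.bdry := by rw [hbdry]; simp
    have hD' : D ∈ T'.bdry := by rw [hbdry]; simp
    have hBT : mu T .pt - ordTight p e T = (mu T .pt - invH p e T .pt) + invHeart p e T := by
      rw [invHeart]; ring
    have hgen : ∀ E ∈ T.bdry, 0 ≤ mu T (.gen E) - invH p e T (.gen E) := fun E hE =>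
      sub_nonneg.2 (invH_gen_le hT hE)
    have hsum : mu T .pt - ordTight p e T =
        ∑ E ∈ T.bdry, (mu T (.gen E) - invH p e T (.gen E)) := by
      rw [mu_pt, ordTight, Finset.sum_sub_distrib]
    have hsumD : mu T (.gen D) - invH p e T (.gen D) ≤ mu T .pt - ordTight p e T := by
      rw [hsum]
      exact Finset.single_le_sum hgen hD
    by_cases hbP : IsBad p e T .pt
    · have hbN' := hbN.2 hbP
      have hPlt : 0 < mu T .pt - invH p e T .pt := sub_pos.2 hbP
      obtain ⟨hle, heq⟩ := hrhoN hbP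
      -- the letter of the exceptional divisor is at most `δ = inv_♡(P)`, hence equal to it
      have hrN : wRho p e T' N = invHeart p e T :=
        le_antisymm hle (hgeA N (mem_badDivisors.2 ⟨hN', hbN'⟩))
      by_cases hbD0 : IsBad p e T (.gen D)
      · -- the words `A` before and after are `♡, w-ρ_D` or `w-ρ_D`, and `♡, w-ρ_D - ♡`
        have hbad' : badDivisors p e T' = {N, D} := by
          ext E
          rw [mem_badDivisors, hbdry, Finset.mem_insert, Finset.mem_singleton]
          refine ⟨fun h => h.1, fun h => ⟨h, ?_⟩⟩
          rcases h with rfl | rfl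
          exacts [hbN', hbD.2 hbD0]
        have hrD := hrhoD hbD0
        have hrDge := hgeA D (mem_badDivisors.2 ⟨hD', hbD.2 hbD0⟩)
        have hA' := wordA_pair hDN.symm hbad' hA0' (by rw [hrN]; exact hrDge)
        refine lt_asymm hjump (invSpade_lt_of_wordA_lt h0 hz ?_ ?_)
        · have hsingle : badDivisors p e T = {D} → wordA p e T' < wordA p e T := by
            intro h
            rw [wordA_singleton h hA0, hA', List.cons_lt_cons_iff]
            left; linarith
          rcases bdry_eq_of_mem hT hD with h | ⟨E, hED, h⟩
          · apply hsingle
            ext F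
            rw [mem_badDivisors, h, Finset.mem_singleton]
            exact ⟨fun h => h.1, fun h => ⟨h, h ▸ hbD0⟩⟩
          · have hE : E ∈ T.bdry := by rw [h]; simp
            by_cases hbE : IsBad p e T (.gen E)
            · have hbad : badDivisors p e T = {E, D} := by
                ext F
                rw [mem_badDivisors, h, Finset.mem_insert, Finset.mem_singleton, Finset.mem_insert,
                  Finset.mem_singleton, or_comm]
                refine ⟨fun h => h.1, fun h => ⟨h, ?_⟩⟩
                rcases h with rfl | rfl <;> assumption
              have hrE := heq hrN E hE hED hbE
              rw [wordA_pair hED hbad hA0 (by rw [hrE]; linarith), hA', hrE, hrN,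
                List.cons_lt_cons_iff]
              refine Or.inr ⟨rfl, singleton_lt_singleton.2 ?_⟩
              linarith
            · apply hsingle
              ext F
              rw [mem_badDivisors, h, Finset.mem_insert, Finset.mem_singleton, Finset.mem_singleton]
              refine ⟨?_, fun h => ⟨Or.inl h, h ▸ hbD0⟩⟩
              rintro ⟨rfl | rfl, hF⟩
              · rfl
              · exact absurd hF hbE
        · rw [hA', wordB, List.cons_lt_cons_iff]
          left; linarith
      · -- only the other component is bad, and `A` does not change
        have hbad' : badDivisors p e T' = {N} := by
          ext E
          rw [mem_badDivisors, hbdry, Finset.mem_insert, Finset.mem_singleton, Finset.mem_singleton]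
          refine ⟨?_, fun h => ⟨Or.inl h, h ▸ hbN'⟩⟩
          rintro ⟨rfl | rfl, hE⟩
          · rfl
          · exact absurd (hbD.1 hE) hbD0
        refine not_lt.2 (invSpade_le_of_words_le h0 hz ?_ ?_) hjump
        · rw [wordA_singleton hbad' hA0', hrN]
          exact (invHeart_le_words hT h0).1
        · rw [wordB, wordB, singleton_le_singleton, hB, invH_gen_eq hT hD hbD0]
          linarith
    · have hPeq : invH p e T .pt = mu T .pt := invH_pt_eq hT hbP
      have hbN' : ¬ IsBad p e T' (.gen N) := fun h => hbP (hbN.1 h)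
      have hbD' : IsBad p e T' (.gen D) := by
        obtain ⟨E, hE⟩ := hne'
        obtain ⟨hE, hb⟩ := mem_badDivisors.1 hE
        rw [hbdry, Finset.mem_insert, Finset.mem_singleton] at hE
        rcases hE with rfl | rfl
        · exact absurd hb hbN'
        · exact hb
      have hbD0 := hbD.1 hbD'
      have hbad' : badDivisors p e T' = {D} := by
        ext E
        rw [mem_badDivisors, hbdry, Finset.mem_insert, Finset.mem_singleton]
        refine ⟨?_, fun h => ⟨Or.inr h, h ▸ hbD'⟩⟩
        rintro ⟨rfl | rfl, hE⟩
        · exact absurd hE hbN'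
        · rfl
      -- `B` can only stay equal if `D` is the only bad component
      have hbad : badDivisors p e T = {D} := by
        ext E
        rw [mem_badDivisors, Finset.mem_singleton]
        refine ⟨fun ⟨hE, hb⟩ => ?_, fun h => ⟨h ▸ hD, h ▸ hbD0⟩⟩
        by_contra hED
        have h1 := Finset.sum_le_sum_of_subset_of_nonneg (s := {D, E}) (t := T.bdry)
          (f := fun E => mu T (.gen E) - invH p e T (.gen E)) (by
            intro F hF
            rw [Finset.mem_insert, Finset.mem_singleton] at hF
            rcases hF with rfl | rfl <;> assumption) (fun i hi _ => hgen i hi)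
        rw [Finset.sum_pair (Ne.symm hED), ← hsum] at h1
        have h2 : 0 < mu T (.gen E) - invH p e T (.gen E) := sub_pos.2 hb
        linarith
      refine not_lt.2 (invSpade_le_of_words_le h0 hz ?_ ?_) hjump
      · rw [wordA_singleton hbad' hA0', wordA_singleton hbad hA0, singleton_le_singleton,
          hrhoD hbD0]
        linarith
      · rw [wordB, wordB, singleton_le_singleton, hB]
        linarith

/-- After a jump, the word `A` at a point with one component does not grow until the second component
appears. -/
theorem wRho_step (hT : InMonomialCase p e T) (hT' : InMonomialCase p e T')
    (hstep : AlgorithmStep p e T T') (h0' : invSpade p e T' ≠ zeroPair)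
    (hconf : ¬ (Config4 p e T' ∨ Config5 p e T')) {D : ℕ} (hD : T.bdry = {D})
    (hb : IsBad p e T (.gen D)) :
    ∃ N, T'.bdry = {N} ∧ IsBad p e T' (.gen N) ∧ wRho p e T' N ≤ wRho p e T D := by
  classical
  obtain ⟨-, hne', -, -⟩ := invHeart_pos hT' h0'
  have hDT : D ∈ T.bdry := by rw [hD]; exact Finset.mem_singleton_self _
  rcases hstep.2 with ⟨-, c, hc, htr⟩ | ⟨-, htr⟩
  · obtain ⟨-, f, -, himg, hf⟩ := curve_step_invariants hT hT' hc htr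
    obtain ⟨h1, h2⟩ := hf D hDT
    exact ⟨f D, by rw [himg, hD, Finset.image_singleton], h1.2 hb, (h2 hb).le⟩
  · obtain ⟨N, hbN, hcase⟩ := point_step_cases hT hT' htr
    rcases hcase with ⟨hbdry, hcase⟩ | ⟨E, -, hEN, hbdry, -⟩
    · have hbad : IsBad p e T' (.gen N) := by
        obtain ⟨E, hE⟩ := hne'
        obtain ⟨hE, hb⟩ := mem_badDivisors.1 hE
        rw [hbdry, Finset.mem_singleton] at hE
        rwa [hE] at hb
      refine ⟨N, hbdry, hbad, ((hcase (hbN.1 hbad)).1 D hD).trans ?_⟩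
      exact invHeart_le_wRho hT (mem_badDivisors.2 ⟨hDT, hb⟩)
    · exfalso
      have h2 : T'.bdry.card = 2 := by rw [hbdry, Finset.card_pair hEN.symm]
      have h3 : (badDivisors p e T').card ≤ 2 := h2 ▸ Finset.card_le_card (Finset.filter_subset _ _)
      have h4 := hne'.card_pos
      apply hconf
      rw [Config4, Config5]
      omega

/-- If the second component appears while `w-ρ_D < 2 δ`, then `inv_♠` drops below `δ`. -/
theorem pairLtWord_of_step (hT : InMonomialCase p e T) (hT' : InMonomialCase p e T')
    (hstep : AlgorithmStep p e T T') (hcard : T'.bdry.card = 2) {D : ℕ} (hD : T.bdry = {D})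
    (hb : IsBad p e T (.gen D)) {δ : ℚ} (hδ : 0 < δ) (hlt : wRho p e T D < 2 * δ) :
    PairLtWord (invSpade p e T') [δ] := by
  classical
  rcases hstep.2 with ⟨-, c, hc, htr⟩ | ⟨-, htr⟩
  · obtain ⟨-, f, -, himg, -⟩ := curve_step_invariants hT hT' hc htr
    rw [himg, hD, Finset.image_singleton, Finset.card_singleton] at hcard
    omega
  · obtain ⟨N, hbN, hcase⟩ := point_step_cases hT hT' htr
    rcases hcase with ⟨hbdry, -⟩ | ⟨E, hE, hEN, hbdry, hbE, hrhoE, hB, hrhoN⟩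
    · rw [hbdry, Finset.card_singleton] at hcard
      omega
    · rw [hD, Finset.mem_singleton] at hE
      subst hE
      have hN' : N ∈ T'.bdry := by rw [hbdry]; simp
      have hE' : E ∈ T'.bdry := by rw [hbdry]; simp
      apply pairLtWord_of_lt hδ
      -- the letters add up to at most `w-ρ_D < 2 δ`
      rcases lt_or_ge (wRho p e T' E) δ with h | h
      · exact Or.inl ⟨E, mem_badDivisors.2 ⟨hE', hbE.2 hb⟩, h⟩
      · rw [hrhoE hb] at h
        by_cases hbP : IsBad p e T .pt
        · refine Or.inl ⟨N, mem_badDivisors.2 ⟨hN', hbN.2 hbP⟩, ?_⟩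
          linarith [(hrhoN hbP).1]
        · right
          have h1 : mu T .pt = mu T (.gen E) := by rw [mu_pt, hD, Finset.sum_singleton]
          have h2 : ordTight p e T = invH p e T (.gen E) := by
            rw [ordTight, hD, Finset.sum_singleton]
          have h3 := invH_pt_eq hT hbP
          rw [invHeart] at h
          linarith

end Jump

end KM

end

theorem proposition7 {k : Type*} [Field k] [IsAlgClosed k] (p : ℕ) [ExpChar k p] (e n : ℕ)
    (T : ℕ → KM.Triplet k)
    (hmon : ∀ i ≤ n, KM.InMonomialCase p e (T i))
    (hstep : ∀ i < n, KM.AlgorithmStep p e (T i) (T (i + 1)))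
    (hn : 0 < n)
    (hjump : KM.invSpade p e (T 0) < KM.invSpade p e (T 1))
    (hfirst : ∀ i, 0 < i → i < n → ¬ (KM.Config4 p e (T i) ∨ KM.Config5 p e (T i)))
    (hlast : KM.Config4 p e (T n) ∨ KM.Config5 p e (T n)) :
    KM.PairGtWord (KM.invSpade p e (T 0)) [KM.invHeart p e (T 0)] ∧
      KM.PairLtWord (KM.invSpade p e (T n)) [KM.invHeart p e (T 0)] ∧
      KM.invSpade p e (T n) < KM.invSpade p e (T 0) := by
  have hT0 := hmon 0 hn.le
  have h0 := (hstep 0 hn).1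
  have hpos := (KM.invHeart_pos hT0 h0).1
  have hlt : KM.PairLtWord (KM.invSpade p e (T n)) [KM.invHeart p e (T 0)] := by
    have hcard : (T n).bdry.card = 2 := hlast.elim And.left And.left
    obtain ⟨N, hN, hbN, hrN⟩ : ∃ N, (T 1).bdry = {N} ∧ KM.IsBad p e (T 1) (.gen N) ∧
        KM.wRho p e (T 1) N < 2 * KM.invHeart p e (T 0) := by
      rcases (hstep 0 hn).2 with ⟨-, c, hc, htr⟩ | ⟨hs, htr⟩
      · exact absurd (KM.curve_step_invariants hT0 (hmon 1 hn) hc htr).1 hjump.ne'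
      · obtain ⟨N, h1, h2, h3⟩ := KM.bdry_eq_singleton_of_jump hT0 (hmon 1 hn) h0 htr hjump
        exact ⟨N, h1, h2, h3 hs⟩
    have key : ∀ i, 1 + i < n → ∃ D, (T (1 + i)).bdry = {D} ∧
        KM.IsBad p e (T (1 + i)) (.gen D) ∧
        KM.wRho p e (T (1 + i)) D < 2 * KM.invHeart p e (T 0) := by
      intro i
      induction i with
      | zero => exact fun _ => ⟨N, hN, hbN, hrN⟩
      | succ i ih =>
        intro hi
        obtain ⟨D, hD, hb, hr⟩ := ih (by omega)
        obtain ⟨N, h1, h2, h3⟩ := KM.wRho_step (hmon _ (by omega)) (hmon _ hi.le)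
          (hstep (1 + i) (by omega)) (hstep _ hi).1 (hfirst _ (by omega) hi) hD hb
        exact ⟨N, h1, h2, h3.trans_lt hr⟩
    -- there is one component after the jump, but two at the last point
    have hn1 : n ≠ 1 := by
      rintro rfl
      rw [hN, Finset.card_singleton] at hcard
      omega
    obtain ⟨i, rfl⟩ : ∃ i, n = 1 + i + 1 := ⟨n - 2, by omega⟩
    obtain ⟨D, hD, hb, hr⟩ := key i (by omega)
    exact KM.pairLtWord_of_step (hmon _ (by omega)) (hmon _ le_rfl) (hstep _ (by omega)) hcard
      hD hb hpos hr
  refine ⟨?_, hlt, KM.lt_invSpade_of_pairLtWord hT0 h0 hlt⟩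
  rcases (KM.invHeart_le_fst hT0 h0).lt_or_eq with h | h
  · exact Or.inl h
  · exact Or.inr ⟨h.symm, fun h => hpos.ne' (by simpa using h)⟩
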